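/- **Conventions.** Let $d\ge 1$, $\mathbb T^d=(\mathbb R/\mathbb Z)^d$, and for $n\in\mathbb Z^d$ put $|n|=\sum_j|n_j|$; for $x\in\mathbb R$ let $\|x\|_{\mathbb T}=\min_{j\in\mathbb Z}|x-j|$. Let $\alpha\in\mathbb R^d$ with $(1,\alpha)$ rationally independent, and $$\beta=\beta(\alpha)=\limsup_{|k|\to\infty}\frac1{|k|}\ln\frac1{\|\langle k,\alpha\rangle\|_{\mathbb T}}\in[0,\infty].$$ For $V\in C^\omega(\mathbb T^d,\mathbb R)$ and $\theta\in\mathbb T^d$ let $H_{V,\alpha,\theta}$ be the operator $(H_{V,\alpha,\theta}u)_n=u_{n+1}+u_{n-1}+V(\theta+n\alpha)u_n$ on $\ell^2(\mathbb Z)$, and let $\Sigma_{V,\alpha}\subset\mathbb R$ be its spectrum (independent of $\theta$). A *spectral gap* is a bounded connected component $G=(a,b)$ of $\mathbb R\setminus\Sigma_{V,\alpha}$; its edge points are $a,b$ and $|G|=b-a$. Let $S_E^V(x)=\begin{pmatrix}E-V(x)&-1\\1&0\end{pmatrix}$. For $R>0$, an element of $C^\omega_R(\mathbb T^d,\mathrm{PSL}(2,\mathbb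 R))$ is a map $X$ that lifts to a map $\mathbb R^d\to \mathrm{SL}(2,\mathbb R)$, $\mathbb Z^d$-periodic up to sign, with a bounded holomorphic extension to $\{z\in\mathbb C^d:|\mathrm{Im}\,z_j|<R\ \forall j\}$; $|X|_R$ is the supremum over this strip of the operator norm (induced by the Euclidean norm) of the extension. For $R>3\beta$ let $$D_{\alpha,R}=2+40\sum_{n\in\mathbb Z^d\setminus\{0\}}\frac{e^{-(R+3\beta)|n|/2}}{|e^{2\pi \mathrm i\langle n,\alpha\rangle}-1|^3}<\infty,$$ and for $\tau>d-1$ let $D_\tau=2^{4\tau+9}\,\Gamma(4\tau+2)$. For $\gamma>0$, $\alpha\in \mathrm{DC}_d(\gamma,\tau)$ means $\|\langle n,\alpha\rangle\|_{\mathbb T}>\gamma|n|^{-\tau}$ for all $n\in\mathbb Z^d\setminus\{0\}$. **Theorem.** Let $R>3\beta(\alpha)\ge 0$, $\kappa\in(0,\frac14)$, and let $V\in C^\omega(\mathbb T^d,\mathbb R)$ be non-constant. Let $E$ be an edge point of a spectral gap $G(V)$ of $H_{V,\alpha,\theta}$. Assume that there are $\zeta\in(0,\frac12)$ and $X\in C^\omega_R(\mathbb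 T^d,\mathrm{PSL}(2,\mathbb R))$ such that, in $\mathrm{PSL}(2,\mathbb R)$ (that is, up to sign), $$X(\cdot+\alpha)^{-1}S_E^V(\cdot)X(\cdot)=\begin{pmatrix}1&\zeta\\0&1\end{pmatrix}.$$ 1. If $|X|_R^{14}\,\zeta^\kappa\le 10^{-5}D_{\alpha,R}^{-4}$, then $\zeta^{1+\kappa}\le|G(V)|\le\zeta^{1-\kappa}$. 2. If $\gamma>0$, $\tau>d-1$, $\alpha\in\mathrm{DC}_d(\gamma,\tau)$ and $|X|_R^{14}\,\zeta^\kappa\le 10^{-5}D_\tau^{-4}\gamma^{12}R^{4(4\tau+1)}$, then $\zeta^{1+\kappa}\le|G(V)|\le\zeta^{1-\kappa}$. -/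

import Mathlib

noncomputable section

namespace QPSchrodinger

open Filter

/-! Functions on the torus `𝕋^d = (ℝ/ℤ)^d` are represented by `ℤ^d`-periodic functions on `ℝ^d`,
and points of the torus by representatives in `ℝ^d`. -/

/-- The integer vector `n`, seen in `ℝ^d`. -/
def intVec {d : ℕ} (n : Fin d → ℤ) : Fin d → ℝ := fun j => (n j : ℝ)

/-- The pairing `⟨n, x⟩ = ∑ j, n_j x_j`. -/
def pair {d : ℕ} (n : Fin d → ℤ) (x : Fin d → ℝ) : ℝ := ∑ j, (n j : ℝ) * x j

/-- The length `|n| = ∑ j, |n_j|` of an integer vector. -/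
def len {d : ℕ} (n : Fin d → ℤ) : ℝ := ∑ j, |(n j : ℝ)|

/-- The distance `‖x‖_𝕋` of a real number to the nearest integer. -/
def distInt (x : ℝ) : ℝ := |x - round x|

/-- `(1, α)` is rationally independent. -/
def RationallyIndependent {d : ℕ} (α : Fin d → ℝ) : Prop :=
  ∀ (n : Fin d → ℤ) (m : ℤ), pair n α = (m : ℝ) → n = 0

/-- `β(α) = limsup_{|k| → ∞} (1/|k|) ln (1/‖⟨k, α⟩‖_𝕋)`, as an extended real number. -/
def beta {d : ℕ} (α : Fin d → ℝ) : EReal :=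
  limsup (fun k : Fin d → ℤ => ((1 / len k * Real.log (1 / distInt (pair k α)) : ℝ) : EReal))
    cofinite

/-- The Diophantine class `DC_d(γ, τ)`. -/
def Diophantine {d : ℕ} (γ τ : ℝ) (α : Fin d → ℝ) : Prop :=
  ∀ n : Fin d → ℤ, n ≠ 0 → γ / len n ^ τ < distInt (pair n α)

/-- `D_{α,R} = 2 + 40 ∑_{n ≠ 0} e^{-(R+3β(α))|n|/2} / |e^{2πi⟨n,α⟩} - 1|³`
(a convergent series when `(1, α)` is rationally independent and `R > 3β(α)`). -/
def DConst {d : ℕ} (α : Fin d → ℝ) (R : ℝ) : ℝ :=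
  2 + 40 * ∑' n : {n : Fin d → ℤ // n ≠ 0},
    Real.exp (-((R + 3 * (beta α).toReal) * len n.1 / 2)) /
      ‖Complex.exp (2 * Real.pi * Complex.I * (pair n.1 α : ℂ)) - 1‖ ^ 3

/-- `D_τ = 2^{4τ+9} Γ(4τ+2)`. -/
def DTau (τ : ℝ) : ℝ := (2 : ℝ) ^ (4 * τ + 9) * Real.Gamma (4 * τ + 2)

/-- An element of `C^ω(𝕋^d, ℝ)`. -/
structure AnalyticPotential (d : ℕ) where
  toFun : (Fin d → ℝ) → ℝ
  analytic : AnalyticOnNhd ℝ toFun Set.univ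
  periodic : ∀ (n : Fin d → ℤ) (x : Fin d → ℝ), toFun (x + intVec n) = toFun x

theorem AnalyticPotential.exists_bound {d : ℕ} (V : AnalyticPotential d) :
    ∃ C : ℝ, ∀ x, |V.toFun x| ≤ C := by
  have hc : Continuous V.toFun := continuousOn_univ.mp V.analytic.continuousOn
  obtain ⟨C, hC⟩ := (isCompact_Icc (a := (0 : Fin d → ℝ)) (b := 1)).exists_bound_of_continuousOn
    hc.continuousOn
  refine ⟨C, fun x => ?_⟩
  have hx : V.toFun x = V.toFun (fun j => Int.fract (x j)) := by
    rw [← V.periodic (fun j => ⌊x j⌋) (fun j => Int.fract (x j))]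
    congr 1
    funext j
    simp [intVec]
  rw [hx]
  exact hC _ ⟨fun j => Int.fract_nonneg _, fun j => (Int.fract_lt_one _).le⟩

/-- The complex Hilbert space `ℓ²(ℤ)`. -/
abbrev EllTwo : Type := lp (fun _ : ℤ => ℂ) 2

theorem memℓp_shift (u : EllTwo) (m : ℤ) : Memℓp (fun n : ℤ => u (n + m)) 2 := by
  refine memℓp_gen ?_
  have h := (lp.memℓp u).summable (by norm_num)
  exact (Equiv.addRight m).summable_iff.mpr h

theorem memℓp_mul {v : ℤ → ℝ} {C : ℝ} (hv : ∀ n, |v n| ≤ C) (u : EllTwo) :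
    Memℓp (fun n : ℤ => (v n : ℂ) * u n) 2 := by
  refine ((lp.memℓp u).const_smul (C : ℂ)).mono' (fun n => ?_)
  have hC : 0 ≤ C := (abs_nonneg _).trans (hv n)
  simp only [Pi.smul_apply, smul_eq_mul, norm_mul, Complex.norm_real, Real.norm_eq_abs]
  rw [abs_of_nonneg hC]
  exact mul_le_mul_of_nonneg_right (hv n) (norm_nonneg _)

/-- The translation `(T_m u)_n = u_{n+m}` on `ℓ²(ℤ)`. -/
def shift (m : ℤ) : EllTwo →L[ℂ] EllTwo :=
  LinearMap.mkContinuous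
    { toFun := fun u => ⟨fun n => u (n + m), memℓp_shift u m⟩
      map_add' := fun _ _ => rfl
      map_smul' := fun _ _ => rfl } 1 (by
    intro u
    rw [one_mul]
    refine lp.norm_le_of_tsum_le (by norm_num) (norm_nonneg _) ?_
    rw [lp.norm_rpow_eq_tsum (by norm_num) u]
    exact le_of_eq ((Equiv.addRight m).tsum_eq (fun n => ‖u n‖ ^ (2 : ENNReal).toReal)))

/-- Multiplication by a bounded real sequence on `ℓ²(ℤ)`. -/
def mulSeq (v : ℤ → ℝ) (hv : ∃ C : ℝ, ∀ n, |v n| ≤ C) : EllTwo →L[ℂ] EllTwo :=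
  LinearMap.mkContinuous
    { toFun := fun u => ⟨fun n => (v n : ℂ) * u n, memℓp_mul hv.choose_spec u⟩
      map_add' := fun u w => by
        ext n
        exact mul_add _ _ _
      map_smul' := fun c u => by
        ext n
        exact mul_left_comm _ _ _ } hv.choose (by
    intro u
    have hC : 0 ≤ hv.choose := (abs_nonneg _).trans (hv.choose_spec 0)
    have h : ‖(⟨fun n => (v n : ℂ) * u n, memℓp_mul hv.choose_spec u⟩ : EllTwo)‖
        ≤ ‖(hv.choose : ℂ) • u‖ := by
      refine lp.norm_mono (by norm_num) (fun n => ?_)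
      simp only [lp.coeFn_smul, Pi.smul_apply, smul_eq_mul, norm_mul, Complex.norm_real,
        Real.norm_eq_abs]
      rw [abs_of_nonneg hC]
      exact mul_le_mul_of_nonneg_right (hv.choose_spec n) (norm_nonneg _)
    refine h.trans (le_of_eq ?_)
    rw [norm_smul, Complex.norm_real, Real.norm_eq_abs, abs_of_nonneg hC])

/-- The quasi-periodic Schrödinger operator
`(H_{V,α,θ} u)_n = u_{n+1} + u_{n-1} + V(θ + nα) u_n` on `ℓ²(ℤ)`. -/
def schrodinger {d : ℕ} (V : AnalyticPotential d) (α θ : Fin d → ℝ) : EllTwo →L[ℂ] EllTwo :=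
  shift 1 + shift (-1) +
    mulSeq (fun n : ℤ => V.toFun (θ + (n : ℝ) • α))
      ⟨V.exists_bound.choose, fun _ => V.exists_bound.choose_spec _⟩

/-- The spectrum of `H_{V,α,θ}`, as a subset of the real line (the operator is self-adjoint). -/
def spec {d : ℕ} (V : AnalyticPotential d) (α θ : Fin d → ℝ) : Set ℝ :=
  {E | (E : ℂ) ∈ spectrum ℂ (schrodinger V α θ)}

/-- `(a, b)` is a spectral gap: a (non-empty) bounded connected component of the complement of
the closed set `S`. -/
def IsSpectralGap (S : Set ℝ) (a b : ℝ) : Prop :=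
  a < b ∧ a ∈ S ∧ b ∈ S ∧ ∀ E ∈ Set.Ioo a b, E ∉ S

/-- The Schrödinger cocycle `S_E^V(x)`. -/
def cocycle {d : ℕ} (V : AnalyticPotential d) (E : ℝ) (x : Fin d → ℝ) :
    Matrix (Fin 2) (Fin 2) ℝ :=
  !![E - V.toFun x, -1; 1, 0]

/-- The complex strip `{z ∈ ℂ^d : |Im z_j| < R for all j}`. -/
def strip (d : ℕ) (R : ℝ) : Set (Fin d → ℂ) := {z | ∀ j, |(z j).im| < R}

/-- The Euclidean operator norm of a complex `2 × 2` matrix. -/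
def opNorm (A : Matrix (Fin 2) (Fin 2) ℂ) : ℝ :=
  ‖Matrix.toEuclideanCLM (n := Fin 2) (𝕜 := ℂ) A‖

/-- Equality of matrices up to sign, that is, in `PSL(2, ℝ)` for elements of `SL(2, ℝ)`. -/
def EqUpToSign (A B : Matrix (Fin 2) (Fin 2) ℝ) : Prop := A = B ∨ A = -B

/-- An element of `C^ω_R(𝕋^d, PSL(2, ℝ))`: a map given by a lift `ℝ^d → SL(2, ℝ)`, which is
`ℤ^d`-periodic up to sign, together with a bounded holomorphic extension of the lift to the strip
`strip d R` (only the values of `ext` in the strip matter). -/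
structure AnalyticPSL (d : ℕ) (R : ℝ) where
  lift : (Fin d → ℝ) → Matrix.SpecialLinearGroup (Fin 2) ℝ
  periodic : ∀ (n : Fin d → ℤ) (x : Fin d → ℝ), EqUpToSign (lift (x + intVec n)).1 (lift x).1
  ext : (Fin d → ℂ) → Matrix (Fin 2) (Fin 2) ℂ
  ext_ofReal : ∀ (x : Fin d → ℝ) (i j : Fin 2),
    ext (fun l => (x l : ℂ)) i j = (((lift x).1 i j : ℝ) : ℂ)
  holomorphic : ∀ i j : Fin 2, DifferentiableOn ℂ (fun z => ext z i j) (strip d R)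
  bounded : ∃ C : ℝ, ∀ z ∈ strip d R, opNorm (ext z) ≤ C

/-- `|X|_R`, the supremum over the strip of the norm of (the extension of) `X`. -/
def AnalyticPSL.norm {d : ℕ} {R : ℝ} (X : AnalyticPSL d R) : ℝ :=
  ⨆ z : strip d R, opNorm (X.ext z.1)

/-- `X(· + α)⁻¹ A(·) X(·) = B` in `PSL(2, ℝ)`. -/
def Conjugates {d : ℕ} {R : ℝ} (X : AnalyticPSL d R) (α : Fin d → ℝ)
    (A : (Fin d → ℝ) → Matrix (Fin 2) (Fin 2) ℝ) (B : Matrix (Fin 2) (Fin 2) ℝ) : Prop :=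
  ∀ x : Fin d → ℝ, EqUpToSign ((X.lift (x + α))⁻¹.1 * A x * (X.lift x).1) B

end QPSchrodinger

end

/-!
A conjugacy of the Schrödinger cocycle at a gap edge `E` to the parabolic matrix with entry `ζ`
determines the spectrum near `E` up to second order, because one averaging step already decides
whether the cocycle at energy `E - δ` is elliptic or hyperbolic.

Along the orbit of `θ`, the first row of the conjugacy `X` gives a bounded solution `φ` of
`H φ = E φ` and a bounded sequence `ψ` solving the same equation up to a term of size `ζ`, with
Wronskian one. In the frame of `X` the cocycle at energy `E - δ` is the parabolic matrix plus `δ`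
times a quadratic expression in `φ`, `ψ`. Solving the cohomological equations for `φ²`, `ψ²`, `φψ`
replaces these products by their means `a`, `b`, `c`, at the cost of errors of second order. All
this is recorded in `EdgeData`. The Wronskian identity bounds `a` and `ab - c²` from below
(`EdgeData.le_a`, `EdgeData.le_gram`), and the averaged generator has determinant
`δ² (ab - c²) - δ a ζ`.

* Where this determinant is nonnegative, the averaged cocycle has a bounded orbit, which transported
  back is a bounded approximate solution whose defect is much smaller than `|δ|`
  (`EdgeData.exists_quasimode`). Truncating it produces spectrum within `|δ|` of `E - δ`
  (`EdgeData.exists_spec_of_elliptic`). For `δ < 0` this shows that `E` is the upper edge of its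
  gap, and for `δ = ζ^{1-κ} / 2` that the gap is no longer than `ζ^{1-κ}`.
* For `0 < δ < ζ^{1+κ}` a quadratic form in the frame of `X`, corrected to first order by the
  cohomological solutions, increases along every orbit (`lyapunov_step`). Summing over `ℤ` shows
  that `H - E + δ` is bounded below (`EdgeData.bounded_below`), so that the gap has length at least
  `ζ^{1+κ}`.

These estimates are combined in `EdgeData.gap_bounds`, under a smallness condition in terms of
`|X|_R` and any bound `L ≥ 1` for the small divisor series `∑ e^{-5R|n|} / |e^{2πi⟨n,α⟩} - 1|`. The
rate `5R` comes from moving the contour of integration for the `n`-th Fourier coefficient almost to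
the boundary of the strip (`exists_fourier_expansion`). The series is bounded by `D_{α,R}` in
general and by `T = D_τ γ⁻³ R^{-(4τ+1)}` in the Diophantine case.

In the Diophantine case with `T < 1`, that is, for large `R`, the hypothesis by itself does not make
`ζ` small. Here one uses that `X₁₁` has a zero: otherwise its modulus would be a positive (or
alternating) solution, `E` would be an extreme point of the spectrum, hence isolated, hence an
eigenvalue, which is impossible since `φ` is not square summable (`Conjugates.exists_zero`).
Since `X₁₁²` oscillates by at most `2 |X|_R² e^{-2R}`, the first column of `X` is tiny, and
`det X = 1` forces `e^{2R} ≤ 8 |X|_R⁴` (`AnalyticPSL.exp_le_norm_pow`). This compensates for the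
factor `T⁻⁴`.
-/

noncomputable section

namespace QPSchrodinger

open Filter

/-! ### Orbit data of a parabolic normal form, and the Lyapunov form -/

/-- The orbit data of a parabolic normal form of the Schrödinger cocycle at energy `E`. The
sequences `φ`, `ψ` are the first-row entries of the conjugacy along the orbit: `φ` is a bounded
solution of the eigenvalue equation, `ψ` solves it up to the parabolic defect `ζ`, and
`wronskian` is the determinant condition. The numbers `a`, `b`, `c` are the means of `φ²`, `ψ²`,
`φψ`, and `y₁`, `y₂`, `y₃` the bounded solutions of the corresponding cohomological equations. -/
structure EdgeData (v : ℤ → ℝ) (E ζ M K : ℝ) where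
  φ : ℤ → ℝ
  ψ : ℤ → ℝ
  a : ℝ
  b : ℝ
  c : ℝ
  y₁ : ℤ → ℝ
  y₂ : ℤ → ℝ
  y₃ : ℤ → ℝ
  abs_φ : ∀ n, |φ n| ≤ M
  abs_ψ : ∀ n, |ψ n| ≤ M
  abs_y₁ : ∀ n, |y₁ n| ≤ K
  abs_y₂ : ∀ n, |y₂ n| ≤ K
  abs_y₃ : ∀ n, |y₃ n| ≤ K
  solution_φ : ∀ n, φ (n + 1) + φ (n - 1) + v n * φ n = E * φ n
  solution_ψ : ∀ n, ψ (n + 1) + ψ (n - 1) + v n * ψ n = E * ψ n + ζ * (φ (n - 1) - φ (n + 1))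
  wronskian : ∀ n, φ (n + 1) * (ψ n - ζ * φ n) - ψ (n + 1) * φ n = 1
  step_y₁ : ∀ n, y₁ (n + 1) - y₁ n = φ n ^ 2 - a
  step_y₂ : ∀ n, y₂ (n + 1) - y₂ n = ψ n ^ 2 - b
  step_y₃ : ∀ n, y₃ (n + 1) - y₃ n = φ n * ψ n - c

/-- A bounded sequence cannot increase by a fixed positive amount at each step. -/
theorem nonpos_of_bounded_of_le_step {z : ℤ → ℝ} {C η : ℝ} (hz : ∀ n, |z n| ≤ C)
    (h : ∀ n, η ≤ z (n + 1) - z n) : η ≤ 0 := by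
  by_contra! hη
  have key : ∀ N : ℕ, N * η ≤ z N - z 0 := by
    intro N
    induction N with
    | zero => simp
    | succ k ih =>
      have := h k
      push_cast
      linarith
  obtain ⟨N, hN⟩ := exists_nat_gt (2 * C / η)
  rw [div_lt_iff₀ hη] at hN
  have := key N
  have h1 := abs_le.1 (hz N)
  have h2 := abs_le.1 (hz 0)
  linarith

/-- The constant `m` in a cohomological equation `y (n + 1) - y n = f n - m` with bounded solution
`y` is the mean of `f`, hence at most any upper bound of `f`. -/
theorem mean_le_of_le {y f : ℤ → ℝ} {m C B : ℝ} (hy : ∀ n, |y n| ≤ C)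
    (h : ∀ n, y (n + 1) - y n = f n - m) (hf : ∀ n, f n ≤ B) : m ≤ B := by
  have := nonpos_of_bounded_of_le_step (z := fun n => - y n) (C := C) (η := m - B)
    (fun n => by simpa using hy n) (fun n => by linarith [h n, hf n])
  linarith

theorem le_mean_of_le {y f : ℤ → ℝ} {m C B : ℝ} (hy : ∀ n, |y n| ≤ C)
    (h : ∀ n, y (n + 1) - y n = f n - m) (hf : ∀ n, B ≤ f n) : B ≤ m := by
  have := nonpos_of_bounded_of_le_step (z := y) (C := C) (η := B - m)
    hy (fun n => by linarith [h n, hf n])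
  linarith

namespace EdgeData

variable {v : ℤ → ℝ} {E ζ M K : ℝ} (D : EdgeData v E ζ M K)

include D in
theorem bound_nonneg : 0 ≤ M := (abs_nonneg _).trans (D.abs_φ 0)

theorem sq_φ_le (n : ℤ) : D.φ n ^ 2 ≤ M ^ 2 :=
  sq_le_sq' (abs_le.1 (D.abs_φ n)).1 (abs_le.1 (D.abs_φ n)).2

theorem sq_ψ_le (n : ℤ) : D.ψ n ^ 2 ≤ M ^ 2 :=
  sq_le_sq' (abs_le.1 (D.abs_ψ n)).1 (abs_le.1 (D.abs_ψ n)).2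

theorem a_le : D.a ≤ M ^ 2 := mean_le_of_le D.abs_y₁ D.step_y₁ D.sq_φ_le

theorem b_le : D.b ≤ M ^ 2 := mean_le_of_le D.abs_y₂ D.step_y₂ D.sq_ψ_le

theorem a_nonneg : 0 ≤ D.a := le_mean_of_le D.abs_y₁ D.step_y₁ fun _ => sq_nonneg _

theorem b_nonneg : 0 ≤ D.b := le_mean_of_le D.abs_y₂ D.step_y₂ fun _ => sq_nonneg _

/-- The averaged Wronskian identity, after replacing `ψ` by `ψ - t φ` and applying
`2 |x y| ≤ s x² + y² / s` pointwise. -/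
theorem one_le_means (hζ : 0 ≤ ζ) {s : ℝ} (hs : 0 < s) (t : ℝ) :
    1 ≤ (s + ζ) * D.a + (D.b - 2 * t * D.c + t ^ 2 * D.a) / s := by
  have hb : ∀ n, |(s + ζ) / 2 * (D.y₁ (n + 1) + D.y₁ n) + 1 / (2 * s) *
      ((D.y₂ (n + 1) - 2 * t * D.y₃ (n + 1) + t ^ 2 * D.y₁ (n + 1)) +
        (D.y₂ n - 2 * t * D.y₃ n + t ^ 2 * D.y₁ n))| ≤
      (s + ζ) / 2 * (K + K) + 1 / (2 * s) * ((K + 2 * |t| * K + t ^ 2 * K) +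
        (K + 2 * |t| * K + t ^ 2 * K)) := by
    intro n
    have e : ∀ n, |D.y₂ n - 2 * t * D.y₃ n + t ^ 2 * D.y₁ n| ≤ K + 2 * |t| * K + t ^ 2 * K := by
      intro n
      refine (abs_add_le _ _).trans
        (add_le_add ((abs_sub _ _).trans (add_le_add (D.abs_y₂ n) ?_)) ?_)
      · rw [abs_mul, abs_mul, abs_two]
        exact mul_le_mul_of_nonneg_left (D.abs_y₃ n) (by positivity)
      · rw [abs_mul, abs_of_nonneg (sq_nonneg t)]
        exact mul_le_mul_of_nonneg_left (D.abs_y₁ n) (by positivity)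
    refine (abs_add_le _ _).trans (add_le_add ?_ ?_)
    · rw [abs_mul, abs_of_nonneg (by positivity : 0 ≤ (s + ζ) / 2)]
      exact mul_le_mul_of_nonneg_left
        ((abs_add_le _ _).trans (add_le_add (D.abs_y₁ _) (D.abs_y₁ _))) (by positivity)
    · rw [abs_mul, abs_of_nonneg (by positivity : 0 ≤ 1 / (2 * s))]
      exact mul_le_mul_of_nonneg_left
        ((abs_add_le _ _).trans (add_le_add (e _) (e _))) (by positivity)
  have := nonpos_of_bounded_of_le_step (η := 1 - ((s + ζ) * D.a +
    (D.b - 2 * t * D.c + t ^ 2 * D.a) / s)) hb (fun n => by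
      have h1 := D.step_y₁ n
      have h2 := D.step_y₂ n
      have h3 := D.step_y₃ n
      have h1' := D.step_y₁ (n + 1)
      have h2' := D.step_y₂ (n + 1)
      have h3' := D.step_y₃ (n + 1)
      have hW := D.wronskian n
      set x := D.φ (n + 1)
      set x' := D.φ n
      set w := D.ψ (n + 1) - t * x with hw
      set w' := D.ψ n - t * x' with hw'
      -- Young's inequality for the three products in the Wronskian of `φ` and `ψ - t φ`
      have q1 : 2 * (x * w') ≤ s * x ^ 2 + 1 / s * w' ^ 2 := by
        have := mul_nonneg (one_div_pos.2 hs).le (sq_nonneg (s * x - w'))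
        have e : 1 / s * (s * x - w') ^ 2 = s * x ^ 2 + 1 / s * w' ^ 2 - 2 * (x * w') := by
          field_simp
          ring
        linarith
      have q2 : 2 * (-(w * x')) ≤ s * x' ^ 2 + 1 / s * w ^ 2 := by
        have := mul_nonneg (one_div_pos.2 hs).le (sq_nonneg (s * x' + w))
        have e : 1 / s * (s * x' + w) ^ 2 = s * x' ^ 2 + 1 / s * w ^ 2 + 2 * (w * x') := by
          field_simp
          ring
        linarith
      have q3 : 2 * (-(ζ * x * x')) ≤ ζ * x ^ 2 + ζ * x' ^ 2 := by
        nlinarith [mul_nonneg hζ (sq_nonneg (x + x'))]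
      have hW' : x * w' - ζ * x * x' - w * x' = 1 := by
        rw [← hW, hw, hw']; ring
      have e1 : D.y₂ (n + 1 + 1) - 2 * t * D.y₃ (n + 1 + 1) + t ^ 2 * D.y₁ (n + 1 + 1)
          - (D.y₂ (n + 1) - 2 * t * D.y₃ (n + 1) + t ^ 2 * D.y₁ (n + 1)) =
          w ^ 2 - (D.b - 2 * t * D.c + t ^ 2 * D.a) := by
        rw [hw]; linear_combination h2' - 2 * t * h3' + t ^ 2 * h1'
      have e2 : D.y₂ (n + 1) - 2 * t * D.y₃ (n + 1) + t ^ 2 * D.y₁ (n + 1)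
          - (D.y₂ n - 2 * t * D.y₃ n + t ^ 2 * D.y₁ n) =
          w' ^ 2 - (D.b - 2 * t * D.c + t ^ 2 * D.a) := by
        rw [hw']; linear_combination h2 - 2 * t * h3 + t ^ 2 * h1
      have e3 : (s + ζ) / 2 * (D.y₁ (n + 1 + 1) + D.y₁ (n + 1)) + 1 / (2 * s) *
          ((D.y₂ (n + 1 + 1) - 2 * t * D.y₃ (n + 1 + 1) + t ^ 2 * D.y₁ (n + 1 + 1)) +
            (D.y₂ (n + 1) - 2 * t * D.y₃ (n + 1) + t ^ 2 * D.y₁ (n + 1))) -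
          ((s + ζ) / 2 * (D.y₁ (n + 1) + D.y₁ n) + 1 / (2 * s) *
          ((D.y₂ (n + 1) - 2 * t * D.y₃ (n + 1) + t ^ 2 * D.y₁ (n + 1)) +
            (D.y₂ n - 2 * t * D.y₃ n + t ^ 2 * D.y₁ n))) =
          (s + ζ) / 2 * (x ^ 2 + x' ^ 2) + 1 / s / 2 * (w ^ 2 + w' ^ 2) -
          ((s + ζ) * D.a + (D.b - 2 * t * D.c + t ^ 2 * D.a) / s) := by
        have e4 : 1 / (2 * s) = 1 / s / 2 := by field_simp
        have e5 : (D.b - 2 * t * D.c + t ^ 2 * D.a) / s =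
          1 / s * (D.b - 2 * t * D.c + t ^ 2 * D.a) := by ring
        rw [e4, e5]
        linear_combination (s + ζ) / 2 * (h1' + h1) + 1 / s / 2 * (e1 + e2)
      rw [e3]
      linarith)
  linarith

/-- If `a` were to vanish, the averaged Wronskian identity would fail for large `s`. -/
theorem a_pos (hζ : 0 ≤ ζ) : 0 < D.a := by
  rcases D.a_nonneg.lt_or_eq with h | h
  · exact h
  have := D.one_le_means hζ (s := M ^ 2 + 1) (by positivity) 0
  rw [← h] at this
  have h2 : (D.b - 2 * 0 * D.c + 0 ^ 2 * 0) / (M ^ 2 + 1) < 1 := by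
    rw [div_lt_one (by positivity)]
    linarith [D.b_le]
  linarith

/-- The averaged Wronskian identity with `s = 2 M²` and `t = 0`. -/
theorem le_a (hζ : 0 ≤ ζ) (hM : 1 ≤ M) (h : ζ * M ^ 2 ≤ 1 / 20) : 1 / (5 * M ^ 2) ≤ D.a := by
  have := D.one_le_means hζ (s := 2 * M ^ 2) (by positivity) 0
  have h1 : (D.b - 2 * 0 * D.c + 0 ^ 2 * D.a) / (2 * M ^ 2) ≤ 1 / 2 := by
    rw [div_le_iff₀ (by positivity)]
    linarith [D.b_le]
  have h2 : ζ * D.a ≤ ζ * M ^ 2 := mul_le_mul_of_nonneg_left D.a_le hζ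
  rw [div_le_iff₀ (by positivity)]
  linarith

/-- The averaged Wronskian identity with `t = c / a`, which minimizes `b - 2 t c + t² a`, and with
`s = 1 / (2 a)`. -/
theorem le_gram (hζ : 0 ≤ ζ) (h : ζ * M ^ 2 ≤ 1 / 20) : 1 / 5 ≤ D.a * D.b - D.c ^ 2 := by
  have ha := D.a_pos hζ
  have := D.one_le_means hζ (s := 1 / (2 * D.a)) (by positivity) (D.c / D.a)
  have e : (D.b - 2 * (D.c / D.a) * D.c + (D.c / D.a) ^ 2 * D.a) / (1 / (2 * D.a)) =
      2 * (D.a * D.b - D.c ^ 2) := by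
    field_simp
    ring
  have e2 : (1 / (2 * D.a) + ζ) * D.a = 1 / 2 + ζ * D.a := by field_simp
  have h2 : ζ * D.a ≤ ζ * M ^ 2 := mul_le_mul_of_nonneg_left D.a_le hζ
  rw [e, e2] at this
  linarith

end EdgeData

/-- The error terms of the corrected quadratic form, absorbed into its main increment
`δ a P² + (ζ / 2) Q²`. -/
theorem lyapunov_absorb {ζ δ a M K P Q G H : ℝ} (hζ : 0 < ζ) (hδ : 0 < δ) (hM : 1 ≤ M)
    (hK : M ^ 2 ≤ K) (hδζ : δ ≤ ζ) (hζK : 1000 * K ^ 3 * ζ ≤ 1) (ha5 : 1 ≤ 5 * K * a)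
    (P0 : 0 ≤ P) (Q0 : 0 ≤ Q) (G0 : 0 ≤ G) (H0 : 0 ≤ H) (bH : H ≤ δ * M * (P + Q) + G) :
    G * (M * (P + Q)) + ζ * M * H * Q + (ζ * Q + 2 * M * H) * (M * H) +
      δ * (K * (2 * Q * (M * H) + (M * H) ^ 2)) +
      δ * (K * (2 * P * (ζ * Q + 2 * M * H) + (ζ * Q + 2 * M * H) ^ 2)) ≤
    δ * a / 2 * P ^ 2 + ζ / 4 * Q ^ 2 + 5 * M * G * (P + Q) + 22 * M ^ 2 * G ^ 2 := by
  have hK1 : 1 ≤ K := (one_le_pow₀ hM).trans hK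
  have hK0 : 0 < K := by linarith
  have hKK : K ≤ K ^ 3 := le_self_pow₀ hK1 (by norm_num)
  have ha0 : 0 < a := by
    by_contra! h
    have := mul_nonpos_of_nonneg_of_nonpos hK0.le h
    linarith
  have hζ1 : ζ ≤ 1 := by
    have : 1 * ζ ≤ K ^ 3 * ζ := by
      have := one_le_pow₀ hK1 (n := 3)
      gcongr
    linarith
  have hδK3 : 1000 * K ^ 3 * δ ≤ 1 := by
    have : K ^ 3 * δ ≤ K ^ 3 * ζ := mul_le_mul_of_nonneg_left hδζ (by positivity)
    linarith
  have hδK : δ * K ≤ 1 := by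
    have : δ * K ≤ δ * K ^ 3 := by gcongr
    have : 0 ≤ δ * K := by positivity
    linarith
  have M0 : 0 ≤ M := by linarith
  -- collecting the error terms, first in `H`, then in `G`
  have s1 : G * (M * (P + Q)) + ζ * M * H * Q + (ζ * Q + 2 * M * H) * (M * H) +
      δ * (K * (2 * Q * (M * H) + (M * H) ^ 2)) +
      δ * (K * (2 * P * (ζ * Q + 2 * M * H) + (ζ * Q + 2 * M * H) ^ 2)) ≤
      G * (M * (P + Q)) + (2 * ζ * M + 2 * (δ * K) * M) * (Q * H) + 4 * (δ * K) * M * (P * H) +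
      11 * M ^ 2 * H ^ 2 + 2 * (δ * K) * ζ * (P * Q) + 2 * (δ * K) * ζ ^ 2 * Q ^ 2 := by
    have : δ * K * (ζ * Q + 2 * M * H) ^ 2 ≤ δ * K * (2 * ζ ^ 2 * Q ^ 2 + 8 * M ^ 2 * H ^ 2) :=
      mul_le_mul_of_nonneg_left (by linarith [sq_nonneg (ζ * Q - 2 * M * H)]) (by positivity)
    have h9 : δ * K * (M ^ 2 * H ^ 2) ≤ 1 * (M ^ 2 * H ^ 2) :=
      mul_le_mul_of_nonneg_right hδK (by positivity)
    linarith
  have QH : Q * H ≤ δ * M * (P * Q + Q ^ 2) + Q * G := by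
    have := mul_le_mul_of_nonneg_left bH Q0
    linarith
  have PH : P * H ≤ δ * M * (P ^ 2 + P * Q) + P * G := by
    have := mul_le_mul_of_nonneg_left bH P0
    linarith
  have HH : H ^ 2 ≤ 4 * (δ * M) ^ 2 * (P ^ 2 + Q ^ 2) + 2 * G ^ 2 := by
    have h1 : H ^ 2 ≤ (δ * M * (P + Q) + G) ^ 2 := by gcongr
    have h2 : (δ * M * (P + Q) + G) ^ 2 ≤ 2 * (δ * M * (P + Q)) ^ 2 + 2 * G ^ 2 := by
      have := sq_nonneg (δ * M * (P + Q) - G)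
      linarith
    have h3 : (δ * M) ^ 2 * (P + Q) ^ 2 ≤ (δ * M) ^ 2 * (2 * P ^ 2 + 2 * Q ^ 2) :=
      mul_le_mul_of_nonneg_left (by linarith [sq_nonneg (P - Q)]) (by positivity)
    linarith
  have PQ0 : 0 ≤ P * Q := by positivity
  have hδδ : δ ^ 2 ≤ δ * ζ := by rw [sq]; gcongr
  have hMK : M ≤ K := (le_self_pow₀ hM (by norm_num)).trans hK
  have m1 : M ^ 2 ≤ K ^ 2 := by gcongr
  have m2 : K * M ^ 2 ≤ K ^ 2 := by rw [sq K]; gcongr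
  have m3 : M ^ 4 ≤ K ^ 2 := by
    have : M ^ 4 = M ^ 2 * M ^ 2 := by ring
    rw [this, sq K]
    gcongr
  have s2 : (2 * ζ * M + 2 * (δ * K) * M) * (Q * H) ≤
      4 * δ * ζ * K ^ 2 * (P * Q + Q ^ 2) + 4 * M * (Q * G) := by
    have hc : 2 * ζ * M + 2 * (δ * K) * M ≤ 4 * M := by
      have := mul_le_mul_of_nonneg_right hζ1 M0
      have := mul_le_mul_of_nonneg_right hδK M0
      linarith
    have hc0 : 0 ≤ 2 * ζ * M + 2 * (δ * K) * M := by positivity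
    have t1 := mul_le_mul_of_nonneg_left QH hc0
    have t2 : (2 * ζ * M + 2 * (δ * K) * M) * (Q * G) ≤ 4 * M * (Q * G) :=
      mul_le_mul_of_nonneg_right hc (by positivity)
    have t3 : (2 * ζ * M + 2 * (δ * K) * M) * (δ * M) ≤ 4 * δ * ζ * K ^ 2 := by
      have u1 : δ * ζ * M ^ 2 ≤ δ * ζ * K ^ 2 := by gcongr
      have u2 : δ ^ 2 * (K * M ^ 2) ≤ δ * ζ * K ^ 2 := by gcongr
      linarith
    have t4 := mul_le_mul_of_nonneg_right t3 (by positivity : 0 ≤ P * Q + Q ^ 2)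
    linarith
  have s3 : 4 * (δ * K) * M * (P * H) ≤
      4 * δ * ζ * K ^ 2 * (P * Q) + 4 * δ ^ 2 * K ^ 2 * P ^ 2 + 4 * M * (P * G) := by
    have hc : 4 * (δ * K) * M ≤ 4 * M := by
      have := mul_le_mul_of_nonneg_right hδK M0
      linarith
    have t1 := mul_le_mul_of_nonneg_left PH (by positivity : 0 ≤ 4 * (δ * K) * M)
    have t2 : 4 * (δ * K) * M * (P * G) ≤ 4 * M * (P * G) :=
      mul_le_mul_of_nonneg_right hc (by positivity)
    have u2 : δ ^ 2 * (K * M ^ 2) * (P * Q) ≤ δ * ζ * K ^ 2 * (P * Q) := by gcongr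
    have u3 : δ ^ 2 * (K * M ^ 2) * P ^ 2 ≤ δ ^ 2 * K ^ 2 * P ^ 2 := by gcongr
    linarith
  have s4 : 11 * M ^ 2 * H ^ 2 ≤
      44 * δ ^ 2 * K ^ 2 * P ^ 2 + 44 * δ * ζ * K ^ 2 * Q ^ 2 + 22 * M ^ 2 * G ^ 2 := by
    have t1 := mul_le_mul_of_nonneg_left HH (by positivity : 0 ≤ 11 * M ^ 2)
    have u2 : δ ^ 2 * M ^ 4 * P ^ 2 ≤ δ ^ 2 * K ^ 2 * P ^ 2 := by gcongr
    have u3 : δ ^ 2 * M ^ 4 * Q ^ 2 ≤ δ * ζ * K ^ 2 * Q ^ 2 := by gcongr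
    linarith
  have kk : K ≤ K ^ 2 := le_self_pow₀ hK1 (by norm_num)
  have s5 : 2 * (δ * K) * ζ * (P * Q) ≤ 2 * δ * ζ * K ^ 2 * (P * Q) := by
    have : δ * ζ * K * (P * Q) ≤ δ * ζ * K ^ 2 * (P * Q) := by gcongr
    linarith
  have s6 : 2 * (δ * K) * ζ ^ 2 * Q ^ 2 ≤ 2 * δ * ζ * K ^ 2 * Q ^ 2 := by
    have : δ * ζ * (K * ζ) * Q ^ 2 ≤ δ * ζ * K ^ 2 * Q ^ 2 := by
      have : K * ζ ≤ K ^ 2 := (mul_le_of_le_one_right hK0.le hζ1).trans kk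
      gcongr
    linarith
  have δK2 : 1000 * K ^ 2 * δ ≤ 1 := by
    have : K ^ 2 * δ ≤ K ^ 3 * δ := by
      have : K ^ 2 ≤ K ^ 3 := pow_le_pow_right₀ hK1 (by norm_num)
      gcongr
    linarith
  -- absorption of the collected quadratic errors into the main terms
  have r1 : 50 * δ * ζ * K ^ 2 * Q ^ 2 ≤ ζ / 8 * Q ^ 2 := by
    have : ζ * (K ^ 2 * δ) * Q ^ 2 ≤ ζ * (1 / 1000) * Q ^ 2 := by
      have : K ^ 2 * δ ≤ 1 / 1000 := by linarith
      gcongr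
    have := mul_nonneg hζ.le (sq_nonneg Q)
    linarith
  have aK : δ * K ^ 2 ≤ a / 200 := by
    have : K ^ 2 * δ * 1 ≤ K ^ 2 * δ * (5 * K * a) := by gcongr
    have : K ^ 3 * δ * a ≤ 1 / 1000 * a := by
      have : K ^ 3 * δ ≤ 1 / 1000 := by linarith
      gcongr
    linarith
  have r2 : 48 * δ ^ 2 * K ^ 2 * P ^ 2 ≤ δ * a / 4 * P ^ 2 := by
    have : δ * (δ * K ^ 2) * P ^ 2 ≤ δ * (a / 200) * P ^ 2 := by gcongr
    have := mul_nonneg (mul_nonneg hδ.le ha0.le) (sq_nonneg P)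
    linarith
  have r3 : 10 * δ * ζ * K ^ 2 * (P * Q) ≤ δ * a / 4 * P ^ 2 + ζ / 8 * Q ^ 2 := by
    have ζK : ζ * K ^ 2 ≤ 1 / 1000 := by
      have : ζ * K ^ 2 ≤ ζ * K ^ 3 := by
        have : K ^ 2 ≤ K ^ 3 := pow_le_pow_right₀ hK1 (by norm_num)
        gcongr
      linarith
    have t1 : 10 * (δ * K ^ 2) * P * Q ≤ Q ^ 2 / 8 + 200 * (δ * K ^ 2) ^ 2 * P ^ 2 := by
      have := sq_nonneg (40 * (δ * K ^ 2 * P) - Q)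
      linarith
    have t2 := mul_le_mul_of_nonneg_left t1 hζ.le
    have t3 : ζ * K ^ 2 * (δ * P ^ 2 * (δ * K ^ 2)) ≤ 1 / 1000 * (δ * P ^ 2 * (a / 200)) := by
      gcongr
    have t4 : 0 ≤ δ * a * P ^ 2 := by positivity
    linarith
  linarith

/-- The one-step estimate behind hyperbolicity: `(p₁, p₂)` are the coordinates of `(u_n, u_{n-1})`
in the conjugated frame, `f` is the value of `(H - E + δ) u`, and the quadratic form
`p₁ p₂ + δ (y₂ p₂² - y₁ p₁²)`, corrected to first order by the cohomological solutions, increases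
at each step. -/
theorem lyapunov_step {ζ δ a b M K : ℝ} (hζ : 0 < ζ) (hδ : 0 < δ) (hM : 1 ≤ M)
    (hK : M ^ 2 ≤ K) (hδζ : δ ≤ ζ) (hζK : 1000 * K ^ 3 * ζ ≤ 1) (ha : 1 / (5 * M ^ 2) ≤ a)
    (hb : δ * b ≤ ζ / 2) :
    ∃ c C : ℝ, 0 < c ∧ 0 ≤ C ∧ ∀ φ ψ y₁ y₂ y₁' y₂' p₁ p₂ p₁' p₂' u f : ℝ, |φ| ≤ M → |ψ| ≤ M →
      |y₁'| ≤ K → |y₂'| ≤ K → y₁' - y₁ = φ ^ 2 - a → y₂' - y₂ = ψ ^ 2 - b →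
      u = φ * p₁ + ψ * p₂ → p₁' = p₁ + ζ * p₂ - (ψ - ζ * φ) * (δ * u - f) →
      p₂' = p₂ + φ * (δ * u - f) →
      c * (p₁ ^ 2 + p₂ ^ 2) - C * f ^ 2 ≤ (p₁' * p₂' + δ * (y₂' * p₂' ^ 2 - y₁' * p₁' ^ 2)) -
        (p₁ * p₂ + δ * (y₂ * p₂ ^ 2 - y₁ * p₁ ^ 2)) := by
  have hK1 : 1 ≤ K := (one_le_pow₀ hM).trans hK
  have ha0 : 0 < a := lt_of_lt_of_le (by positivity) ha
  have ha5 : 1 ≤ 5 * K * a := by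
    rw [div_le_iff₀ (by positivity)] at ha
    have := mul_le_mul_of_nonneg_right hK ha0.le
    linarith
  have hζ1 : ζ ≤ 1 := by
    have : 1 * ζ ≤ K ^ 3 * ζ := by
      have := one_le_pow₀ hK1 (n := 3)
      gcongr
    linarith
  set c₀ := min (ζ / 4) (δ * a / 2) with hc₀
  have hc₀0 : 0 < c₀ := lt_min (by positivity) (by positivity)
  refine ⟨c₀ / 2, 25 * M ^ 2 / c₀ + 22 * M ^ 2, by positivity, by positivity, ?_⟩
  intro φ ψ y₁ y₂ y₁' y₂' p₁ p₂ p₁' p₂' u f hφ hψ hy₁ hy₂ h1 h2 hu hp₁ hp₂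
  set h := δ * u - f with hh
  set d₁ := ζ * p₂ - (ψ - ζ * φ) * h with hd₁
  set d₂ := φ * h with hd₂
  have hexp : (p₁' * p₂' + δ * (y₂' * p₂' ^ 2 - y₁' * p₁' ^ 2)) -
        (p₁ * p₂ + δ * (y₂ * p₂ ^ 2 - y₁ * p₁ ^ 2)) =
      (ζ - δ * b) * p₂ ^ 2 + δ * a * p₁ ^ 2 - f * (φ * p₁ - ψ * p₂) + ζ * φ * h * p₂ + d₁ * d₂
      + δ * (y₂' * (2 * p₂ * d₂ + d₂ ^ 2)) - δ * (y₁' * (2 * p₁ * d₁ + d₁ ^ 2)) := by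
    have e1 : p₁' = p₁ + d₁ := by rw [hp₁, hd₁]; ring
    have e2 : p₂' = p₂ + d₂ := by rw [hp₂]
    rw [e1, e2]
    have e3 : p₁ * d₂ + p₂ * d₁ = ζ * p₂ ^ 2 + δ * (φ ^ 2 * p₁ ^ 2 - ψ ^ 2 * p₂ ^ 2)
        - f * (φ * p₁ - ψ * p₂) + ζ * φ * h * p₂ := by
      rw [hd₁, hd₂, hh, hu]; ring
    linear_combination e3 + δ * p₂ ^ 2 * h2 - δ * p₁ ^ 2 * h1
  rw [hexp]
  set P := |p₁| with hP
  set Q := |p₂| with hQ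
  set G := |f| with hG
  set H := |h| with hH
  have P0 : 0 ≤ P := abs_nonneg _
  have Q0 : 0 ≤ Q := abs_nonneg _
  have G0 : 0 ≤ G := abs_nonneg _
  have H0 : 0 ≤ H := abs_nonneg _
  have M0 : 0 ≤ M := by linarith
  have hP2 : p₁ ^ 2 = P ^ 2 := (sq_abs _).symm
  have hQ2 : p₂ ^ 2 = Q ^ 2 := (sq_abs _).symm
  have hG2 : f ^ 2 = G ^ 2 := (sq_abs _).symm
  have bu : |u| ≤ M * (P + Q) := by
    rw [hu]
    refine (abs_add_le _ _).trans ?_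
    rw [abs_mul, abs_mul, mul_add]
    gcongr
  have bH : H ≤ δ * M * (P + Q) + G := by
    rw [hH, hh]
    refine (abs_sub _ _).trans ?_
    rw [abs_mul, abs_of_pos hδ, mul_assoc]
    gcongr
  have bd₂ : |d₂| ≤ M * H := by
    rw [hd₂, abs_mul]; gcongr
  have bd₁ : |d₁| ≤ ζ * Q + 2 * M * H := by
    rw [hd₁]
    refine (abs_sub _ _).trans ?_
    rw [abs_mul, abs_mul, abs_of_pos hζ]
    have : |ψ - ζ * φ| ≤ 2 * M := by
      refine (abs_sub _ _).trans ?_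
      rw [abs_mul, abs_of_pos hζ]
      have : ζ * |φ| ≤ 1 * M := by gcongr
      linarith
    gcongr
  have b1 : |f * (φ * p₁ - ψ * p₂)| ≤ G * (M * (P + Q)) := by
    rw [abs_mul]
    refine mul_le_mul_of_nonneg_left ?_ G0
    refine (abs_sub _ _).trans ?_
    rw [abs_mul, abs_mul, mul_add]
    gcongr
  have b2 : |ζ * φ * h * p₂| ≤ ζ * M * H * Q := by
    rw [abs_mul, abs_mul, abs_mul, abs_of_pos hζ]; gcongr
  have b3 : |d₁ * d₂| ≤ (ζ * Q + 2 * M * H) * (M * H) := by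
    rw [abs_mul]; gcongr
  have b4 : |δ * (y₂' * (2 * p₂ * d₂ + d₂ ^ 2))| ≤
      δ * (K * (2 * Q * (M * H) + (M * H) ^ 2)) := by
    rw [abs_mul, abs_mul, abs_of_pos hδ]
    have : |2 * p₂ * d₂ + d₂ ^ 2| ≤ 2 * Q * (M * H) + (M * H) ^ 2 := by
      refine (abs_add_le _ _).trans ?_
      rw [abs_mul, abs_mul, abs_two, abs_pow]
      gcongr
    gcongr
  have b5 : |δ * (y₁' * (2 * p₁ * d₁ + d₁ ^ 2))| ≤
      δ * (K * (2 * P * (ζ * Q + 2 * M * H) + (ζ * Q + 2 * M * H) ^ 2)) := by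
    rw [abs_mul, abs_mul, abs_of_pos hδ]
    have : |2 * p₁ * d₁ + d₁ ^ 2| ≤
        2 * P * (ζ * Q + 2 * M * H) + (ζ * Q + 2 * M * H) ^ 2 := by
      refine (abs_add_le _ _).trans ?_
      rw [abs_mul, abs_mul, abs_two, abs_pow]
      gcongr
    gcongr
  have lower := (neg_le_abs (-(f * (φ * p₁ - ψ * p₂)))).trans_eq (abs_neg _)
  have l1 := (neg_abs_le (ζ * φ * h * p₂))
  have l2 := (neg_abs_le (d₁ * d₂))
  have l3 := (neg_abs_le (δ * (y₂' * (2 * p₂ * d₂ + d₂ ^ 2))))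
  have l4 := (le_abs_self (δ * (y₁' * (2 * p₁ * d₁ + d₁ ^ 2))))
  rw [hP2, hQ2, hG2]
  have M1 := lyapunov_absorb hζ hδ hM hK hδζ hζK ha5 P0 Q0 G0 H0 bH
  have r4 : 5 * M * G * (P + Q) ≤ c₀ / 2 * (P ^ 2 + Q ^ 2) + 25 * M ^ 2 / c₀ * G ^ 2 := by
    have e : c₀ / 2 * (P ^ 2 + Q ^ 2) + 25 * M ^ 2 / c₀ * G ^ 2 - 5 * M * G * (P + Q) =
        1 / (2 * c₀) * ((c₀ * P - 5 * M * G) ^ 2 + (c₀ * Q - 5 * M * G) ^ 2) := by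
      field_simp
      ring
    have : 0 ≤ 1 / (2 * c₀) * ((c₀ * P - 5 * M * G) ^ 2 + (c₀ * Q - 5 * M * G) ^ 2) := by
      positivity
    linarith
  have r5 : c₀ * (P ^ 2 + Q ^ 2) ≤ δ * a / 2 * P ^ 2 + ζ / 4 * Q ^ 2 := by
    have t1 : c₀ * P ^ 2 ≤ δ * a / 2 * P ^ 2 :=
      mul_le_mul_of_nonneg_right (min_le_right _ _) (sq_nonneg _)
    have t2 : c₀ * Q ^ 2 ≤ ζ / 4 * Q ^ 2 :=
      mul_le_mul_of_nonneg_right (min_le_left _ _) (sq_nonneg _)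
    linarith
  have r6 : ζ / 2 * Q ^ 2 ≤ (ζ - δ * b) * Q ^ 2 :=
    mul_le_mul_of_nonneg_right (by linarith) (sq_nonneg _)
  linarith

/-! ### Approximate solutions in the elliptic regime -/

namespace EdgeData

variable {v : ℤ → ℝ} {E ζ M K : ℝ} (D : EdgeData v E ζ M K)

/-- In the elliptic regime `δ² (ab - c²) ≥ δ a ζ`, the averaged cocycle at energy `E - δ` has an
eigenvector with eigenvalue of modulus one. Transported back by the first-order averaging
transformation it gives a bounded approximate solution whose defect is of second order, hence
much smaller than `|δ|` times its size. -/
theorem exists_quasimode (hM : 1 ≤ M) (hK : M ^ 2 ≤ K) (hζ : 0 ≤ ζ) {δ t : ℝ} (hδ : δ ≠ 0)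
    (hδt : |δ| ≤ t) (hζt : ζ ≤ t) (ht : 200 * (M ^ 4 * K * t) ≤ 1)
    (hell : δ * D.a * ζ ≤ δ ^ 2 * (D.a * D.b - D.c ^ 2)) :
    ∃ (u : ℤ → ℂ) (B r k : ℝ), (∀ n, ‖u n‖ ≤ B) ∧
      (∀ n, ‖u (n + 1) + u (n - 1) + ((v n - (E - δ) : ℝ) : ℂ) * u n‖ ≤ r) ∧
      (∀ n, k ≤ ‖u (n + 1)‖ ^ 2 + ‖u n‖ ^ 2) ∧ 2 * r ^ 2 < δ ^ 2 * k := by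
  have hM0 : 0 < M := by linarith
  have hK1 : 1 ≤ K := (one_le_pow₀ hM).trans hK
  have hK0 : 0 < K := by linarith
  have ha := D.a_pos hζ
  have hδ0 : 0 < |δ| := abs_pos.2 hδ
  have ht0 : 0 < t := hδ0.trans_le hδt
  set ω := √(δ ^ 2 * (D.a * D.b - D.c ^ 2) - δ * D.a * ζ) with hω
  have hω0 : 0 ≤ ω := Real.sqrt_nonneg _
  have hω2 : ω ^ 2 = δ ^ 2 * (D.a * D.b - D.c ^ 2) - δ * D.a * ζ :=
    Real.sq_sqrt (by linarith)
  have hωδ : ω ^ 2 ≤ |δ| * (2 * M ^ 4 * t) := by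
    have h1 : D.a * D.b - D.c ^ 2 ≤ M ^ 4 := by
      have : D.a * D.b ≤ M ^ 2 * M ^ 2 :=
        mul_le_mul D.a_le D.b_le D.b_nonneg (by positivity)
      linarith [sq_nonneg D.c]
    have h2 : δ ^ 2 * (D.a * D.b - D.c ^ 2) ≤ |δ| * (t * M ^ 4) := by
      rw [← sq_abs δ, sq, mul_assoc]
      have := mul_le_mul_of_nonneg_left h1 hδ0.le
      have := mul_le_mul_of_nonneg_right hδt (by positivity : 0 ≤ M ^ 4)
      refine mul_le_mul_of_nonneg_left ?_ hδ0.le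
      linarith
    have h3 : -(δ * D.a * ζ) ≤ |δ| * (M ^ 4 * t) := by
      have e : -(δ * D.a * ζ) ≤ |δ| * (D.a * ζ) := by
        have := mul_le_mul_of_nonneg_right (neg_le_abs δ) (mul_nonneg ha.le hζ)
        linarith
      refine e.trans (mul_le_mul_of_nonneg_left ?_ hδ0.le)
      refine mul_le_mul (D.a_le.trans ?_) hζt hζ (by positivity)
      exact pow_le_pow_right₀ hM (by norm_num)
    linarith
  have hωt : ω ≤ 2 * M ^ 2 * t := by
    refine abs_le_of_sq_le_sq' ?_ (by positivity) |>.2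
    have := mul_le_mul_of_nonneg_right hδt (by positivity : 0 ≤ 2 * M ^ 4 * t)
    have : 0 ≤ M ^ 4 * t ^ 2 := by positivity
    linarith
  have hMt : M ^ 2 * t ≤ M ^ 4 * K * t := by
    have : M ^ 2 * 1 ≤ M ^ 4 * K := by
      have : M ^ 2 ≤ M ^ 4 := pow_le_pow_right₀ hM (by norm_num)
      gcongr
    have := mul_le_mul_of_nonneg_right this ht0.le
    linarith
  have hω1 : ω ≤ 1 := by linarith
  -- the multiplier and its inverse
  set l : ℂ := Complex.exp (Complex.I * ω) with hl
  have hl0 : l ≠ 0 := Complex.exp_ne_zero _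
  have hln : ‖l‖ = 1 := by rw [hl, mul_comm]; exact Complex.norm_exp_ofReal_mul_I ω
  have hl1 : ‖l - 1‖ ≤ ω := by
    have := Real.norm_exp_I_mul_ofReal_sub_one_le (x := ω)
    rwa [Real.norm_of_nonneg hω0] at this
  have hnI : ‖Complex.I * (ω : ℂ)‖ = ω := by simp [abs_of_nonneg hω0]
  have hl2 : ‖l - 1 - Complex.I * ω‖ ≤ ω ^ 2 := by
    have := Complex.norm_exp_sub_one_sub_id_le (x := Complex.I * ω) (by rw [hnI]; exact hω1)
    rwa [hnI] at this
  have hli : l⁻¹ = Complex.exp (-(Complex.I * ω)) := (Complex.exp_neg _).symm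
  have hl1' : ‖l⁻¹ - 1‖ ≤ ω := by
    have e : l⁻¹ - 1 = -(l⁻¹ * (l - 1)) := by field_simp; ring
    rw [e, norm_neg, norm_mul, norm_inv, hln]
    simpa using hl1
  have hl2' : ‖l⁻¹ - 1 + Complex.I * ω‖ ≤ ω ^ 2 := by
    have := Complex.norm_exp_sub_one_sub_id_le (x := -(Complex.I * ω))
      (by rw [norm_neg, hnI]; exact hω1)
    rwa [norm_neg, hnI, ← hli, sub_neg_eq_add] at this
  clear_value l
  -- the eigenvector of the averaged generator
  set w₁ : ℂ := Complex.I * ω - δ * D.c with hw₁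
  set w₂ : ℂ := δ * D.a with hw₂
  have hω2c : (ω : ℂ) ^ 2 = δ ^ 2 * (D.a * D.b - D.c ^ 2) - δ * D.a * ζ := by
    exact_mod_cast congrArg (fun x : ℝ => (x : ℂ)) hω2
  have eig₁ : Complex.I * ω * w₁ = -(δ * D.c) * w₁ + (ζ - δ * D.b) * w₂ := by
    rw [hw₁, hw₂]
    linear_combination (-1 : ℂ) * hω2c + (ω : ℂ) ^ 2 * Complex.I_sq
  have eig₂ : Complex.I * ω * w₂ = δ * D.a * w₁ + δ * D.c * w₂ := by
    rw [hw₁, hw₂]; ring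
  have hw₂0 : w₂ ≠ 0 := by
    rw [hw₂]
    exact mul_ne_zero (by exact_mod_cast hδ) (by exact_mod_cast ha.ne')
  clear_value w₁ w₂
  set W := max ‖w₁‖ ‖w₂‖ with hW
  have hW0 : 0 < W := lt_max_of_lt_right (norm_pos_iff.2 hw₂0)
  have hW₁ : ‖w₁‖ ≤ W := le_max_left _ _
  have hW₂ : ‖w₂‖ ≤ W := le_max_right _ _
  -- the averaging correction
  set P : ℤ → ℂ := fun n => -(δ * (D.y₃ n * w₁ + D.y₂ n * w₂)) with hP
  set Q : ℤ → ℂ := fun n => δ * (D.y₁ n * w₁ + D.y₃ n * w₂) with hQ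
  have nr : ∀ x : ℝ, ‖(x : ℂ)‖ = |x| := fun x => by simp
  have bP : ∀ n, ‖P n‖ ≤ |δ| * (2 * K * W) := by
    intro n
    rw [hP, norm_neg, norm_mul, nr]
    refine mul_le_mul_of_nonneg_left ((norm_add_le _ _).trans ?_) hδ0.le
    rw [norm_mul, norm_mul, nr, nr]
    have := mul_le_mul (D.abs_y₃ n) hW₁ (norm_nonneg _) hK0.le
    have := mul_le_mul (D.abs_y₂ n) hW₂ (norm_nonneg _) hK0.le
    linarith
  have bQ : ∀ n, ‖Q n‖ ≤ |δ| * (2 * K * W) := by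
    intro n
    rw [hQ, norm_mul, nr]
    refine mul_le_mul_of_nonneg_left ((norm_add_le _ _).trans ?_) hδ0.le
    rw [norm_mul, norm_mul, nr, nr]
    have := mul_le_mul (D.abs_y₁ n) hW₁ (norm_nonneg _) hK0.le
    have := mul_le_mul (D.abs_y₃ n) hW₂ (norm_nonneg _) hK0.le
    linarith
  have sP : ∀ n, P (n + 1) - P n =
      -(δ * ((D.φ n * D.ψ n - D.c) * w₁ + (D.ψ n ^ 2 - D.b) * w₂)) := by
    intro n
    have h2 := congrArg (fun x : ℝ => (x : ℂ)) (D.step_y₂ n)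
    have h3 := congrArg (fun x : ℝ => (x : ℂ)) (D.step_y₃ n)
    push_cast at h2 h3
    simp only [hP]
    linear_combination (-(δ : ℂ) * w₁) * h3 - (δ : ℂ) * w₂ * h2
  have sQ : ∀ n, Q (n + 1) - Q n =
      δ * ((D.φ n ^ 2 - D.a) * w₁ + (D.φ n * D.ψ n - D.c) * w₂) := by
    intro n
    have h1 := congrArg (fun x : ℝ => (x : ℂ)) (D.step_y₁ n)
    have h3 := congrArg (fun x : ℝ => (x : ℂ)) (D.step_y₃ n)
    push_cast at h1 h3
    simp only [hQ]
    linear_combination ((δ : ℂ) * w₁) * h1 + (δ : ℂ) * w₂ * h3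
  clear_value P Q
  set s : ℤ → ℂ := fun n => D.φ n * w₁ + D.ψ n * w₂ with hs
  set e : ℤ → ℂ := fun n => D.φ n * P n + D.ψ n * Q n with he
  have bφ : ∀ n (z : ℂ) C, ‖z‖ ≤ C → ‖(D.φ n : ℂ) * z‖ ≤ M * C := by
    intro n z C h
    rw [norm_mul, nr]
    exact mul_le_mul (D.abs_φ n) h (norm_nonneg _) hM0.le
  have bψ : ∀ n (z : ℂ) C, ‖z‖ ≤ C → ‖(D.ψ n : ℂ) * z‖ ≤ M * C := by
    intro n z C h
    rw [norm_mul, nr]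
    exact mul_le_mul (D.abs_ψ n) h (norm_nonneg _) hM0.le
  have bs : ∀ n, ‖s n‖ ≤ 2 * M * W := fun n =>
    (norm_add_le _ _).trans (by linarith [bφ n _ _ hW₁, bψ n _ _ hW₂])
  have be : ∀ n, ‖e n‖ ≤ 4 * M * |δ| * K * W := fun n =>
    (norm_add_le _ _).trans (by linarith [bφ n _ _ (bP n), bψ n _ _ (bQ n)])
  have be' : ∀ n, ‖e n‖ ≤ W / (50 * M) := by
    intro n
    refine (be n).trans ?_
    rw [le_div_iff₀ (by positivity)]
    have h1 : M ^ 2 * K * |δ| ≤ M ^ 4 * K * t := by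
      have : M ^ 2 ≤ M ^ 4 := pow_le_pow_right₀ hM (by norm_num)
      gcongr
    have : M ^ 2 * K * |δ| * 200 * W ≤ 1 * W := by
      refine mul_le_mul_of_nonneg_right ?_ hW0.le
      linarith
    linarith
  have hun : ∀ n, ‖l ^ n * (s n + e n)‖ = ‖s n + e n‖ := by
    intro n
    rw [norm_mul, norm_zpow, hln, one_zpow, one_mul]
  refine ⟨fun n => l ^ n * (s n + e n), 2 * M * W + W / (50 * M), 34 * (M ^ 3 * K * t) * |δ| * W,
    W ^ 2 / (8 * M ^ 2), ?_, ?_, ?_, ?_⟩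
  · intro n
    rw [hun]
    exact (norm_add_le _ _).trans (add_le_add (bs n) (be' n))
  · intro n
    have hφ := congrArg (fun x : ℝ => (x : ℂ)) (D.solution_φ n)
    have hψ := congrArg (fun x : ℝ => (x : ℂ)) (D.solution_ψ n)
    have hwr := congrArg (fun x : ℝ => (x : ℂ)) (D.wronskian n)
    have sPn := sP n
    have sQn := sQ n
    have sPm := sP (n - 1)
    have sQm := sQ (n - 1)
    rw [sub_add_cancel] at sPm sQm
    push_cast at hφ hψ hwr
    -- everything of first order in `δ` and `ζ` cancels, by the Wronskian identity
    have key : l ^ (n + 1) * (s (n + 1) + e (n + 1)) + l ^ (n - 1) * (s (n - 1) + e (n - 1)) +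
        ((v n - (E - δ) : ℝ) : ℂ) * (l ^ n * (s n + e n)) = l ^ n * (
        (D.φ (n + 1) * ((l - 1 - Complex.I * ω) * w₁ + (l - 1) * P (n + 1)) +
          D.φ (n - 1) * ((l⁻¹ - 1 + Complex.I * ω) * w₁ + (l⁻¹ - 1) * P (n - 1)) +
          D.ψ (n + 1) * ((l - 1 - Complex.I * ω) * w₂ + (l - 1) * Q (n + 1)) +
          D.ψ (n - 1) * ((l⁻¹ - 1 + Complex.I * ω) * w₂ + (l⁻¹ - 1) * Q (n - 1))) +
        ζ * (D.φ (n - 1) * Q n - D.φ (n + 1) * Q n) + δ * e n -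
        δ * (ζ * (D.φ (n + 1) * (D.φ n * s n)))) := by
      rw [zpow_add_one₀ hl0, zpow_sub_one₀ hl0]
      simp only [hs, he]
      push_cast
      linear_combination (l ^ n) * ((w₁ + P n) * hφ + (w₂ + Q n) * hψ + D.φ (n + 1) * sPn
        - D.φ (n - 1) * sPm + D.ψ (n + 1) * sQn - D.ψ (n - 1) * sQm
        + (D.φ (n + 1) - D.φ (n - 1)) * eig₁ + (D.ψ (n + 1) - D.ψ (n - 1)) * eig₂
        - δ * (D.φ n * w₁ + D.ψ n * w₂) * hwr)
    have step : ∀ (x y z q : ℂ), ‖x‖ ≤ ω ^ 2 → ‖y‖ ≤ ω → ‖z‖ ≤ W → ‖q‖ ≤ |δ| * (2 * K * W) →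
        ‖x * z + y * q‖ ≤ |δ| * (6 * M ^ 2 * K * t) * W := by
      intro x y z q hx hy hz hq
      refine (norm_add_le _ _).trans ?_
      rw [norm_mul, norm_mul]
      have h1 : ‖x‖ * ‖z‖ ≤ |δ| * (2 * M ^ 4 * t) * W :=
        mul_le_mul (hx.trans hωδ) hz (norm_nonneg _) (by positivity)
      have h2 : ‖y‖ * ‖q‖ ≤ 2 * M ^ 2 * t * (|δ| * (2 * K * W)) :=
        mul_le_mul (hy.trans hωt) hq (norm_nonneg _) (by positivity)
      have h3 : |δ| * (M ^ 2 * M ^ 2 * t) * W ≤ |δ| * (M ^ 2 * K * t) * W := by gcongr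
      linarith
    have i1 := bφ (n + 1) _ _ (step _ _ _ _ hl2 hl1 hW₁ (bP (n + 1)))
    have i2 := bφ (n - 1) _ _ (step _ _ _ _ hl2' hl1' hW₁ (bP (n - 1)))
    have i3 := bψ (n + 1) _ _ (step _ _ _ _ hl2 hl1 hW₂ (bQ (n + 1)))
    have i4 := bψ (n - 1) _ _ (step _ _ _ _ hl2' hl1' hW₂ (bQ (n - 1)))
    have i5 : ‖(ζ : ℂ) * (D.φ (n - 1) * Q n - D.φ (n + 1) * Q n)‖ ≤
        t * (4 * M * |δ| * K * W) := by
      rw [norm_mul, nr, abs_of_nonneg hζ]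
      refine mul_le_mul hζt ((norm_sub_le _ _).trans ?_) (norm_nonneg _) ht0.le
      linarith [bφ (n - 1) _ _ (bQ n), bφ (n + 1) _ _ (bQ n)]
    have i6 : ‖(δ : ℂ) * e n‖ ≤ t * (4 * M * |δ| * K * W) := by
      rw [norm_mul, nr]
      exact mul_le_mul hδt (be n) (norm_nonneg _) ht0.le
    have i7 : ‖(δ : ℂ) * (ζ * (D.φ (n + 1) * (D.φ n * s n)))‖ ≤
        |δ| * (t * (M * (M * (2 * M * W)))) := by
      rw [norm_mul, nr, norm_mul, nr, abs_of_nonneg hζ]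
      refine mul_le_mul_of_nonneg_left ?_ hδ0.le
      exact mul_le_mul hζt (bφ _ _ _ (bφ _ _ _ (bs n))) (norm_nonneg _) ht0.le
    rw [key, norm_mul, norm_zpow, hln, one_zpow, one_mul]
    refine (norm_sub_le _ _).trans ?_
    refine (add_le_add_left (norm_add₃_le.trans (add_le_add_left (add_le_add_left
      (norm_add₄_le.trans (add_le_add (add_le_add (add_le_add i1 i2) i3) i4)) _) _)) _).trans ?_
    have j1 : t * M * |δ| * K * W ≤ t * M ^ 3 * |δ| * K * W := by
      have : M ≤ M ^ 3 := le_self_pow₀ hM (by norm_num)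
      gcongr
    have j2 : |δ| * t * M ^ 3 * W * 1 ≤ |δ| * t * M ^ 3 * W * K := by gcongr
    linarith
  · intro n
    simp only [hun]
    have hwr := congrArg (fun x : ℝ => (x : ℂ)) (D.wronskian n)
    push_cast at hwr
    have hζM : ζ * M ^ 2 ≤ 1 / 200 := by
      have := mul_le_mul_of_nonneg_right hζt (by positivity : 0 ≤ M ^ 2)
      linarith
    have g : ∀ w : ℂ, ‖w‖ - ζ * M ^ 2 * ‖w‖ ≤
        ‖(1 + ζ * (D.φ (n + 1) * D.φ n)) * w‖ := by
      intro w
      have h1 : (1 + ζ * (D.φ (n + 1) * D.φ n)) * w =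
          w - (-((ζ : ℂ) * (D.φ (n + 1) * (D.φ n * w)))) := by ring
      rw [h1]
      refine le_trans ?_ (norm_sub_norm_le _ _)
      rw [norm_neg, norm_mul, nr, abs_of_nonneg hζ]
      have := mul_le_mul_of_nonneg_left (bφ (n + 1) _ _ (bφ n w _ le_rfl)) hζ
      linarith
    have r1 : (1 + ζ * (D.φ (n + 1) * D.φ n)) * w₁ = D.ψ n * s (n + 1) - D.ψ (n + 1) * s n := by
      simp only [hs]
      linear_combination (-w₁) * hwr
    have r2 : (1 + ζ * (D.φ (n + 1) * D.φ n)) * w₂ = D.φ (n + 1) * s n - D.φ n * s (n + 1) := by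
      simp only [hs]
      linear_combination (-w₂) * hwr
    have h1 : ‖w₁‖ - ζ * M ^ 2 * ‖w₁‖ ≤ M * (‖s (n + 1)‖ + ‖s n‖) := by
      refine (g w₁).trans ?_
      rw [r1]
      refine (norm_sub_le _ _).trans ?_
      linarith [bψ n (s (n + 1)) _ le_rfl, bψ (n + 1) (s n) _ le_rfl]
    have h2 : ‖w₂‖ - ζ * M ^ 2 * ‖w₂‖ ≤ M * (‖s (n + 1)‖ + ‖s n‖) := by
      refine (g w₂).trans ?_
      rw [r2]
      refine (norm_sub_le _ _).trans ?_
      linarith [bφ n (s (n + 1)) _ le_rfl, bφ (n + 1) (s n) _ le_rfl]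
    have h3 : W - W / 200 ≤ M * (‖s (n + 1)‖ + ‖s n‖) := by
      rcases max_choice ‖w₁‖ ‖w₂‖ with h | h
      · rw [hW, h]
        have := mul_le_mul_of_nonneg_right hζM (norm_nonneg w₁)
        linarith
      · rw [hW, h]
        have := mul_le_mul_of_nonneg_right hζM (norm_nonneg w₂)
        linarith
    have h4 : ∀ n, ‖s n‖ ≤ ‖s n + e n‖ + W / (50 * M) := by
      intro n
      have := norm_sub_le (s n + e n) (e n)
      rw [add_sub_cancel_right] at this
      linarith [be' n]
    have h5 : W / (2 * M) ≤ ‖s (n + 1) + e (n + 1)‖ + ‖s n + e n‖ := by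
      rw [div_le_iff₀ (by positivity)]
      have := mul_le_mul_of_nonneg_left (add_le_add (h4 (n + 1)) (h4 n)) hM0.le
      have e1 : M * (‖s (n + 1) + e (n + 1)‖ + W / (50 * M) + (‖s n + e n‖ + W / (50 * M))) =
          M * (‖s (n + 1) + e (n + 1)‖ + ‖s n + e n‖) + W / 25 := by
        field_simp
        ring
      linarith
    have h6 : (W / (2 * M)) ^ 2 ≤ (‖s (n + 1) + e (n + 1)‖ + ‖s n + e n‖) ^ 2 := by gcongr
    have e2 : W ^ 2 / (8 * M ^ 2) = (W / (2 * M)) ^ 2 / 2 := by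
      field_simp
      ring
    rw [e2]
    linarith [sq_nonneg (‖s (n + 1) + e (n + 1)‖ - ‖s n + e n‖)]
  · have hX : 0 < M ^ 4 * K * t := by positivity
    have h1 : (M ^ 4 * K * t) ^ 2 ≤ (1 / 200) ^ 2 := by
      have : M ^ 4 * K * t ≤ 1 / 200 := by linarith
      gcongr
    have e1 : 2 * (34 * (M ^ 3 * K * t) * |δ| * W) ^ 2 =
        18496 * (M ^ 4 * K * t) ^ 2 * (|δ| ^ 2 * (W ^ 2 / (8 * M ^ 2))) := by
      field_simp
      ring
    rw [e1, sq_abs]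
    have h3 : 0 < δ ^ 2 * (W ^ 2 / (8 * M ^ 2)) := by positivity
    refine mul_lt_of_lt_one_left h3 ?_
    linarith

end EdgeData

/-! ### Spectra of self-adjoint operators -/

section SelfAdjoint

variable {H : Type*} [NormedAddCommGroup H] [InnerProductSpace ℂ H] [CompleteSpace H]

omit [CompleteSpace H] in
theorem ofReal_mem_spectrum_iff (T : H →L[ℂ] H) (x : ℝ) :
    (x : ℂ) ∈ spectrum ℂ T ↔ x ∈ spectrum ℝ T := by
  have := spectrum.algebraMap_mem_iff ℂ (a := T) (r := x)
  simpa using this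

/-- If `T` has no spectrum within `ρ` of `x`, then `(T - x)² ≥ ρ²` by the functional calculus. -/
theorem mul_norm_le_of_forall_notMem_spectrum {T : H →L[ℂ] H} (hT : IsSelfAdjoint T) {x ρ : ℝ}
    (hρ : 0 ≤ ρ) (h : ∀ y : ℝ, |y - x| < ρ → (y : ℂ) ∉ spectrum ℂ T) (u : H) :
    ρ * ‖u‖ ≤ ‖T u - (x : ℂ) • u‖ := by
  have h0 : 0 ≤ cfc (fun y : ℝ => (y - x) ^ 2 - ρ ^ 2) T := by
    refine cfc_nonneg fun y hy => ?_
    rw [← ofReal_mem_spectrum_iff] at hy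
    have : ρ ≤ |y - x| := by
      by_contra! hlt
      exact h y hlt hy
    have := pow_le_pow_left₀ hρ this 2
    rw [sq_abs] at this
    linarith
  have e : cfc (fun y : ℝ => (y - x) ^ 2 - ρ ^ 2) T =
      (T - algebraMap ℝ _ x) ^ 2 - algebraMap ℝ _ (ρ ^ 2) := by
    rw [cfc_sub (fun y : ℝ => (y - x) ^ 2) (fun _ => ρ ^ 2) T,
      cfc_pow (fun y : ℝ => y - x) 2 T, cfc_sub (fun y : ℝ => y) (fun _ => x) T, cfc_id' ℝ T,
      cfc_const _ T, cfc_const _ T]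
  rw [e, ContinuousLinearMap.nonneg_iff_isPositive] at h0
  have h1 := h0.re_inner_nonneg_left u
  have hS : IsSelfAdjoint (T - algebraMap ℝ (H →L[ℂ] H) x) :=
    hT.sub (IsSelfAdjoint.algebraMap _ (IsSelfAdjoint.all x))
  have h2 : ((T - algebraMap ℝ (H →L[ℂ] H) x) ^ 2 -
        algebraMap ℝ (H →L[ℂ] H) (ρ ^ 2) : H →L[ℂ] H) u =
      (T - algebraMap ℝ (H →L[ℂ] H) x) ((T - algebraMap ℝ (H →L[ℂ] H) x) u)
        - ((ρ ^ 2 : ℝ) : ℂ) • u := by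
    rw [sq, Complex.coe_smul]
    simp [Algebra.algebraMap_eq_smul_one]
  have h3 : (T - algebraMap ℝ (H →L[ℂ] H) x) u = T u - (x : ℂ) • u := by
    simp [Algebra.algebraMap_eq_smul_one]
  rw [h2, inner_sub_left] at h1
  have h4 : inner ℂ ((T - algebraMap ℝ (H →L[ℂ] H) x) ((T - algebraMap ℝ (H →L[ℂ] H) x) u)) u =
      inner ℂ ((T - algebraMap ℝ (H →L[ℂ] H) x) u) ((T - algebraMap ℝ (H →L[ℂ] H) x) u) := by
    have := ContinuousLinearMap.adjoint_inner_right (T - algebraMap ℝ (H →L[ℂ] H) x)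
      ((T - algebraMap ℝ (H →L[ℂ] H) x) u) u
    rw [ContinuousLinearMap.isSelfAdjoint_iff'.1 hS] at this
    exact this.symm
  rw [h4, h3, map_sub, inner_smul_left, Complex.conj_ofReal] at h1
  have h5 : RCLike.re (inner ℂ (T u - (x : ℂ) • u) (T u - (x : ℂ) • u)) =
    ‖T u - (x : ℂ) • u‖ ^ 2 := inner_self_eq_norm_sq _
  have h6 : RCLike.re ((((ρ ^ 2 : ℝ) : ℂ)) * inner ℂ u u) = ρ ^ 2 * ‖u‖ ^ 2 := by
    rw [← inner_self_eq_norm_sq (𝕜 := ℂ) u]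
    exact RCLike.re_ofReal_mul _ _
  rw [h5, h6] at h1
  refine abs_le_of_sq_le_sq' ?_ (norm_nonneg _) |>.2
  rw [mul_pow]
  linarith

/-- When `T - x` is bounded below it is injective with closed range, and its range is dense because
it is self-adjoint. -/
theorem notMem_spectrum_of_bounded_below {T : H →L[ℂ] H} (hT : IsSelfAdjoint T) {x c : ℝ}
    (hc : 0 < c) (h : ∀ u, c * ‖u‖ ≤ ‖T u - (x : ℂ) • u‖) : (x : ℂ) ∉ spectrum ℂ T := by
  rw [ofReal_mem_spectrum_iff, spectrum.notMem_iff, ← IsUnit.neg_iff, neg_sub]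
  set S := T - algebraMap ℝ (H →L[ℂ] H) x with hSdef
  have hS : IsSelfAdjoint S := hT.sub (IsSelfAdjoint.algebraMap _ (IsSelfAdjoint.all x))
  have hSu : ∀ u, S u = T u - (x : ℂ) • u := fun u => by
    simp [hSdef, Algebra.algebraMap_eq_smul_one]
  have hbd : ∀ u, c * ‖u‖ ≤ ‖S u‖ := fun u => by rw [hSu]; exact h u
  have hanti : AntilipschitzWith (Real.toNNReal c⁻¹) S := by
    refine S.antilipschitz_of_bound fun u => ?_
    rw [Real.coe_toNNReal _ (by positivity), inv_mul_eq_div, le_div_iff₀ hc, mul_comm]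
    exact hbd u
  rw [ContinuousLinearMap.isUnit_iff_bijective]
  refine ⟨hanti.injective, ?_⟩
  have hcl : IsClosed (Set.range S) := hanti.isClosed_range S.uniformContinuous
  have hker : LinearMap.ker (S : H →ₗ[ℂ] H) = ⊥ := LinearMap.ker_eq_bot.2 hanti.injective
  have hort : (LinearMap.range (S : H →ₗ[ℂ] H))ᗮ = ⊥ := by
    have := ContinuousLinearMap.orthogonal_range S
    rw [ContinuousLinearMap.isSelfAdjoint_iff'.1 hS] at this
    rw [this, hker]
  have hr : LinearMap.range (S : H →ₗ[ℂ] H) = ⊤ := by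
    have hcl' : IsClosed ((LinearMap.range (S : H →ₗ[ℂ] H) : Submodule ℂ H) : Set H) := by
      convert hcl using 1
      rfl
    have : CompleteSpace (LinearMap.range (S : H →ₗ[ℂ] H)) := hcl'.completeSpace_coe
    exact (Submodule.orthogonal_eq_bot_iff).1 hort
  intro y
  have : y ∈ LinearMap.range (S : H →ₗ[ℂ] H) := hr ▸ Submodule.mem_top
  exact this

theorem le_of_mem_spectrum_of_inner_le {T : H →L[ℂ] H} (hT : IsSelfAdjoint T) {B : ℝ}
    (h : ∀ u, RCLike.re (inner ℂ (T u) u) ≤ B * ‖u‖ ^ 2) {x : ℝ}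
    (hx : (x : ℂ) ∈ spectrum ℂ T) : x ≤ B := by
  by_contra! hlt
  refine notMem_spectrum_of_bounded_below hT (sub_pos.2 hlt) (fun u => ?_) hx
  rcases (norm_nonneg u).eq_or_lt with h0 | h0
  · rw [← h0, mul_zero]; exact norm_nonneg _
  have h1 : RCLike.re (inner ℂ ((x : ℂ) • u - T u) u) =
      x * ‖u‖ ^ 2 - RCLike.re (inner ℂ (T u) u) := by
    rw [inner_sub_left, inner_smul_left, Complex.conj_ofReal, map_sub,
      ← inner_self_eq_norm_sq (𝕜 := ℂ) u]
    congr 1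
    exact RCLike.re_ofReal_mul _ _
  have h2 : RCLike.re (inner ℂ ((x : ℂ) • u - T u) u) ≤ ‖T u - (x : ℂ) • u‖ * ‖u‖ := by
    rw [norm_sub_rev]
    exact re_inner_le_norm _ _
  have := h u
  refine le_of_mul_le_mul_right ?_ h0
  nlinarith

theorem le_of_mem_spectrum_of_le_inner {T : H →L[ℂ] H} (hT : IsSelfAdjoint T) {B : ℝ}
    (h : ∀ u, B * ‖u‖ ^ 2 ≤ RCLike.re (inner ℂ (T u) u)) {x : ℝ}
    (hx : (x : ℂ) ∈ spectrum ℂ T) : B ≤ x := by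
  have := le_of_mem_spectrum_of_inner_le (T := -T) hT.neg (B := -B) (fun u => by
    have := h u
    simp only [neg_apply, inner_neg_left, map_neg]
    linarith) (x := -x) (by
    rw [← spectrum.neg_eq]
    simpa using hx)
  linarith

/-- An isolated point of the spectrum of a self-adjoint operator is an eigenvalue: the indicator
function of the point is continuous on the spectrum, and its functional calculus is a nonzero
projection onto eigenvectors. -/
theorem exists_eigenvector_of_isolated {T : H →L[ℂ] H} (hT : IsSelfAdjoint T) {x ρ : ℝ}
    (hρ : 0 < ρ) (hx : (x : ℂ) ∈ spectrum ℂ T)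
    (h : ∀ y : ℝ, y ≠ x → |y - x| < ρ → (y : ℂ) ∉ spectrum ℂ T) :
    ∃ u : H, u ≠ 0 ∧ T u = (x : ℂ) • u := by
  set f : ℝ → ℝ := fun y => if y = x then 1 else 0 with hf
  have hcont : ContinuousOn f (spectrum ℝ T) := by
    intro y hy
    by_cases hyx : y = x
    · have : f =ᶠ[nhdsWithin y (spectrum ℝ T)] fun _ => 1 := by
        have hb : Metric.ball x ρ ∈ nhds y := hyx ▸ Metric.ball_mem_nhds x hρ
        filter_upwards [nhdsWithin_le_nhds hb, self_mem_nhdsWithin] with z hz hz'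
        have : z = x := by
          by_contra hne
          exact h z hne hz ((ofReal_mem_spectrum_iff T z).2 hz')
        simp [hf, this]
      exact (continuousWithinAt_const (b := (1 : ℝ))).congr_of_eventuallyEq this (by simp [hf, hyx])
    · have : f =ᶠ[nhdsWithin y (spectrum ℝ T)] fun _ => 0 := by
        filter_upwards [nhdsWithin_le_nhds (isOpen_ne.mem_nhds hyx)] with z hz
        have : z ≠ x := hz
        simp [hf, this]
      exact (continuousWithinAt_const (b := (0 : ℝ))).congr_of_eventuallyEq this (by simp [hf, hyx])
  have h0 : cfc f T ≠ 0 := by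
    intro h0
    have h1 := cfc_map_spectrum (R := ℝ) f T hT hcont
    have h2 : (1 : ℝ) ∈ spectrum ℝ (cfc f T) := by
      rw [h1]
      exact ⟨x, (ofReal_mem_spectrum_iff T x).1 hx, by simp [hf]⟩
    rw [h0] at h2
    have : Nontrivial (H →L[ℂ] H) := by
      by_contra hn
      rw [not_nontrivial_iff_subsingleton] at hn
      rw [spectrum.of_subsingleton] at h2
      exact h2
    rw [spectrum.zero_eq] at h2
    exact one_ne_zero h2
  have hmul : (T - algebraMap ℝ _ x) * cfc f T = 0 := by
    have e : T - algebraMap ℝ _ x = cfc (fun y : ℝ => y - x) T := by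
      rw [cfc_sub (fun y : ℝ => y) (fun _ => x) T, cfc_id' ℝ T, cfc_const _ T]
    rw [e, ← cfc_mul (fun y : ℝ => y - x) f T (by fun_prop) hcont]
    have : (fun y => (y - x) * f y) = fun _ => (0 : ℝ) := by
      funext y
      by_cases hy : y = x <;> simp [hf, hy]
    rw [this, cfc_const_zero]
  obtain ⟨w, hw⟩ : ∃ w, cfc f T w ≠ 0 := by
    by_contra! hall
    exact h0 (ContinuousLinearMap.ext hall)
  refine ⟨cfc f T w, hw, ?_⟩
  have h2 : T (cfc f T w) - (x : ℂ) • cfc f T w = 0 := by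
    simpa [Algebra.algebraMap_eq_smul_one] using DFunLike.congr_fun hmul w
  exact sub_eq_zero.1 h2

end SelfAdjoint

/-! ### The Schrödinger operator -/

section Schrodinger

variable {d : ℕ} (V : AnalyticPotential d) (α θ : Fin d → ℝ)

/-- The potential `V(θ + nα)` along the orbit. -/
def orbitPotential (n : ℤ) : ℝ := V.toFun (θ + (n : ℝ) • α)

theorem schrodinger_apply (u : EllTwo) (n : ℤ) :
    schrodinger V α θ u n = u (n + 1) + u (n - 1) + (orbitPotential V α θ n : ℂ) * u n := rfl

theorem inner_shift (u w : EllTwo) (m : ℤ) :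
    inner ℂ (shift m u) w = inner ℂ u (shift (-m) w) := by
  rw [lp.inner_eq_tsum, lp.inner_eq_tsum,
    ← (Equiv.addRight m).tsum_eq (fun n => inner ℂ (u n) (shift (-m) w n))]
  refine tsum_congr fun n => ?_
  have : (shift (-m) w) ((Equiv.addRight m) n) = w n := by
    change w (n + m + -m) = w n
    rw [add_neg_cancel_right]
  rw [this]
  rfl

theorem isSelfAdjoint_schrodinger : IsSelfAdjoint (schrodinger V α θ) := by
  rw [ContinuousLinearMap.isSelfAdjoint_iff_isSymmetric]
  intro u w
  change inner ℂ (shift 1 u + shift (-1) u + mulSeq _ _ u) w =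
    inner ℂ u (shift 1 w + shift (-1) w + mulSeq _ _ w)
  rw [inner_add_left, inner_add_left, inner_add_right, inner_add_right, inner_shift, inner_shift,
    neg_neg, add_comm (inner ℂ u (shift (-1) w))]
  congr 1
  rw [lp.inner_eq_tsum, lp.inner_eq_tsum]
  refine tsum_congr fun n => ?_
  change inner ℂ ((V.toFun (θ + (n : ℝ) • α) : ℂ) * u n) (w n) =
    inner ℂ (u n) ((V.toFun (θ + (n : ℝ) • α) : ℂ) * w n)
  simp only [RCLike.inner_apply, map_mul, Complex.conj_ofReal]
  ring

theorem summable_norm_sq (u : EllTwo) : Summable fun n => ‖u n‖ ^ 2 := by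
  simpa using (lp.memℓp u).summable (by norm_num)

theorem norm_sq_eq_tsum (u : EllTwo) : ‖u‖ ^ 2 = ∑' n, ‖u n‖ ^ 2 := by
  have := lp.norm_rpow_eq_tsum (p := 2) (by norm_num) u
  simpa using this

end Schrodinger

/-! ### Approximate eigenvectors and positive solutions -/

section Weyl

variable {d : ℕ} (V : AnalyticPotential d) (α θ : Fin d → ℝ)

theorem summable_int_shift {f : ℤ → ℝ} (hf : Summable f) (m : ℤ) : Summable fun n => f (n + m) :=
  hf.comp_injective (add_left_injective m)

theorem tsum_int_shift (f : ℤ → ℝ) (m : ℤ) : ∑' n, f (n + m) = ∑' n, f n :=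
  (Equiv.addRight m).tsum_eq f

theorem abs_re_inner_le (z w : ℂ) : |RCLike.re (inner ℂ z w)| ≤ ‖z‖ * ‖w‖ :=
  (RCLike.abs_re_le_norm _).trans (norm_inner_le_norm _ _)

/-- The mass of `u` on `[0, 2N)` is estimated over disjoint pairs of neighbours. -/
theorem mul_le_sum_of_pairs {u : ℤ → ℂ} {k : ℝ} (hk : ∀ n, k ≤ ‖u (n + 1)‖ ^ 2 + ‖u n‖ ^ 2)
    (N : ℕ) : N * k ≤ ∑ n ∈ Finset.Ico (0 : ℤ) (2 * N), ‖u n‖ ^ 2 := by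
  induction N with
  | zero => simp
  | succ m ih =>
    have e : Finset.Ico (0 : ℤ) (2 * ((m + 1 : ℕ) : ℤ)) =
        insert (2 * (m : ℤ) + 1) (insert (2 * (m : ℤ)) (Finset.Ico 0 (2 * (m : ℤ)))) := by
      ext n
      simp only [Finset.mem_Ico, Finset.mem_insert]
      omega
    rw [e, Finset.sum_insert (by simp), Finset.sum_insert (by simp)]
    have := hk (2 * (m : ℤ))
    push_cast
    linarith

/-- Sharp truncations of a bounded approximate solution which does not decay are approximate
eigenvectors: the boundary terms stay bounded while the mass grows. -/
theorem defect_ge_of_bounded_below {ρ x B r k : ℝ} (hρ : 0 ≤ ρ)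
    (hlow : ∀ u, ρ * ‖u‖ ≤ ‖schrodinger V α θ u - (x : ℂ) • u‖) (u : ℤ → ℂ)
    (hB : ∀ n, ‖u n‖ ≤ B)
    (hr : ∀ n, ‖u (n + 1) + u (n - 1) + ((orbitPotential V α θ n - x : ℝ) : ℂ) * u n‖ ≤ r)
    (hk : ∀ n, k ≤ ‖u (n + 1)‖ ^ 2 + ‖u n‖ ^ 2) : ρ ^ 2 * k ≤ 2 * r ^ 2 := by
  have hB0 : 0 ≤ B := (norm_nonneg _).trans (hB 0)
  have hr0 : 0 ≤ r := (norm_nonneg _).trans (hr 0)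
  have main : ∀ N : ℕ, N * (ρ ^ 2 * k - 2 * r ^ 2) ≤ 2 * r ^ 2 + 4 * (r + 2 * B) ^ 2 := by
    intro N
    set s : Finset ℤ := Finset.Ico 0 (2 * N) with hs
    set w : ℤ → ℂ := fun n => if n ∈ s then u n else 0 with hw
    have hwz : ∀ n ∉ s, w n = 0 := fun n hn => by simp [hw, hn]
    have hwu : ∀ n ∈ s, w n = u n := fun n hn => by simp [hw, hn]
    have hmem : Memℓp w 2 := by
      refine memℓp_gen (summable_of_ne_finset_zero (s := s) fun n hn => ?_)
      rw [hwz n hn]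
      simp
    set wl : EllTwo := ⟨w, hmem⟩ with hwl
    have hnorm : ‖wl‖ ^ 2 = ∑ n ∈ s, ‖u n‖ ^ 2 := by
      rw [norm_sq_eq_tsum, tsum_eq_sum (s := s) (fun n hn => by
        change ‖w n‖ ^ 2 = 0
        rw [hwz n hn]; simp)]
      refine Finset.sum_congr rfl fun n hn => ?_
      change ‖w n‖ ^ 2 = _
      rw [hwu n hn]
    have hlower : N * k ≤ ‖wl‖ ^ 2 := by
      rw [hnorm]
      exact mul_le_sum_of_pairs hk N
    set g : EllTwo := schrodinger V α θ wl - (x : ℂ) • wl with hg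
    have hgn : ∀ n, g n = w (n + 1) + w (n - 1) + ((orbitPotential V α θ n - x : ℝ) : ℂ) * w n := by
      intro n
      change schrodinger V α θ wl n - (x : ℂ) * w n = _
      rw [schrodinger_apply]
      change w (n + 1) + w (n - 1) + _ * w n - _ = _
      push_cast
      ring
    set bd : Finset ℤ := {-1, 0, 2 * (N : ℤ) - 1, 2 * (N : ℤ)} with hbd
    have hg_out : ∀ n ∉ Finset.Ico (-1 : ℤ) (2 * N + 1), g n = 0 := by
      intro n hn
      rw [Finset.mem_Ico] at hn
      rw [hgn, hwz n, hwz (n + 1), hwz (n - 1)]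
      · simp
      all_goals
        rw [hs, Finset.mem_Ico]
        omega
    have hg_in : ∀ n ∈ Finset.Ico (-1 : ℤ) (2 * N + 1),
        ‖g n‖ ^ 2 ≤ r ^ 2 + if n ∈ bd then (r + 2 * B) ^ 2 else 0 := by
      intro n hn
      rw [Finset.mem_Ico] at hn
      by_cases hb : n ∈ bd
      · rw [if_pos hb]
        have hbound : ‖g n‖ ≤ r + 2 * B := by
          have hwB : ∀ m, ‖w m‖ ≤ B := by
            intro m
            by_cases hm : m ∈ s
            · rw [hwu m hm]; exact hB m
            · rw [hwz m hm, norm_zero]; exact hB0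
          by_cases hns : n ∈ s
          · have hd : ∀ m, ‖w m - u m‖ ≤ B := by
              intro m
              by_cases hm : m ∈ s
              · rw [hwu m hm, sub_self, norm_zero]; exact hB0
              · rw [hwz m hm, zero_sub, norm_neg]; exact hB m
            have e : g n = (u (n + 1) + u (n - 1) +
                ((orbitPotential V α θ n - x : ℝ) : ℂ) * u n) +
                (w (n + 1) - u (n + 1)) + (w (n - 1) - u (n - 1)) := by
              rw [hgn, hwu n hns]; ring
            rw [e]
            exact norm_add₃_le.trans (by linarith [hr n, hd (n + 1), hd (n - 1)])
          · rw [hgn, hwz n hns, mul_zero, add_zero]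
            exact (norm_add_le _ _).trans (by linarith [hwB (n + 1), hwB (n - 1)])
        have := pow_le_pow_left₀ (norm_nonneg _) hbound 2
        linarith [sq_nonneg r]
      · rw [if_neg hb, add_zero]
        simp only [hbd, Finset.mem_insert, Finset.mem_singleton, not_or] at hb
        refine pow_le_pow_left₀ (norm_nonneg _) ?_ 2
        rw [hgn, hwu n, hwu (n + 1), hwu (n - 1)]
        · exact hr n
        all_goals
          rw [hs, Finset.mem_Ico]
          omega
    have hupper : ‖g‖ ^ 2 ≤ (2 * N + 2) * r ^ 2 + 4 * (r + 2 * B) ^ 2 := by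
      rw [norm_sq_eq_tsum, tsum_eq_sum (s := Finset.Ico (-1 : ℤ) (2 * N + 1)) (fun n hn => by
        rw [hg_out n hn]; simp)]
      refine (Finset.sum_le_sum hg_in).trans ?_
      rw [Finset.sum_add_distrib, Finset.sum_const, Int.card_Ico, ← Finset.sum_filter,
        Finset.sum_const, nsmul_eq_mul, nsmul_eq_mul]
      have c1 : ((2 * (N : ℤ) + 1 - (-1)).toNat : ℝ) = 2 * N + 2 := by
        have : (2 * (N : ℤ) + 1 - (-1)).toNat = 2 * N + 2 := by omega
        rw [this]; push_cast; ring
      have c2 : ((Finset.filter (fun n => n ∈ bd) (Finset.Ico (-1 : ℤ) (2 * N + 1))).card : ℝ) ≤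
          4 := by
        have h1 : (Finset.filter (fun n => n ∈ bd) (Finset.Ico (-1 : ℤ) (2 * N + 1))).card ≤
            bd.card := Finset.card_le_card fun n hn => (Finset.mem_filter.1 hn).2
        have h2 : bd.card ≤ 4 := Finset.card_le_four
        exact_mod_cast h1.trans h2
      rw [c1]
      have := mul_le_mul_of_nonneg_right c2 (sq_nonneg (r + 2 * B))
      linarith
    have h1 := pow_le_pow_left₀ (mul_nonneg hρ (norm_nonneg _)) (hlow wl) 2
    rw [mul_pow] at h1
    have h2 := mul_le_mul_of_nonneg_left hlower (sq_nonneg ρ)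
    linarith
  by_contra! hlt
  obtain ⟨N, hN⟩ := exists_nat_gt ((2 * r ^ 2 + 4 * (r + 2 * B) ^ 2) / (ρ ^ 2 * k - 2 * r ^ 2))
  rw [div_lt_iff₀ (by linarith)] at hN
  linarith [main N]

/-- A positive solution `φ` of the eigenvalue equation (alternating in sign when `σ = -1`) bounds
the hopping term of the operator, by the inequality
`2 |u_n u_{n+1}| ≤ |u_n|² φ_{n+1} / φ_n + |u_{n+1}|² φ_n / φ_{n+1}`. -/
theorem abs_hopping_le {E σ : ℝ} {φ : ℤ → ℝ} (hφ : ∀ n, 0 < φ n)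
    (hsol : ∀ n, φ (n + 1) + φ (n - 1) = σ * (E - orbitPotential V α θ n) * φ n) (u : EllTwo) :
    |RCLike.re (inner ℂ (schrodinger V α θ u) u) -
      ∑' n, orbitPotential V α θ n * ‖u n‖ ^ 2| ≤
      ∑' n, σ * (E - orbitPotential V α θ n) * ‖u n‖ ^ 2 := by
  obtain ⟨C, hC⟩ := V.exists_bound
  have hCn : ∀ n, |orbitPotential V α θ n| ≤ C := fun n => hC _
  have hsu := summable_norm_sq u
  have hvs : Summable fun n => orbitPotential V α θ n * ‖u n‖ ^ 2 := by
    refine Summable.of_norm_bounded (hsu.mul_left C) fun n => ?_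
    rw [norm_mul, Real.norm_eq_abs, Real.norm_of_nonneg (sq_nonneg _)]
    exact mul_le_mul_of_nonneg_right (hCn n) (sq_nonneg _)
  have hws : Summable fun n => σ * (E - orbitPotential V α θ n) * ‖u n‖ ^ 2 := by
    have := ((hsu.mul_left E).sub hvs).mul_left σ
    refine this.congr fun n => ?_
    ring
  set A : ℤ → ℝ := fun n => φ (n + 1) / φ n * ‖u n‖ ^ 2 with hA
  set B : ℤ → ℝ := fun n => φ (n - 1) / φ n * ‖u n‖ ^ 2 with hB
  have hA0 : ∀ n, 0 ≤ A n := fun n =>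
    mul_nonneg (div_nonneg (hφ _).le (hφ _).le) (sq_nonneg _)
  have hB0 : ∀ n, 0 ≤ B n := fun n =>
    mul_nonneg (div_nonneg (hφ _).le (hφ _).le) (sq_nonneg _)
  have hAB : ∀ n, A n + B n = σ * (E - orbitPotential V α θ n) * ‖u n‖ ^ 2 := by
    intro n
    have := (hφ n).ne'
    simp only [hA, hB]
    rw [← add_mul, ← add_div, hsol, mul_div_assoc, div_self this, mul_one]
  have hsA : Summable A := Summable.of_nonneg_of_le hA0
    (fun n => by linarith [hAB n, hB0 n]) hws
  have hsB : Summable B := Summable.of_nonneg_of_le hB0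
    (fun n => by linarith [hAB n, hA0 n]) hws
  have hsA' : Summable fun n => A (n - 1) := by
    simpa only [sub_eq_add_neg] using summable_int_shift hsA (-1)
  have hsB' : Summable fun n => B (n + 1) :=
    summable_int_shift hsB 1
  have young : ∀ n, ‖u (n + 1)‖ * ‖u n‖ ≤ (A n + B (n + 1)) / 2 := by
    intro n
    have h1 := hφ n
    have h2 := hφ (n + 1)
    simp only [hA, hB, add_sub_cancel_right]
    have e : (φ (n + 1) / φ n * ‖u n‖ ^ 2 + φ n / φ (n + 1) * ‖u (n + 1)‖ ^ 2) / 2 -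
        ‖u (n + 1)‖ * ‖u n‖ =
        (φ (n + 1) * ‖u n‖ - φ n * ‖u (n + 1)‖) ^ 2 / (2 * φ n * φ (n + 1)) := by
      field_simp
      ring
    have : 0 ≤ (φ (n + 1) * ‖u n‖ - φ n * ‖u (n + 1)‖) ^ 2 / (2 * φ n * φ (n + 1)) := by
      positivity
    linarith
  have hin : HasSum (fun n => RCLike.re (inner ℂ (schrodinger V α θ u n) (u n)))
      (RCLike.re (inner ℂ (schrodinger V α θ u) u)) :=
    (lp.hasSum_inner (𝕜 := ℂ) (schrodinger V α θ u) u).mapL RCLike.reCLM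
  have hpt : ∀ n, |RCLike.re (inner ℂ (schrodinger V α θ u n) (u n)) -
      orbitPotential V α θ n * ‖u n‖ ^ 2| ≤ (A n + B (n + 1)) / 2 + (A (n - 1) + B n) / 2 := by
    intro n
    have e : RCLike.re (inner ℂ (schrodinger V α θ u n) (u n)) -
        orbitPotential V α θ n * ‖u n‖ ^ 2 =
        RCLike.re (inner ℂ (u (n + 1)) (u n)) + RCLike.re (inner ℂ (u (n - 1)) (u n)) := by
      rw [schrodinger_apply, inner_add_left, inner_add_left, map_add, map_add]
      have h1 : inner ℂ ((orbitPotential V α θ n : ℂ) * u n) (u n) =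
          (orbitPotential V α θ n : ℂ) * inner ℂ (u n) (u n) := by
        rw [← smul_eq_mul, inner_smul_left, Complex.conj_ofReal]
      rw [h1, ← inner_self_eq_norm_sq (𝕜 := ℂ) (u n)]
      have : RCLike.re ((orbitPotential V α θ n : ℂ) * inner ℂ (u n) (u n)) =
        orbitPotential V α θ n * RCLike.re (inner ℂ (u n) (u n)) := RCLike.re_ofReal_mul _ _
      rw [this]
      ring
    rw [e]
    refine (abs_add_le _ _).trans (add_le_add ?_ ?_)
    · exact (abs_re_inner_le _ _).trans (young n)
    · have := young (n - 1)
      rw [sub_add_cancel] at this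
      have h := abs_re_inner_le (u (n - 1)) (u n)
      rw [mul_comm] at h
      exact h.trans this
  have hsum : Summable fun n => (A n + B (n + 1)) / 2 + (A (n - 1) + B n) / 2 :=
    ((hsA.add hsB').div_const 2).add ((hsA'.add hsB).div_const 2)
  have tA : ∑' n, A (n - 1) = ∑' n, A n := tsum_int_shift A (-1)
  have tB : ∑' n, B (n + 1) = ∑' n, B n := tsum_int_shift B 1
  have hL := hin.sub hvs.hasSum
  rw [← hL.tsum_eq, ← Real.norm_eq_abs]
  refine (tsum_of_norm_bounded hsum.hasSum hpt).trans_eq ?_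
  rw [← tsum_congr hAB, ((hsA.add hsB').div_const 2).tsum_add ((hsA'.add hsB).div_const 2),
    tsum_div_const, tsum_div_const, hsA.tsum_add hsB', hsA'.tsum_add hsB, hsA.tsum_add hsB,
    tB, tA]
  ring

end Weyl

/-! ### Boundedness below in the hyperbolic regime -/

section Lyapunov

variable {v : ℤ → ℝ} {E ζ M K : ℝ} (D : EdgeData v E ζ M K)

include D in
/-- For `0 < δ ≪ ζ` the cocycle at energy `E - δ` is hyperbolic: summing the increments of the
corrected quadratic form over `ℤ` bounds `u` by `(H - E + δ) u`. -/
theorem EdgeData.bounded_below (hζ : 0 < ζ) {δ : ℝ} (hδ : 0 < δ) (hM : 1 ≤ M)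
    (hK : M ^ 2 ≤ K) (hδζ : δ ≤ ζ) (hζK : 1000 * K ^ 3 * ζ ≤ 1) (hδM : δ * M ^ 2 ≤ ζ / 2) :
    ∃ c : ℝ, 0 < c ∧ ∀ u : ℤ → ℝ, Summable (fun n => u n ^ 2) →
      Summable (fun n => (u (n + 1) + u (n - 1) + (v n - (E - δ)) * u n) ^ 2) →
      c * ∑' n, u n ^ 2 ≤ ∑' n, (u (n + 1) + u (n - 1) + (v n - (E - δ)) * u n) ^ 2 := by
  have hK1 : 1 ≤ K := (one_le_pow₀ hM).trans hK
  have hM0 : 0 < M := by linarith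
  have hζM : ζ * M ^ 2 ≤ 1 / 20 := by
    have h1 : M ^ 2 * ζ ≤ K ^ 3 * ζ := by
      have : M ^ 2 ≤ K ^ 3 := hK.trans (le_self_pow₀ hK1 (by norm_num))
      gcongr
    linarith
  have hb : δ * D.b ≤ ζ / 2 := (mul_le_mul_of_nonneg_left D.b_le hδ.le).trans hδM
  obtain ⟨c, C, hc, hC, hstep⟩ := lyapunov_step hζ hδ hM hK hδζ hζK (D.le_a hζ.le hM hζM) hb
  refine ⟨c / (2 * M ^ 2 * (C + 1)), by positivity, fun u hu hf => ?_⟩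
  set f : ℤ → ℝ := fun n => u (n + 1) + u (n - 1) + (v n - (E - δ)) * u n with hfdef
  set p₁ : ℤ → ℝ := fun n => (D.ψ (n - 1) - ζ * D.φ (n - 1)) * u n - D.ψ n * u (n - 1) with hp₁
  set p₂ : ℤ → ℝ := fun n => D.φ n * u (n - 1) - D.φ (n - 1) * u n with hp₂
  have hW : ∀ n, D.φ n * (D.ψ (n - 1) - ζ * D.φ (n - 1)) - D.ψ n * D.φ (n - 1) = 1 := by
    intro n
    have := D.wronskian (n - 1)
    rwa [sub_add_cancel] at this
  have hup : ∀ n, u n = D.φ n * p₁ n + D.ψ n * p₂ n := by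
    intro n
    simp only [hp₁, hp₂]
    linear_combination (-u n) * hW n
  have hp₁s : ∀ n, p₁ (n + 1) = p₁ n + ζ * p₂ n - (D.ψ n - ζ * D.φ n) * (δ * u n - f n) := by
    intro n
    simp only [hp₁, hp₂, hfdef, add_sub_cancel_right]
    linear_combination (-u n) * D.solution_ψ n + ζ * u n * D.solution_φ n
  have hp₂s : ∀ n, p₂ (n + 1) = p₂ n + D.φ n * (δ * u n - f n) := by
    intro n
    simp only [hp₂, hfdef, add_sub_cancel_right]
    linear_combination (u n) * D.solution_φ n
  have hu' : Summable fun n => u (n - 1) ^ 2 := by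
    simpa only [sub_eq_add_neg] using summable_int_shift hu (-1)
  have sq2 : ∀ x y z w : ℝ, |x| ≤ 2 * M → |y| ≤ 2 * M →
      (x * z - y * w) ^ 2 ≤ 8 * M ^ 2 * (z ^ 2 + w ^ 2) := by
    intro x y z w hx hy
    have hx2 : x ^ 2 ≤ (2 * M) ^ 2 := sq_le_sq' (abs_le.1 hx).1 (abs_le.1 hx).2
    have hy2 : y ^ 2 ≤ (2 * M) ^ 2 := sq_le_sq' (abs_le.1 hy).1 (abs_le.1 hy).2
    have h1 := mul_le_mul_of_nonneg_right hx2 (sq_nonneg z)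
    have h2 := mul_le_mul_of_nonneg_right hy2 (sq_nonneg w)
    linarith [sq_nonneg (x * z + y * w)]
  have hζ1 : ζ ≤ 1 := by
    have : ζ * 1 ≤ ζ * M ^ 2 := by
      have := one_le_pow₀ hM (n := 2)
      gcongr
    linarith
  have bψ : ∀ n, |D.ψ n - ζ * D.φ n| ≤ 2 * M := by
    intro n
    refine (abs_sub _ _).trans ?_
    rw [abs_mul, abs_of_pos hζ]
    have : ζ * |D.φ n| ≤ 1 * M := mul_le_mul hζ1 (D.abs_φ n) (abs_nonneg _) zero_le_one
    linarith [D.abs_ψ n]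
  have hs₁ : Summable fun n => p₁ n ^ 2 := by
    refine Summable.of_nonneg_of_le (fun n => sq_nonneg _) (fun n => ?_)
      ((hu.add hu').mul_left (8 * M ^ 2))
    exact sq2 _ _ _ _ (bψ _) ((D.abs_ψ _).trans (by linarith))
  have hs₂ : Summable fun n => p₂ n ^ 2 := by
    refine Summable.of_nonneg_of_le (fun n => sq_nonneg _) (fun n => ?_)
      ((hu'.add hu).mul_left (8 * M ^ 2))
    exact sq2 _ _ _ _ ((D.abs_φ _).trans (by linarith)) ((D.abs_φ _).trans (by linarith))
  set F : ℤ → ℝ := fun n => p₁ n * p₂ n + δ * (D.y₂ n * p₂ n ^ 2 - D.y₁ n * p₁ n ^ 2) with hF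
  have hFs : Summable F := by
    refine Summable.of_norm_bounded ((hs₁.add hs₂).mul_left (1 + δ * K)) fun n => ?_
    rw [Real.norm_eq_abs]
    simp only [hF]
    have h1 : |p₁ n * p₂ n| ≤ p₁ n ^ 2 + p₂ n ^ 2 := by
      rw [abs_le]
      constructor <;>
        linarith [sq_nonneg (p₁ n + p₂ n), sq_nonneg (p₁ n - p₂ n), sq_nonneg (p₁ n),
          sq_nonneg (p₂ n)]
    have h2 : |δ * (D.y₂ n * p₂ n ^ 2 - D.y₁ n * p₁ n ^ 2)| ≤
        δ * (K * p₂ n ^ 2 + K * p₁ n ^ 2) := by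
      rw [abs_mul, abs_of_pos hδ]
      refine mul_le_mul_of_nonneg_left ((abs_sub _ _).trans ?_) hδ.le
      rw [abs_mul, abs_mul, abs_of_nonneg (sq_nonneg (p₂ n)), abs_of_nonneg (sq_nonneg (p₁ n))]
      exact add_le_add (mul_le_mul_of_nonneg_right (D.abs_y₂ n) (sq_nonneg _))
        (mul_le_mul_of_nonneg_right (D.abs_y₁ n) (sq_nonneg _))
    refine (abs_add_le _ _).trans ?_
    linarith
  have hFs' : Summable fun n => F (n + 1) := summable_int_shift hFs 1
  have hinc : ∀ n, c * (p₁ n ^ 2 + p₂ n ^ 2) - C * f n ^ 2 ≤ F (n + 1) - F n := fun n =>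
    hstep _ _ _ _ _ _ _ _ _ _ _ _ (D.abs_φ n) (D.abs_ψ n) (D.abs_y₁ (n + 1)) (D.abs_y₂ (n + 1))
      (D.step_y₁ n) (D.step_y₂ n) (hup n) (hp₁s n) (hp₂s n)
  have hsum := ((((hs₁.add hs₂).mul_left c).sub (hf.mul_left C))).tsum_le_tsum hinc
    (hFs'.sub hFs)
  have tF : ∑' n, F (n + 1) = ∑' n, F n := tsum_int_shift F 1
  rw [hFs'.tsum_sub hFs, tF, sub_self,
    ((hs₁.add hs₂).mul_left c).tsum_sub (hf.mul_left C), tsum_mul_left, tsum_mul_left] at hsum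
  have hu2 : ∑' n, u n ^ 2 ≤ 2 * M ^ 2 * ∑' n, (p₁ n ^ 2 + p₂ n ^ 2) := by
    rw [← tsum_mul_left]
    refine hu.tsum_le_tsum (fun n => ?_) ((hs₁.add hs₂).mul_left _)
    rw [hup n]
    have h1 := mul_le_mul_of_nonneg_right (D.sq_φ_le n) (sq_nonneg (p₁ n))
    have h2 := mul_le_mul_of_nonneg_right (D.sq_ψ_le n) (sq_nonneg (p₂ n))
    linarith [sq_nonneg (D.φ n * p₁ n - D.ψ n * p₂ n)]
  have hf0 : 0 ≤ ∑' n, f n ^ 2 := tsum_nonneg fun n => sq_nonneg _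
  rw [div_mul_eq_mul_div, div_le_iff₀ (by positivity)]
  have h3 := mul_le_mul_of_nonneg_left hu2 hc.le
  have h4 := mul_le_mul_of_nonneg_left hsum (by positivity : 0 ≤ 2 * M ^ 2)
  have h5 : 0 ≤ M ^ 2 * ∑' n, f n ^ 2 := by positivity
  linarith

end Lyapunov

/-! ### Spectral gaps at a parabolic energy -/

section GapEdges

variable {d : ℕ} {V : AnalyticPotential d} {α θ : Fin d → ℝ} {E ζ M K a b : ℝ}

/-- In the elliptic regime, the quasimode at energy `E - δ` gives spectrum closer than `|δ|` to
`E - δ`. -/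
theorem EdgeData.exists_spec_of_elliptic (D : EdgeData (orbitPotential V α θ) E ζ M K)
    (hM : 1 ≤ M) (hK : M ^ 2 ≤ K) (hζ : 0 ≤ ζ) {δ t : ℝ} (hδ : δ ≠ 0)
    (hδt : |δ| ≤ t) (hζt : ζ ≤ t) (ht : 200 * (M ^ 4 * K * t) ≤ 1)
    (hell : δ * D.a * ζ ≤ δ ^ 2 * (D.a * D.b - D.c ^ 2)) :
    ∃ y ∈ spec V α θ, |y - (E - δ)| < |δ| := by
  by_contra! hcon
  obtain ⟨u, B, r, k, hB, hr, hk, hlt⟩ := D.exists_quasimode hM hK hζ hδ hδt hζt ht hell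
  have hlow := mul_norm_le_of_forall_notMem_spectrum (isSelfAdjoint_schrodinger V α θ)
    (x := E - δ) (abs_nonneg δ) (fun y hy hmem => absurd hy (not_lt.2 (hcon y hmem)))
  have := defect_ge_of_bounded_below V α θ (abs_nonneg δ) hlow u hB hr hk
  rw [sq_abs] at this
  linarith

/-- In the hyperbolic regime `E - δ` is not in the spectrum. The lower bound for real sequences is
applied to the real and imaginary parts. -/
theorem EdgeData.notMem_spec_of_hyperbolic (D : EdgeData (orbitPotential V α θ) E ζ M K)
    (hζ : 0 < ζ) {δ : ℝ} (hδ : 0 < δ) (hM : 1 ≤ M) (hK : M ^ 2 ≤ K) (hδζ : δ ≤ ζ)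
    (hζK : 1000 * K ^ 3 * ζ ≤ 1) (hδM : δ * M ^ 2 ≤ ζ / 2) : E - δ ∉ spec V α θ := by
  obtain ⟨c, hc, hbd⟩ := D.bounded_below hζ hδ hM hK hδζ hζK hδM
  refine notMem_spectrum_of_bounded_below (isSelfAdjoint_schrodinger V α θ)
    (Real.sqrt_pos.2 hc) fun u => ?_
  refine abs_le_of_sq_le_sq' ?_ (norm_nonneg _) |>.2
  rw [mul_pow, Real.sq_sqrt hc.le]
  set g : EllTwo := schrodinger V α θ u - ((E - δ : ℝ) : ℂ) • u with hg
  have hgn : ∀ n, g n = u (n + 1) + u (n - 1) +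
      ((orbitPotential V α θ n - (E - δ) : ℝ) : ℂ) * u n := by
    intro n
    change schrodinger V α θ u n - ((E - δ : ℝ) : ℂ) * u n = _
    rw [schrodinger_apply]
    push_cast
    ring
  have hsplit : ∀ w : EllTwo, (Summable fun n => (w n).re ^ 2) ∧ (Summable fun n => (w n).im ^ 2) ∧
      ‖w‖ ^ 2 = ∑' n, (w n).re ^ 2 + ∑' n, (w n).im ^ 2 := by
    intro w
    have hs := summable_norm_sq w
    have e : ∀ n, ‖w n‖ ^ 2 = (w n).re ^ 2 + (w n).im ^ 2 := by
      intro n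
      rw [← Complex.normSq_eq_norm_sq, Complex.normSq_apply]
      ring
    have h1 : Summable fun n => (w n).re ^ 2 := Summable.of_nonneg_of_le (fun n => sq_nonneg _)
      (fun n => by rw [e n]; linarith [sq_nonneg (w n).im]) hs
    have h2 : Summable fun n => (w n).im ^ 2 := Summable.of_nonneg_of_le (fun n => sq_nonneg _)
      (fun n => by rw [e n]; linarith [sq_nonneg (w n).re]) hs
    refine ⟨h1, h2, ?_⟩
    rw [norm_sq_eq_tsum, ← h1.tsum_add h2]
    exact tsum_congr e
  obtain ⟨ur, ui, un⟩ := hsplit u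
  obtain ⟨gr, gi, gn⟩ := hsplit g
  have hgre : ∀ n, (g n).re = (u (n + 1)).re + (u (n - 1)).re +
      (orbitPotential V α θ n - (E - δ)) * (u n).re := by
    intro n
    rw [hgn, Complex.add_re, Complex.add_re, Complex.re_ofReal_mul]
  have hgim : ∀ n, (g n).im = (u (n + 1)).im + (u (n - 1)).im +
      (orbitPotential V α θ n - (E - δ)) * (u n).im := by
    intro n
    rw [hgn, Complex.add_im, Complex.add_im, Complex.im_ofReal_mul]
  simp only [hgre] at gr gn
  simp only [hgim] at gi gn
  have h1 := hbd _ ur gr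
  have h2 := hbd _ ui gi
  rw [un, gn]
  linarith

theorem IsSpectralGap.notMem {S : Set ℝ} (hG : IsSpectralGap S a b) {y : ℝ} (h1 : a < y)
    (h2 : y < b) : y ∉ S := hG.2.2.2 y ⟨h1, h2⟩

/-- A parabolic edge with positive `ζ` is the upper edge of its gap, and the gap length is
`ζ^{1 ± κ}`: just above `E`, and at distance `ζ^{1 - κ}` below it, the averaged cocycle is elliptic,
while it is hyperbolic at distances up to `ζ^{1 + κ}` below `E`. -/
theorem EdgeData.gap_bounds {L κ : ℝ} (D : EdgeData (orbitPotential V α θ) E ζ M (M ^ 2 * L))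
    (hκ₀ : 0 < κ) (hκ₁ : κ < 1 / 4) (hG : IsSpectralGap (spec V α θ) a b) (hE : E = a ∨ E = b)
    (hζ₀ : 0 < ζ) (hζ₁ : ζ < 1 / 2) (hM : 1 ≤ M) (hL : 1 ≤ L)
    (hsmall : M ^ 10 * L ^ 4 * ζ ^ κ ≤ 1 / 10 ^ 5) :
    ζ ^ (1 + κ) ≤ b - a ∧ b - a ≤ ζ ^ (1 - κ) := by
  have hM0 : 0 < M := by linarith
  have hL0 : 0 < L := by linarith
  set ε := ζ ^ κ with hε
  have hε0 : 0 < ε := Real.rpow_pos_of_pos hζ₀ _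
  have hζ4 : ζ ≤ ε ^ 4 := by
    rw [hε, ← Real.rpow_natCast, ← Real.rpow_mul hζ₀.le]
    calc ζ = ζ ^ (1 : ℝ) := (Real.rpow_one _).symm
      _ ≤ ζ ^ (κ * (4 : ℕ)) := Real.rpow_le_rpow_of_exponent_ge hζ₀ (by linarith) (by
        push_cast; linarith)
  have hζ3 : ζ ^ (1 - κ) ≤ ε ^ 3 := by
    rw [hε, ← Real.rpow_natCast, ← Real.rpow_mul hζ₀.le]
    exact Real.rpow_le_rpow_of_exponent_ge hζ₀ (by linarith) (by push_cast; linarith)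
  have hplus : ζ ^ (1 + κ) = ζ * ε := by rw [Real.rpow_add hζ₀, Real.rpow_one]
  have hminus : ζ = ζ ^ (1 - κ) * ε := by
    rw [hε, ← Real.rpow_add hζ₀, sub_add_cancel, Real.rpow_one]
  have hM10 : 1 ≤ M ^ 10 := one_le_pow₀ hM
  have hL4 : 1 ≤ L ^ 4 := one_le_pow₀ hL
  -- every power of `M` and `L` needed below is dominated by `M ^ 10 * L ^ 4`
  have hdom : ∀ i j : ℕ, i ≤ 10 → j ≤ 4 → M ^ i * L ^ j * ε ≤ 1 / 10 ^ 5 := by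
    intro i j hi hj
    refine le_trans ?_ hsmall
    have := pow_le_pow_right₀ hM hi
    have := pow_le_pow_right₀ hL hj
    gcongr
  have hε1 : ε ≤ 1 / 10 ^ 5 := by simpa using hdom 0 0 (by norm_num) (by norm_num)
  have hε3 : ε ^ 3 ≤ ε := pow_le_of_le_one hε0.le (by linarith) (by norm_num)
  have hζε3 : ζ ≤ ε ^ 3 := hζ4.trans (pow_le_pow_of_le_one hε0.le (by linarith) (by norm_num))
  have hMε : M ^ 2 * ε ≤ 1 / 10 ^ 5 := by simpa using hdom 2 0 (by norm_num) (by norm_num)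
  have hK : M ^ 2 ≤ M ^ 2 * L := le_mul_of_one_le_right (by positivity) hL
  have ht : 200 * (M ^ 4 * (M ^ 2 * L) * ε ^ 3) ≤ 1 := by
    have h1 : M ^ 4 * (M ^ 2 * L) * ε ^ 3 ≤ M ^ 4 * (M ^ 2 * L) * ε := by gcongr
    have h2 := hdom 6 1 (by norm_num) (by norm_num)
    have e : M ^ 4 * (M ^ 2 * L) * ε = M ^ 6 * L ^ 1 * ε := by ring
    linarith
  have hζM : ζ * M ^ 2 ≤ 1 / 20 := by
    have : ζ * M ^ 2 ≤ ε * M ^ 2 := by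
      have := hζε3.trans hε3
      gcongr
    linarith
  have hν := D.le_gram hζ₀.le hζM
  have hab := hG.1
  -- the gap lies below `E`
  have hEb : E = b := by
    refine hE.resolve_left fun hEa => ?_
    set m := min ζ ((b - a) / 2) with hm
    have hm0 : 0 < m := lt_min hζ₀ (by linarith)
    have hmζ : m ≤ ζ := min_le_left _ _
    have hmb : m ≤ (b - a) / 2 := min_le_right _ _
    obtain ⟨y, hy, hlt⟩ := D.exists_spec_of_elliptic hM hK hζ₀.le (δ := -m) (t := ε ^ 3)
      (neg_ne_zero.2 hm0.ne') (by rw [abs_neg, abs_of_pos hm0]; exact hmζ.trans hζε3) hζε3 ht (by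
        have h1 : 0 ≤ m * D.a * ζ := mul_nonneg (mul_nonneg hm0.le D.a_nonneg) hζ₀.le
        have h2 : 0 ≤ (-m) ^ 2 * (D.a * D.b - D.c ^ 2) :=
          mul_nonneg (sq_nonneg _) (by linarith)
        linarith)
    rw [abs_neg, abs_of_pos hm0, abs_lt] at hlt
    exact hG.notMem (by linarith) (by linarith) hy
  constructor
  · by_contra! hlt
    rw [hplus] at hlt
    refine D.notMem_spec_of_hyperbolic hζ₀ (δ := b - a) (by linarith) hM hK ?_ ?_ ?_ ?_
    · have : ζ * ε ≤ ζ * 1 := by gcongr; linarith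
      linarith
    · have h1 : (M ^ 2 * L) ^ 3 * ζ ≤ (M ^ 2 * L) ^ 3 * ε := by
        have := hζε3.trans hε3
        gcongr
      have h2 := hdom 6 3 (by norm_num) (by norm_num)
      have e : (M ^ 2 * L) ^ 3 * ε = M ^ 6 * L ^ 3 * ε := by ring
      linarith
    · have h1 : (b - a) * M ^ 2 ≤ ζ * ε * M ^ 2 := by gcongr
      have h2 : ζ * (M ^ 2 * ε) ≤ ζ * (1 / 10 ^ 5) := by gcongr
      linarith
    · rw [hEb, sub_sub_cancel]
      exact hG.2.1
  · by_contra! hlt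
    set δ := ζ ^ (1 - κ) / 2 with hδ
    have hδ0 : 0 < δ := half_pos (Real.rpow_pos_of_pos hζ₀ _)
    have hζδ : ζ = 2 * δ * ε := by rw [hδ]; linarith
    obtain ⟨y, hy, hylt⟩ := D.exists_spec_of_elliptic hM hK hζ₀.le (δ := δ) (t := ε ^ 3)
      hδ0.ne' (by rw [abs_of_pos hδ0]; linarith) hζε3 ht (by
        have h1 : D.a * ζ ≤ M ^ 2 * ζ := mul_le_mul_of_nonneg_right D.a_le hζ₀.le
        have h2 : δ * (M ^ 2 * ε) ≤ δ * (1 / 10 ^ 5) := by gcongr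
        have h3 : M ^ 2 * ζ = 2 * (δ * (M ^ 2 * ε)) := by rw [hζδ]; ring
        have h4 : δ * (1 / 5) ≤ δ * (D.a * D.b - D.c ^ 2) := by gcongr
        have h5 : D.a * ζ ≤ δ * (D.a * D.b - D.c ^ 2) := by linarith
        have := mul_le_mul_of_nonneg_left h5 hδ0.le
        linarith)
    rw [abs_of_pos hδ0, abs_lt] at hylt
    exact hG.notMem (by linarith) (by linarith) hy

/-- The mean `a` of `φ²` is positive. -/
theorem EdgeData.not_summable_sq_φ (D : EdgeData (orbitPotential V α θ) E ζ M K) (hζ : 0 ≤ ζ) :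
    ¬ Summable fun n => D.φ n ^ 2 := by
  intro hs
  have hs' : Summable fun n : ℕ => D.φ (n : ℤ) ^ 2 := hs.comp_injective Nat.cast_injective
  have key : ∀ N : ℕ, ∑ n ∈ Finset.range N, D.φ (n : ℤ) ^ 2 = N * D.a + (D.y₁ N - D.y₁ 0) := by
    intro N
    induction N with
    | zero => simp
    | succ m ih =>
      have := D.step_y₁ m
      rw [Finset.sum_range_succ, ih]
      push_cast
      linarith
  have ha := D.a_pos hζ
  obtain ⟨N, hN⟩ := exists_nat_gt ((∑' n : ℕ, D.φ (n : ℤ) ^ 2 + 2 * K) / D.a)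
  rw [div_lt_iff₀ ha] at hN
  have h1 := hs'.sum_le_tsum (Finset.range N) fun n _ => sq_nonneg _
  rw [key] at h1
  linarith [(abs_le.1 (D.abs_y₁ N)).1, (abs_le.1 (D.abs_y₁ 0)).2]

/-- The Wronskian of `φ` and an eigenvector is constant and tends to zero along `ℤ`, hence vanishes.
If `φ` has no zero, the eigenvector is then a multiple of `φ`, which is not square summable. -/
theorem EdgeData.not_eigenvalue (D : EdgeData (orbitPotential V α θ) E ζ M K) (hζ : 0 ≤ ζ)
    (hφ : ∀ n, D.φ n ≠ 0) {u : EllTwo} (hu : u ≠ 0) : schrodinger V α θ u ≠ (E : ℂ) • u := by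
  intro heig
  have hn : ∀ n, u (n + 1) + u (n - 1) + (orbitPotential V α θ n : ℂ) * u n = E * u n := by
    intro n
    rw [← schrodinger_apply, heig]
    rfl
  set W : ℤ → ℂ := fun n => u (n + 1) * D.φ n - u n * D.φ (n + 1) with hW
  have hstep : ∀ n, W (n + 1) = W n := by
    intro n
    have h1 := hn (n + 1)
    have h2 := congrArg (fun x : ℝ => (x : ℂ)) (D.solution_φ (n + 1))
    push_cast at h2
    rw [add_sub_cancel_right] at h1 h2
    simp only [hW]
    linear_combination (D.φ (n + 1) : ℂ) * h1 - u (n + 1) * h2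
  have hconst : ∀ n, W n = W 0 := by
    intro n
    induction n using Int.induction_on with
    | zero => rfl
    | succ k ih => rw [hstep, ih]
    | pred k ih => rw [← ih, ← hstep, sub_add_cancel]
  have hu0 : Tendsto (fun n => ‖u n‖ ^ 2) cofinite (nhds 0) :=
    (summable_norm_sq u).tendsto_cofinite_zero
  have hW0 : W 0 = 0 := by
    by_contra hne
    have hM0 := D.bound_nonneg
    have hpos : 0 < ‖W 0‖ / (2 * (M + 1)) := div_pos (norm_pos_iff.2 hne) (by positivity)
    have hev : ∀ᶠ n in cofinite, ‖u n‖ < ‖W 0‖ / (2 * (M + 1)) := by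
      filter_upwards [hu0.eventually (gt_mem_nhds (pow_pos hpos 2))] with n hlt
      exact lt_of_pow_lt_pow_left₀ 2 hpos.le hlt
    have hev' : ∀ᶠ n in cofinite, ‖u (n + 1)‖ < ‖W 0‖ / (2 * (M + 1)) :=
      (add_left_injective (1 : ℤ)).tendsto_cofinite.eventually hev
    obtain ⟨n, h1, h2⟩ := (hev.and hev').exists
    have hle : ‖W n‖ ≤ ‖u (n + 1)‖ * M + ‖u n‖ * M := by
      refine (norm_sub_le _ _).trans ?_
      rw [norm_mul, norm_mul, Complex.norm_real, Complex.norm_real]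
      exact add_le_add (mul_le_mul_of_nonneg_left (D.abs_φ _) (norm_nonneg _))
        (mul_le_mul_of_nonneg_left (D.abs_φ _) (norm_nonneg _))
    rw [hconst] at hle
    rw [lt_div_iff₀ (by positivity)] at h1 h2
    linarith [norm_nonneg (u n), norm_nonneg (u (n + 1)), norm_pos_iff.2 hne]
  have hratio : ∀ n, u n / D.φ n = u 0 / D.φ 0 := by
    have hs : ∀ n, u (n + 1) / D.φ (n + 1) = u n / D.φ n := by
      intro n
      have h1 : W n = 0 := (hconst n).trans hW0
      have h2 : (D.φ n : ℂ) ≠ 0 := by exact_mod_cast hφ n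
      have h3 : (D.φ (n + 1) : ℂ) ≠ 0 := by exact_mod_cast hφ (n + 1)
      rw [div_eq_div_iff h3 h2]
      exact sub_eq_zero.1 h1
    intro n
    induction n using Int.induction_on with
    | zero => rfl
    | succ k ih => rw [hs, ih]
    | pred k ih => rw [← ih, ← hs, sub_add_cancel]
  have hun : ∀ n, u n = u 0 / D.φ 0 * D.φ n := by
    intro n
    have h2 : (D.φ n : ℂ) ≠ 0 := by exact_mod_cast hφ n
    rw [← hratio n, div_mul_cancel₀ _ h2]
  have hc : u 0 / D.φ 0 ≠ 0 := by
    intro h0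
    refine hu ?_
    ext n
    rw [hun n, h0, zero_mul]
    rfl
  refine D.not_summable_sq_φ hζ ?_
  have := (summable_norm_sq u).mul_left (‖u 0 / D.φ 0‖ ^ 2)⁻¹
  refine this.congr fun n => ?_
  have hc' := norm_ne_zero_iff.2 hc
  rw [hun n, norm_mul, mul_pow, Complex.norm_real, Real.norm_eq_abs, sq_abs, inv_mul_cancel_left₀]
  exact pow_ne_zero 2 hc'

/-- An edge of a bounded gap carries no positive (or sign-alternating) solution: such a solution
makes `E` an extreme point of the spectrum, hence isolated, hence an eigenvalue. -/
theorem EdgeData.not_extremal (D : EdgeData (orbitPotential V α θ) E ζ M K) (hζ : 0 ≤ ζ)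
    (hφ : ∀ n, D.φ n ≠ 0) (hG : IsSpectralGap (spec V α θ) a b) (hE : E = a ∨ E = b)
    {σ : ℝ} (hσ : σ = 1 ∨ σ = -1) {χ : ℤ → ℝ} (hχ : ∀ n, 0 < χ n)
    (hsol : ∀ n, χ (n + 1) + χ (n - 1) = σ * (E - orbitPotential V α θ n) * χ n) : False := by
  have hself := isSelfAdjoint_schrodinger V α θ
  obtain ⟨C, hC⟩ := V.exists_bound
  have hvs : ∀ u : EllTwo, Summable fun n => orbitPotential V α θ n * ‖u n‖ ^ 2 := by
    intro u
    refine Summable.of_norm_bounded ((summable_norm_sq u).mul_left C) fun n => ?_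
    rw [norm_mul, Real.norm_eq_abs, Real.norm_of_nonneg (sq_nonneg _)]
    exact mul_le_mul_of_nonneg_right (hC _) (sq_nonneg _)
  have hsum : ∀ u : EllTwo, ∑' n, σ * (E - orbitPotential V α θ n) * ‖u n‖ ^ 2 =
      σ * (E * ‖u‖ ^ 2 - ∑' n, orbitPotential V α θ n * ‖u n‖ ^ 2) := by
    intro u
    rw [norm_sq_eq_tsum, ← tsum_mul_left (a := E),
      ← ((summable_norm_sq u).mul_left E).tsum_sub (hvs u), ← tsum_mul_left]
    exact tsum_congr fun n => by ring
  have hab := hG.1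
  have hEs : (E : ℂ) ∈ spectrum ℂ (schrodinger V α θ) := by
    rcases hE with h | h <;> rw [h]
    exacts [hG.2.1, hG.2.2.1]
  have hisol : ∀ y : ℝ, y ≠ E → |y - E| < b - a → (y : ℂ) ∉ spectrum ℂ (schrodinger V α θ) := by
    intro y hyE hy hmem
    rw [abs_lt] at hy
    rcases hσ with h1 | h1
    · have hle : ∀ {x : ℝ}, x ∈ spec V α θ → x ≤ E := fun hx =>
        le_of_mem_spectrum_of_inner_le hself (fun u => by
          have := (abs_le.1 (abs_hopping_le V α θ hχ hsol u)).2
          rw [hsum, h1] at this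
          linarith) hx
      rcases hE with h | h
      · linarith [hle hG.2.2.1]
      · have := lt_of_le_of_ne (hle hmem) hyE
        exact hG.notMem (by linarith) (by linarith) hmem
    · have hle : ∀ {x : ℝ}, x ∈ spec V α θ → E ≤ x := fun hx =>
        le_of_mem_spectrum_of_le_inner hself (fun u => by
          have := (abs_le.1 (abs_hopping_le V α θ hχ hsol u)).1
          rw [hsum, h1] at this
          linarith) hx
      rcases hE with h | h
      · have := lt_of_le_of_ne (hle hmem) hyE.symm
        exact hG.notMem (by linarith) (by linarith) hmem
      · linarith [hle hG.2.1]
  obtain ⟨u, hu, heig⟩ := exists_eigenvector_of_isolated hself (sub_pos.2 hab) hEs hisol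
  exact D.not_eigenvalue hζ hφ hu heig

end GapEdges

/-! ### Sums over the lattice -/

section LatticeSums

variable {d : ℕ}

theorem len_nonneg (n : Fin d → ℤ) : 0 ≤ len n := Finset.sum_nonneg fun _ _ => abs_nonneg _

theorem one_le_len {n : Fin d → ℤ} (hn : n ≠ 0) : 1 ≤ len n := by
  obtain ⟨j, hj⟩ := Function.ne_iff.1 hn
  have h1 : (1 : ℝ) ≤ |(n j : ℝ)| := by
    have : 1 ≤ |n j| := Int.one_le_abs hj
    exact_mod_cast this
  exact h1.trans (Finset.single_le_sum (f := fun j => |(n j : ℝ)|)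
    (fun _ _ => abs_nonneg _) (Finset.mem_univ j))

/-- The last factor, which telescopes, makes the bound provable by induction on `N`. -/
theorem sum_Icc_exp_neg_abs_le {s : ℝ} (hs : 0 < s) (N : ℕ) :
    ∑ k ∈ Finset.Icc (-(N : ℤ)) N, Real.exp (-(s * |(k : ℝ)|)) ≤
      1 + 2 / s * (1 - Real.exp (-(s * N))) := by
  induction N with
  | zero => simp
  | succ m ih =>
    have e : Finset.Icc (-((m + 1 : ℕ) : ℤ)) ((m + 1 : ℕ) : ℤ) =
        insert ((m : ℤ) + 1) (insert (-((m : ℤ) + 1)) (Finset.Icc (-(m : ℤ)) m)) := by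
      ext n
      simp only [Finset.mem_Icc, Finset.mem_insert]
      omega
    rw [e, Finset.sum_insert (by simp; omega), Finset.sum_insert (by simp)]
    have h1 : |(((m : ℤ) + 1 : ℤ) : ℝ)| = m + 1 := by
      push_cast
      exact abs_of_nonneg (by positivity)
    have h2 : |((-((m : ℤ) + 1) : ℤ) : ℝ)| = m + 1 := by
      push_cast
      rw [abs_neg]
      exact abs_of_nonneg (by positivity)
    rw [h1, h2]
    push_cast
    have h3 : Real.exp (-(s * m)) = Real.exp (-(s * (m + 1))) * Real.exp s := by
      rw [← Real.exp_add]; ring_nf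
    have h4 : s + 1 ≤ Real.exp s := Real.add_one_le_exp s
    have h5 : Real.exp (-(s * (m + 1))) * s ≤
        Real.exp (-(s * m)) - Real.exp (-(s * (m + 1))) := by
      rw [h3]
      have := mul_le_mul_of_nonneg_left h4 (Real.exp_pos (-(s * (m + 1)))).le
      linarith
    have h6 := mul_le_mul_of_nonneg_left h5 (by positivity : 0 ≤ 2 / s)
    have h7 : 2 / s * (Real.exp (-(s * (m + 1))) * s) = 2 * Real.exp (-(s * (m + 1))) := by
      field_simp
    linarith

/-- The sum over a box factors into one-dimensional sums. -/
theorem sum_exp_neg_len_le {s : ℝ} (hs : 0 < s) (t : Finset (Fin d → ℤ)) :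
    ∑ n ∈ t, Real.exp (-(s * len n)) ≤ (1 + 2 / s) ^ d := by
  obtain ⟨N, hN⟩ : ∃ N : ℕ, t ⊆ Fintype.piFinset fun _ : Fin d => Finset.Icc (-(N : ℤ)) N := by
    refine ⟨∑ n ∈ t, ∑ j, (n j).natAbs, fun n hn => ?_⟩
    rw [Fintype.mem_piFinset]
    intro j
    have h1 : (n j).natAbs ≤ ∑ j, (n j).natAbs :=
      Finset.single_le_sum (f := fun j => (n j).natAbs) (fun _ _ => Nat.zero_le _)
        (Finset.mem_univ j)
    have h2 : ∑ j, (n j).natAbs ≤ ∑ n ∈ t, ∑ j, (n j).natAbs :=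
      Finset.single_le_sum (f := fun n : Fin d → ℤ => ∑ j, (n j).natAbs)
        (fun _ _ => Nat.zero_le _) hn
    rw [Finset.mem_Icc]
    omega
  refine (Finset.sum_le_sum_of_subset_of_nonneg hN fun _ _ _ => (Real.exp_pos _).le).trans ?_
  have e : ∀ n : Fin d → ℤ, Real.exp (-(s * len n)) = ∏ j, Real.exp (-(s * |(n j : ℝ)|)) := by
    intro n
    rw [← Real.exp_sum, len, Finset.mul_sum, Finset.sum_neg_distrib]
  simp only [e]
  rw [← Finset.prod_univ_sum (fun _ : Fin d => Finset.Icc (-(N : ℤ)) N)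
    (fun _ k => Real.exp (-(s * |(k : ℝ)|)))]
  rw [Finset.prod_const, Finset.card_univ, Fintype.card_fin]
  refine pow_le_pow_left₀ (Finset.sum_nonneg fun _ _ => (Real.exp_pos _).le) ?_ d
  refine (sum_Icc_exp_neg_abs_le hs N).trans ?_
  have : 2 / s * (1 - Real.exp (-(s * N))) ≤ 2 / s * 1 := by
    have := Real.exp_pos (-(s * N))
    gcongr
    linarith
  linarith

theorem summable_exp_neg_len {s : ℝ} (hs : 0 < s) :
    Summable fun n : Fin d → ℤ => Real.exp (-(s * len n)) :=
  summable_of_sum_le (fun _ => (Real.exp_pos _).le) (sum_exp_neg_len_le hs)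

theorem tsum_exp_neg_len_le {s : ℝ} (hs : 0 < s) :
    ∑' n : Fin d → ℤ, Real.exp (-(s * len n)) ≤ (1 + 2 / s) ^ d :=
  (summable_exp_neg_len hs).tsum_le_of_sum_le (sum_exp_neg_len_le hs)

/-- The integrand `t ^ p e^{-t}` of `Γ (p + 1)` is at least `y ^ p e^{-t}` for `t ≥ y`. -/
theorem rpow_mul_exp_neg_le_Gamma {p y : ℝ} (hp : 0 ≤ p) (hy : 0 < y) :
    y ^ p * Real.exp (-y) ≤ Real.Gamma (p + 1) := by
  rw [Real.Gamma_eq_integral (by linarith), add_sub_cancel_right]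
  have hint := Real.GammaIntegral_convergent (s := p + 1) (by linarith)
  rw [add_sub_cancel_right] at hint
  have h1 : ∫ t in Set.Ioi y, Real.exp (-t) * t ^ p ≤ ∫ t in Set.Ioi 0, Real.exp (-t) * t ^ p :=
    MeasureTheory.setIntegral_mono_set hint
      ((MeasureTheory.ae_restrict_iff' measurableSet_Ioi).2 (Eventually.of_forall fun t ht =>
        mul_nonneg (Real.exp_pos _).le (Real.rpow_nonneg (le_of_lt ht) _)))
      (Set.Ioi_subset_Ioi hy.le).eventuallyLE
  have h2 : ∫ t in Set.Ioi y, Real.exp (-t) * y ^ p ≤ ∫ t in Set.Ioi y, Real.exp (-t) * t ^ p := by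
    refine MeasureTheory.setIntegral_mono_on ?_ (hint.mono_set (Set.Ioi_subset_Ioi hy.le))
      measurableSet_Ioi fun t ht => ?_
    · exact (integrableOn_exp_neg_Ioi y).mul_const _
    · have : y ^ p ≤ t ^ p := Real.rpow_le_rpow hy.le (le_of_lt ht) hp
      exact mul_le_mul_of_nonneg_left this (Real.exp_pos _).le
  rw [MeasureTheory.integral_mul_const, integral_exp_neg_Ioi] at h2
  linarith

theorem one_le_Gamma {x : ℝ} (hx : 2 ≤ x) : 1 ≤ Real.Gamma x := by
  rw [← Real.Gamma_two]
  exact Real.Gamma_strictMonoOn_Ici.monotoneOn (Set.mem_Ici.2 le_rfl) hx hx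

theorem rpow_mul_exp_neg_le_Gamma_of_le {p m y : ℝ} (hp : 0 ≤ p) (hpm : p ≤ m) (hm : 1 ≤ m)
    (hy : 0 < y) : y ^ p * Real.exp (-y) ≤ Real.Gamma (m + 1) := by
  rcases le_total y 1 with h | h
  · have h1 : y ^ p ≤ 1 := Real.rpow_le_one hy.le h hp
    have h2 : Real.exp (-y) ≤ 1 := Real.exp_le_one_iff.2 (by linarith)
    have h3 : y ^ p * Real.exp (-y) ≤ 1 * 1 := by gcongr
    linarith [one_le_Gamma (x := m + 1) (by linarith)]
  · have h1 : y ^ p ≤ y ^ m := Real.rpow_le_rpow_of_exponent_le h hpm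
    exact (mul_le_mul_of_nonneg_right h1 (Real.exp_pos _).le).trans
      (rpow_mul_exp_neg_le_Gamma (by linarith) hy)

/-- Weighted lattice sums over `ℤ^d \ {0}`, with `m = 4τ + 1`. For small `x` the exponential
`e^{-x|n|}` is spent on the power `|n|^{m - d} ≥ |n|^τ` and the remaining geometric sum is
`O(x^{-d})`; for `x ≥ 1` it is spent on the full power `|n|^m`. -/
theorem tsum_len_rpow_mul_exp_le {τ x : ℝ} (hd : 1 ≤ d) (hτ : (d : ℝ) - 1 < τ) (hx : 0 < x) :
    Summable (fun n : Fin d → ℤ => if n = 0 then 0 else len n ^ τ * Real.exp (-(3 * x * len n))) ∧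
    ∑' n : Fin d → ℤ, (if n = 0 then 0 else len n ^ τ * Real.exp (-(3 * x * len n))) ≤
      2 ^ (τ + 1) * Real.Gamma (4 * τ + 2) / x ^ (4 * τ + 1) := by
  have hd' : (1 : ℝ) ≤ d := by exact_mod_cast hd
  have hτ0 : 0 < τ := by linarith
  have hΓ : 0 < Real.Gamma (4 * τ + 2) := Real.Gamma_pos_of_pos (by linarith)
  have h2d : (2 : ℝ) ^ d ≤ 2 ^ (τ + 1) := by
    rw [← Real.rpow_natCast]
    exact Real.rpow_le_rpow_of_exponent_le (by norm_num) (by linarith)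
  obtain ⟨p, hp, hpm, hτp, hgeom⟩ : ∃ p : ℝ, 0 ≤ p ∧ p ≤ 4 * τ + 1 ∧ τ ≤ p ∧
      (1 + 2 / (2 * x)) ^ d * (1 / x ^ p) ≤ 2 ^ (τ + 1) / x ^ (4 * τ + 1) := by
    rcases le_total x 1 with h | h
    · refine ⟨4 * τ + 1 - d, by linarith, by linarith, by linarith, ?_⟩
      have h1 : 1 + 2 / (2 * x) ≤ 2 / x := by
        rw [show 2 / (2 * x) = 1 / x by field_simp]
        have : 1 ≤ 1 / x := by rw [le_div_iff₀ hx]; linarith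
        have e : 2 / x = 1 / x + 1 / x := by ring
        linarith
      have h2 : (1 + 2 / (2 * x)) ^ d ≤ (2 / x) ^ d := pow_le_pow_left₀ (by positivity) h1 d
      have e : x ^ (4 * τ + 1) = x ^ d * x ^ (4 * τ + 1 - d) := by
        rw [← Real.rpow_natCast, ← Real.rpow_add hx]; ring_nf
      calc (1 + 2 / (2 * x)) ^ d * (1 / x ^ (4 * τ + 1 - d))
          ≤ (2 / x) ^ d * (1 / x ^ (4 * τ + 1 - d)) := by gcongr
        _ = 2 ^ d / x ^ (4 * τ + 1) := by rw [e, div_pow]; field_simp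
        _ ≤ _ := by gcongr
    · refine ⟨4 * τ + 1, by linarith, le_rfl, by linarith, ?_⟩
      have h1 : 1 + 2 / (2 * x) ≤ 2 := by
        rw [show 2 / (2 * x) = 1 / x by field_simp]
        have : 1 / x ≤ 1 := by rw [div_le_iff₀ hx]; linarith
        linarith
      have h2 : (1 + 2 / (2 * x)) ^ d ≤ 2 ^ d := pow_le_pow_left₀ (by positivity) h1 d
      rw [mul_one_div]
      gcongr
      exact h2.trans h2d
  have hterm : ∀ n : Fin d → ℤ, (if n = 0 then 0 else len n ^ τ * Real.exp (-(3 * x * len n))) ≤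
      Real.Gamma (4 * τ + 2) * (1 / x ^ p) * Real.exp (-(2 * x * len n)) := by
    intro n
    split_ifs with hn
    · positivity
    have hl := one_le_len hn
    have hl0 : 0 < len n := by linarith
    have h1 := rpow_mul_exp_neg_le_Gamma_of_le hp hpm (by linarith) (mul_pos hx hl0)
    rw [show 4 * τ + 1 + 1 = 4 * τ + 2 by ring, Real.mul_rpow hx.le hl0.le] at h1
    have h2 : len n ^ τ ≤ len n ^ p := Real.rpow_le_rpow_of_exponent_le hl hτp
    have h3 : Real.exp (-(3 * x * len n)) =
        Real.exp (-(x * len n)) * Real.exp (-(2 * x * len n)) := by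
      rw [← Real.exp_add]; ring_nf
    rw [h3, ← mul_assoc]
    refine mul_le_mul_of_nonneg_right ?_ (Real.exp_pos _).le
    rw [mul_one_div, le_div_iff₀ (Real.rpow_pos_of_pos hx _)]
    refine le_trans ?_ h1
    have h4 : len n ^ τ * (Real.exp (-(x * len n)) * x ^ p) ≤
        len n ^ p * (Real.exp (-(x * len n)) * x ^ p) :=
      mul_le_mul_of_nonneg_right h2 (by positivity)
    linarith
  have hnn : ∀ n : Fin d → ℤ,
      0 ≤ (if n = 0 then 0 else len n ^ τ * Real.exp (-(3 * x * len n))) := by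
    intro n
    split_ifs
    · exact le_rfl
    · exact mul_nonneg (Real.rpow_nonneg (len_nonneg n) _) (Real.exp_pos _).le
  have hs := (summable_exp_neg_len (d := d) (s := 2 * x) (by linarith)).mul_left
    (Real.Gamma (4 * τ + 2) * (1 / x ^ p))
  have hsum := Summable.of_nonneg_of_le hnn hterm hs
  refine ⟨hsum, (hsum.tsum_le_tsum hterm hs).trans ?_⟩
  rw [tsum_mul_left]
  have h1 := tsum_exp_neg_len_le (d := d) (s := 2 * x) (by linarith)
  have h2 : 0 ≤ Real.Gamma (4 * τ + 2) * (1 / x ^ p) := by positivity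
  calc Real.Gamma (4 * τ + 2) * (1 / x ^ p) * ∑' n : Fin d → ℤ, Real.exp (-(2 * x * len n))
      ≤ Real.Gamma (4 * τ + 2) * (1 / x ^ p) * (1 + 2 / (2 * x)) ^ d := by gcongr
    _ = Real.Gamma (4 * τ + 2) * ((1 + 2 / (2 * x)) ^ d * (1 / x ^ p)) := by ring
    _ ≤ Real.Gamma (4 * τ + 2) * (2 ^ (τ + 1) / x ^ (4 * τ + 1)) := by gcongr
    _ = _ := by ring

end LatticeSums

/-! ### Fourier series of functions holomorphic on a strip -/

section Strip

theorem convex_strip_one (R : ℝ) : Convex ℝ {z : ℂ | |z.im| < R} := by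
  have : {z : ℂ | |z.im| < R} = Complex.imLm ⁻¹' (Metric.ball 0 R) := by
    ext z
    simp [Complex.imLm_coe]
  rw [this]
  exact (convex_ball 0 R).linear_preimage _

theorem isOpen_strip_one (R : ℝ) : IsOpen {z : ℂ | |z.im| < R} :=
  isOpen_lt (Complex.continuous_im.abs) continuous_const

/-- Periodicity extends from the real line to the strip by the identity theorem. -/
theorem periodic_on_strip {g : ℂ → ℂ} {R : ℝ} (hR : 0 < R)
    (hg : DifferentiableOn ℂ g {z | |z.im| < R}) (hper : ∀ t : ℝ, g (t + 1) = g t) {z : ℂ}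
    (hz : |z.im| < R) : g (z + 1) = g z := by
  have hS := isOpen_strip_one R
  have hg' : DifferentiableOn ℂ (fun z => g (z + 1)) {z | |z.im| < R} :=
    hg.comp (by fun_prop) (fun z hz => by simpa using hz)
  have h0 : (0 : ℂ) ∈ {z : ℂ | |z.im| < R} := by simpa using hR
  refine (hg'.analyticOnNhd hS).eqOn_of_preconnected_of_frequently_eq (hg.analyticOnNhd hS)
    (convex_strip_one R).isPreconnected h0 ?_ hz
  have ht : Tendsto (fun n : ℕ => (((1 : ℝ) / ((n : ℝ) + 1) : ℝ) : ℂ)) atTop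
      (nhdsWithin 0 {0}ᶜ) := by
    refine tendsto_nhdsWithin_iff.2 ⟨?_, Eventually.of_forall fun n => ?_⟩
    · have := (Complex.continuous_ofReal.tendsto 0).comp
        (tendsto_one_div_add_atTop_nhds_zero_nat (𝕜 := ℝ))
      simpa [Function.comp_def] using this
    · simp only [Set.mem_compl_iff, Set.mem_singleton_iff, Complex.ofReal_eq_zero]
      positivity
  exact ht.frequently (Frequently.of_forall fun n => hper _)

/-- Contour shift for a periodic holomorphic function on a strip. -/
theorem norm_integral_period_le {g : ℂ → ℂ} {R η B : ℝ} (hg : DifferentiableOn ℂ g {z | |z.im| < R})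
    (hper : ∀ t : ℝ, g (t + 1) = g t) (hη0 : 0 ≤ η) (hη : η < R)
    (hB : ∀ t : ℝ, ‖g (t + η * Complex.I)‖ ≤ B) : ‖∫ t in (0 : ℝ)..1, g t‖ ≤ B := by
  have hR : 0 < R := hη0.trans_lt hη
  have hrect := Complex.integral_boundary_rect_eq_zero_of_differentiableOn g 0 (1 + η * Complex.I)
    (hg.mono (fun z hz => by
      have := hz.2
      simp only [Set.mem_preimage, Complex.zero_im, Complex.add_im, Complex.one_im,
        Complex.mul_im, Complex.ofReal_re, Complex.I_im, Complex.ofReal_im, Complex.I_re] at this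
      simp only [mul_one, mul_zero, zero_add, add_zero, Set.uIcc_of_le hη0] at this
      have h2 := this.2
      change |z.im| < R
      rw [abs_lt]
      constructor <;> linarith [this.1]))
  simp only [Complex.zero_re, Complex.zero_im, Complex.add_re, Complex.one_re, Complex.mul_re,
    Complex.ofReal_re, Complex.I_re, mul_zero, Complex.ofReal_im, Complex.I_im, zero_mul,
    sub_zero, add_zero, Complex.add_im, Complex.one_im, Complex.mul_im, mul_one, zero_add,
    Complex.ofReal_zero, Complex.ofReal_one] at hrect
  have hside : ∫ y in (0 : ℝ)..η, g (1 + y * Complex.I) = ∫ y in (0 : ℝ)..η, g (y * Complex.I) := by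
    refine intervalIntegral.integral_congr fun y hy => ?_
    rw [Set.uIcc_of_le hη0] at hy
    have := periodic_on_strip hR hg hper (z := y * Complex.I) (by
      simp only [Complex.mul_im, Complex.ofReal_re, Complex.I_im, mul_one, Complex.ofReal_im,
        Complex.I_re, mul_zero, add_zero]
      rw [abs_of_nonneg hy.1]
      linarith [hy.2])
    rw [add_comm]
    exact this
  rw [hside, add_sub_cancel_right, sub_eq_zero] at hrect
  rw [hrect]
  have := intervalIntegral.norm_integral_le_of_norm_le_const (a := 0) (b := 1) (C := B)
    (f := fun t : ℝ => g (t + η * Complex.I)) (fun t _ => hB t)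
  simpa using this

end Strip

section Fourier

open MeasureTheory

variable {d : ℕ}

/-- The point of the torus `𝕋^d` represented by `x`. -/
def torusMk (x : Fin d → ℝ) : UnitAddTorus (Fin d) := fun j => (x j : UnitAddCircle)

theorem isOpenQuotientMap_torusMk : IsOpenQuotientMap (torusMk (d := d)) :=
  IsOpenQuotientMap.piMap fun _ => QuotientAddGroup.isOpenQuotientMap_mk

theorem exists_intVec_of_torusMk_eq {x y : Fin d → ℝ} (h : torusMk x = torusMk y) :
    ∃ n : Fin d → ℤ, y = x + intVec n := by
  have : ∀ j, ∃ k : ℤ, y j = x j + k := by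
    intro j
    have hj : ((y j - x j : ℝ) : UnitAddCircle) = 0 := by
      rw [AddCircle.coe_sub, sub_eq_zero]
      exact (congrFun h j).symm
    obtain ⟨k, hk⟩ := (AddCircle.coe_eq_zero_iff (1 : ℝ)).1 hj
    refine ⟨k, ?_⟩
    rw [zsmul_eq_mul, mul_one] at hk
    linarith
  choose n hn using this
  exact ⟨n, funext hn⟩

theorem mFourier_torusMk (n : Fin d → ℤ) (x : Fin d → ℝ) :
    UnitAddTorus.mFourier n (torusMk x) =
      Complex.exp (2 * Real.pi * Complex.I * (pair n x : ℂ)) := by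
  simp only [UnitAddTorus.mFourier, ContinuousMap.coe_mk, torusMk, fourier_coe_apply]
  rw [← Complex.exp_sum, pair]
  congr 1
  push_cast
  rw [Finset.mul_sum]
  refine Finset.sum_congr rfl fun j _ => ?_
  ring

/-- By translation invariance, an integral over the torus is the average of integrals along segments
in a fixed direction `s`. -/
theorem norm_integral_le_of_norm_line_integral_le {μ : Measure (UnitAddTorus (Fin d))}
    [IsProbabilityMeasure μ] [μ.IsAddRightInvariant] {G : UnitAddTorus (Fin d) → ℂ}
    (hG : Continuous G) (s : Fin d → ℝ) {B : ℝ}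
    (hB : ∀ x, ‖∫ t in (0 : ℝ)..1, G (torusMk (x + t • s))‖ ≤ B) : ‖∫ x, G x ∂μ‖ ≤ B := by
  set σ : ℝ → UnitAddTorus (Fin d) := fun t => torusMk (t • s) with hσ
  have hσc : Continuous σ := isOpenQuotientMap_torusMk.continuous.comp (by fun_prop)
  have hadd : ∀ x t, torusMk (x + t • s) = torusMk x + σ t := fun x t => by
    funext j
    simp [torusMk, hσ]
  obtain ⟨C, hC⟩ := (isCompact_univ (X := UnitAddTorus (Fin d))).exists_bound_of_continuousOn
    hG.continuousOn
  have h1 : ∫ x, G x ∂μ = ∫ t in (0 : ℝ)..1, ∫ x, G (x + σ t) ∂μ := by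
    have : ∀ t, ∫ x, G (x + σ t) ∂μ = ∫ x, G x ∂μ := fun t => integral_add_right_eq_self G (σ t)
    simp only [this]
    simp
  rw [h1, intervalIntegral.integral_of_le zero_le_one, integral_integral_swap]
  · refine (norm_integral_le_of_norm_le_const (C := B) (Eventually.of_forall fun y => ?_)).trans ?_
    · obtain ⟨x, rfl⟩ := isOpenQuotientMap_torusMk.surjective y
      rw [← intervalIntegral.integral_of_le zero_le_one]
      simpa only [hadd] using hB x
    · simp
  · have hc : Continuous (Function.uncurry fun t x => G (x + σ t)) := by
      refine hG.comp ?_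
      exact continuous_snd.add (hσc.comp continuous_fst)
    exact Integrable.of_bound hc.aestronglyMeasurable C
      (Eventually.of_forall fun p => hC _ trivial)

variable {R C : ℝ} {f : (Fin d → ℂ) → ℂ}

/-- A periodic function with a bounded holomorphic extension to the strip has exponentially
decaying Fourier coefficients, obtained by shifting the contour along the integer direction
`- sign n`, and is the sum of its Fourier series. -/
theorem exists_fourier_expansion (hR : 0 < R) (hf : DifferentiableOn ℂ f (strip d R))
    (hC : ∀ z ∈ strip d R, ‖f z‖ ≤ C)
    (hper : ∀ (n : Fin d → ℤ) (x : Fin d → ℝ),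
      f (fun l => ((x + intVec n) l : ℂ)) = f (fun l => (x l : ℂ))) :
    ∃ c : (Fin d → ℤ) → ℂ, (∀ n, ‖c n‖ ≤ C * Real.exp (-(5 * R * len n))) ∧
      ∀ x : Fin d → ℝ, HasSum
        (fun n => c n * Complex.exp (2 * Real.pi * Complex.I * (pair n x : ℂ)))
        (f (fun l => (x l : ℂ))) := by
  have hreal : ∀ x : Fin d → ℝ, (fun l => (x l : ℂ)) ∈ strip d R := fun x j => by simpa using hR
  have hC0 : 0 ≤ C := (norm_nonneg _).trans (hC _ (hreal 0))
  have hopen : IsOpen (strip d R) := by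
    have : strip d R = ⋂ j, {z : Fin d → ℂ | |(z j).im| < R} := by
      ext z; simp [strip]
    rw [this]
    exact isOpen_iInter_of_finite fun j =>
      isOpen_lt ((Complex.continuous_im.comp (continuous_apply j)).abs) continuous_const
  have hcont : Continuous fun x : Fin d → ℝ => f (fun l => (x l : ℂ)) :=
    hf.continuousOn.comp_continuous (by fun_prop) hreal
  have hq : Topology.IsQuotientMap
      (⟨torusMk, isOpenQuotientMap_torusMk.continuous⟩ : C(Fin d → ℝ, UnitAddTorus (Fin d))) :=
    isOpenQuotientMap_torusMk.isQuotientMap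
  set F : C(UnitAddTorus (Fin d), ℂ) :=
    hq.lift ⟨fun x : Fin d → ℝ => f (fun l => (x l : ℂ)), hcont⟩ (fun x y h => by
        obtain ⟨n, rfl⟩ := exists_intVec_of_torusMk_eq h
        exact (hper n x).symm) with hF
  have hFx : ∀ x, F (torusMk x) = f (fun l => (x l : ℂ)) := by
    intro x
    have := DFunLike.congr_fun (hq.lift_comp (g := ⟨_, hcont⟩) (by
        intro x y h
        obtain ⟨n, rfl⟩ := exists_intVec_of_torusMk_eq h
        exact (hper n x).symm)) x
    exact this
  have hbound : ∀ n, ‖UnitAddTorus.mFourierCoeff F n‖ ≤ C * Real.exp (-(5 * R * len n)) := by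
    intro n
    set s : Fin d → ℝ := fun j => -(SignType.sign (n j) : ℝ) with hs
    have hpair : pair n s = - len n := by
      rw [pair, len, ← Finset.sum_neg_distrib]
      refine Finset.sum_congr rfl fun j _ => ?_
      rw [hs]
      rcases lt_trichotomy (n j) 0 with h | h | h
      · have h' : (n j : ℝ) < 0 := by exact_mod_cast h
        simp [sign_neg h, abs_of_neg h']
      · simp [h]
      · have h' : (0 : ℝ) < n j := by exact_mod_cast h
        simp [sign_pos h, abs_of_pos h']
    have hs1 : ∀ j, |s j| ≤ 1 := by
      intro j
      rw [hs]
      rcases lt_trichotomy (n j) 0 with h | h | h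
      · simp [sign_neg h]
      · simp [h]
      · simp [sign_pos h]
    have hG : Continuous fun t => UnitAddTorus.mFourier (-n) t • F t := by fun_prop
    refine norm_integral_le_of_norm_line_integral_le
      (μ := Measure.pi fun _ => AddCircle.haarAddCircle) hG s fun x => ?_
    -- the integrand along the line, as a periodic holomorphic function
    set g : ℂ → ℂ := fun z =>
      Complex.exp (2 * Real.pi * Complex.I * (-(pair n x : ℂ) + z * (len n : ℂ))) *
        f (fun l => (x l : ℂ) + z * (s l : ℂ)) with hg
    have hgt : ∀ t : ℝ, UnitAddTorus.mFourier (-n) (torusMk (x + t • s)) •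
        F (torusMk (x + t • s)) = g t := by
      intro t
      rw [mFourier_torusMk, hFx, smul_eq_mul, hg]
      have h1 : pair (-n) (x + t • s) = -pair n x + t * len n := by
        have : pair (-n) (x + t • s) = -(pair n x + t * pair n s) := by
          simp only [pair, Finset.mul_sum, ← Finset.sum_add_distrib, ← Finset.sum_neg_distrib]
          refine Finset.sum_congr rfl fun j _ => ?_
          simp only [Pi.neg_apply, Pi.add_apply, Pi.smul_apply, smul_eq_mul]
          push_cast
          ring
        rw [this, hpair]
        ring
      rw [h1]
      simp
    have hline : ∀ z : ℂ, |z.im| < R → (fun l => (x l : ℂ) + z * (s l : ℂ)) ∈ strip d R := by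
      intro z hz j
      simp only [Complex.add_im, Complex.ofReal_im, Complex.mul_im, mul_zero, zero_add,
        Complex.ofReal_re]
      rw [abs_mul]
      exact (mul_le_of_le_one_right (abs_nonneg _) (hs1 j)).trans_lt hz
    have hgd : DifferentiableOn ℂ g {z | |z.im| < R} := by
      refine DifferentiableOn.mul (by fun_prop) ?_
      refine hf.comp (Differentiable.differentiableOn ?_) fun z hz => hline z hz
      rw [differentiable_pi]
      intro l
      fun_prop
    have hgp : ∀ t : ℝ, g (t + 1) = g t := by
      intro t
      have h1 := hgt (t + 1)
      have h2 : torusMk (x + (t + 1) • s) = torusMk (x + t • s) := by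
        funext j
        have h3 : ((s j : ℝ) : UnitAddCircle) = 0 := by
          rw [AddCircle.coe_eq_zero_iff]
          refine ⟨-(SignType.sign (n j) : ℤ), ?_⟩
          rw [hs]
          simp
        simp only [torusMk, Pi.add_apply, Pi.smul_apply, smul_eq_mul, add_mul, one_mul]
        rw [← add_assoc, AddCircle.coe_add, h3, add_zero]
      rw [h2, hgt] at h1
      rw [h1]
      push_cast
      rfl
    simp only [hgt]
    refine norm_integral_period_le hgd hgp (η := 9 / 10 * R) (by linarith) (by linarith) fun t => ?_
    rw [hg, norm_mul, mul_comm]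
    refine mul_le_mul (hC _ (hline _ ?_)) ?_ (norm_nonneg _) hC0
    · simp only [Complex.add_im, Complex.ofReal_im, Complex.mul_im, Complex.ofReal_re,
        Complex.I_im, mul_one, Complex.I_re, mul_zero, add_zero, zero_add]
      rw [abs_of_pos (by positivity)]
      linarith
    · rw [Complex.norm_exp]
      have hre : (2 * Real.pi * Complex.I * (-(pair n x : ℂ) +
          (t + ((9 / 10 * R : ℝ) : ℂ) * Complex.I) * (len n : ℂ))).re =
          -(2 * Real.pi * (9 / 10 * R) * len n) := by
        simp [Complex.mul_re, Complex.mul_im, Complex.add_re, Complex.add_im]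
        ring
      rw [hre, Real.exp_le_exp]
      have h3 := Real.pi_gt_three
      have h4 : 0 ≤ R * len n := mul_nonneg hR.le (len_nonneg n)
      have h5 := mul_le_mul_of_nonneg_right h3.le h4
      linarith
  refine ⟨UnitAddTorus.mFourierCoeff F, hbound, fun x => ?_⟩
  have hsum : Summable (UnitAddTorus.mFourierCoeff F) := Summable.of_norm_bounded
    ((summable_exp_neg_len (d := d) (s := 5 * R) (by linarith)).mul_left C) hbound
  have := UnitAddTorus.hasSum_mFourier_series_apply_of_summable hsum (torusMk x)
  rw [hFx] at this
  simpa only [smul_eq_mul, mFourier_torusMk] using this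

end Fourier

/-! ### Small divisors and the cohomological equation -/

section SmallDivisors

variable {d : ℕ}

theorem pair_add (n : Fin d → ℤ) (x y : Fin d → ℝ) : pair n (x + y) = pair n x + pair n y := by
  simp only [pair, Pi.add_apply, mul_add, Finset.sum_add_distrib]

/-- The terms of the small divisor series majorizing the solution of the cohomological equation.
The term at `n = 0` vanishes, its denominator being zero. -/
def divisorTerm (α : Fin d → ℝ) (R : ℝ) (n : Fin d → ℤ) : ℝ :=
  Real.exp (-(5 * R * len n)) / ‖Complex.exp (2 * Real.pi * Complex.I * (pair n α : ℂ)) - 1‖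

/-- The terms of the series majorizing the oscillation of a function on the torus. -/
def oscTerm (R : ℝ) (n : Fin d → ℤ) : ℝ := if n = 0 then 0 else Real.exp (-(5 * R * len n))

theorem pair_zero (x : Fin d → ℝ) : pair (0 : Fin d → ℤ) x = 0 := by simp [pair]

theorem divisorTerm_zero (α : Fin d → ℝ) (R : ℝ) : divisorTerm α R 0 = 0 := by
  simp [divisorTerm, pair_zero]

theorem norm_exp_pair (n : Fin d → ℤ) (x : Fin d → ℝ) :
    ‖Complex.exp (2 * Real.pi * Complex.I * (pair n x : ℂ))‖ = 1 := by
  rw [show 2 * Real.pi * Complex.I * (pair n x : ℂ) =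
    ((2 * Real.pi * pair n x : ℝ) : ℂ) * Complex.I by push_cast; ring]
  exact Complex.norm_exp_ofReal_mul_I _

/-- This is `|e^{2πix} - 1| = 2 |sin πx|` and the concavity of the sine on `[0, π/2]`. -/
theorem four_mul_distInt_le (x : ℝ) :
    4 * distInt x ≤ ‖Complex.exp (2 * Real.pi * Complex.I * (x : ℂ)) - 1‖ := by
  have e : Complex.exp (2 * Real.pi * Complex.I * (x : ℂ)) =
      Complex.exp (Complex.I * ((2 * Real.pi * (x - round x) : ℝ) : ℂ)) := by
    rw [← Complex.exp_periodic.int_mul (round x)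
      (Complex.I * ((2 * Real.pi * (x - round x) : ℝ) : ℂ))]
    congr 1
    push_cast
    ring
  rw [e, Complex.norm_exp_I_mul_ofReal_sub_one, norm_mul, Real.norm_eq_abs, Real.norm_eq_abs,
    abs_two, distInt]
  have h1 : |x - round x| ≤ 1 / 2 := abs_sub_round x
  have h2 := Real.mul_abs_le_abs_sin (x := 2 * Real.pi * (x - round x) / 2) (by
    rw [show 2 * Real.pi * (x - round x) / 2 = Real.pi * (x - round x) by ring, abs_mul,
      abs_of_pos Real.pi_pos]
    have := mul_le_mul_of_nonneg_left h1 Real.pi_pos.le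
    linarith)
  have h3 : |2 * Real.pi * (x - round x) / 2| = Real.pi * |x - round x| := by
    rw [show 2 * Real.pi * (x - round x) / 2 = Real.pi * (x - round x) by ring, abs_mul,
      abs_of_pos Real.pi_pos]
  have h4 : 2 / Real.pi * (Real.pi * |x - round x|) = 2 * |x - round x| := by
    have := Real.pi_ne_zero
    field_simp
  rw [h3, h4] at h2
  linarith

theorem distInt_nonneg (x : ℝ) : 0 ≤ distInt x := abs_nonneg _

theorem distInt_le_half (x : ℝ) : distInt x ≤ 1 / 2 := abs_sub_round x

theorem RationallyIndependent.distInt_pos {α : Fin d → ℝ} (hα : RationallyIndependent α)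
    {n : Fin d → ℤ} (hn : n ≠ 0) : 0 < distInt (pair n α) := by
  refine abs_pos.2 fun h => hn (hα n (round (pair n α)) ?_)
  linarith

theorem RationallyIndependent.norm_divisor_pos {α : Fin d → ℝ} (hα : RationallyIndependent α)
    {n : Fin d → ℤ} (hn : n ≠ 0) :
    0 < ‖Complex.exp (2 * Real.pi * Complex.I * (pair n α : ℂ)) - 1‖ :=
  lt_of_lt_of_le (by linarith [hα.distInt_pos hn]) (four_mul_distInt_le _)

theorem norm_divisor_le (α : Fin d → ℝ) (n : Fin d → ℤ) :
    ‖Complex.exp (2 * Real.pi * Complex.I * (pair n α : ℂ)) - 1‖ ≤ 2 := by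
  refine (norm_sub_le _ _).trans ?_
  rw [norm_exp_pair, norm_one]
  norm_num

variable {R C : ℝ} {f : (Fin d → ℂ) → ℂ}

/-- The cohomological equation `y(x + α) - y(x) = f(x) - m`, solved by dividing the Fourier
coefficients of `f` by the small divisors. -/
theorem exists_cohomological_solution {α : Fin d → ℝ} (hα : RationallyIndependent α) (hR : 0 < R)
    (hf : DifferentiableOn ℂ f (strip d R)) (hC : ∀ z ∈ strip d R, ‖f z‖ ≤ C)
    (hper : ∀ (n : Fin d → ℤ) (x : Fin d → ℝ),
      f (fun l => ((x + intVec n) l : ℂ)) = f (fun l => (x l : ℂ)))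
    (hs : Summable (divisorTerm α R)) :
    ∃ (m : ℝ) (y : (Fin d → ℝ) → ℝ), (∀ x, y (x + α) - y x = (f (fun l => (x l : ℂ))).re - m) ∧
      ∀ x, |y x| ≤ C * ∑' n, divisorTerm α R n := by
  obtain ⟨c, hc, hsum⟩ := exists_fourier_expansion hR hf hC hper
  set e : (Fin d → ℤ) → (Fin d → ℝ) → ℂ :=
    fun n x => Complex.exp (2 * Real.pi * Complex.I * (pair n x : ℂ)) with he
  have he_add : ∀ n x, e n (x + α) = e n x * e n α := by
    intro n x
    simp only [he]
    rw [← Complex.exp_add, pair_add]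
    congr 1
    push_cast
    ring
  have he1 : ∀ n x, ‖e n x‖ = 1 := norm_exp_pair
  set q : (Fin d → ℤ) → ℂ := fun n => c n / (e n α - 1) with hq
  have hqb : ∀ n, ‖q n‖ ≤ C * divisorTerm α R n := by
    intro n
    rw [hq, norm_div, divisorTerm, ← mul_div_assoc]
    exact div_le_div_of_nonneg_right (hc n) (norm_nonneg _)
  have hqe : ∀ x n, ‖q n * e n x‖ ≤ C * divisorTerm α R n := by
    intro x n
    rw [norm_mul, he1, mul_one]
    exact hqb n
  have hqs : ∀ x, Summable fun n => q n * e n x := fun x =>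
    Summable.of_norm_bounded (hs.mul_left C) (hqe x)
  refine ⟨(c 0).re, fun x => (∑' n, q n * e n x).re, fun x => ?_, fun x => ?_⟩
  · rw [← Complex.sub_re, ← Complex.sub_re]
    congr 1
    rw [← (hqs (x + α)).tsum_sub (hqs x), ← (hsum x).tsum_eq,
      (hsum x).summable.tsum_eq_add_tsum_ite 0]
    have h0 : Complex.exp (2 * Real.pi * Complex.I * (pair (0 : Fin d → ℤ) x : ℂ)) = 1 := by
      simp [pair_zero]
    rw [h0, mul_one, add_sub_cancel_left]
    refine tsum_congr fun n => ?_
    split_ifs with hn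
    · rw [hn, he_add]
      have : e 0 α = 1 := by simp [he, pair_zero]
      rw [this]
      ring
    · have hne : e n α - 1 ≠ 0 := norm_pos_iff.1 (hα.norm_divisor_pos hn)
      change q n * e n (x + α) - q n * e n x = c n * e n x
      rw [he_add, hq]
      field_simp
  · refine (Complex.abs_re_le_norm _).trans ?_
    rw [← tsum_mul_left]
    exact tsum_of_norm_bounded (hs.mul_left C).hasSum (hqe x)

/-- Only the nonconstant terms of the Fourier series contribute to the oscillation. -/
theorem norm_sub_le_oscillation (hR : 0 < R)
    (hf : DifferentiableOn ℂ f (strip d R)) (hC : ∀ z ∈ strip d R, ‖f z‖ ≤ C)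
    (hper : ∀ (n : Fin d → ℤ) (x : Fin d → ℝ),
      f (fun l => ((x + intVec n) l : ℂ)) = f (fun l => (x l : ℂ))) (x x' : Fin d → ℝ) :
    ‖f (fun l => (x l : ℂ)) - f (fun l => (x' l : ℂ))‖ ≤
      2 * (C * ∑' n : Fin d → ℤ, oscTerm R n) := by
  obtain ⟨c, hc, hsum⟩ := exists_fourier_expansion hR hf hC hper
  have hos : Summable fun n : Fin d → ℤ => oscTerm R n := by
    refine Summable.of_nonneg_of_le (fun n => ?_) (fun n => ?_)
      (summable_exp_neg_len (d := d) (s := 5 * R) (by linarith))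
    · rw [oscTerm]; split_ifs <;> positivity
    · rw [oscTerm]; split_ifs <;> first | positivity | exact le_rfl
  rw [← (hsum x).tsum_eq, ← (hsum x').tsum_eq, ← (hsum x).summable.tsum_sub (hsum x').summable,
    ← tsum_mul_left, ← tsum_mul_left]
  refine tsum_of_norm_bounded ((hos.mul_left C).mul_left 2).hasSum fun n => ?_
  rw [oscTerm]
  split_ifs with hn
  · rw [hn]; simp [pair_zero]
  · refine (norm_sub_le _ _).trans ?_
    rw [norm_mul, norm_mul, norm_exp_pair, norm_exp_pair]
    linarith [hc n]

/-- The exponent `β(α)` is nonnegative, every term of the upper limit being so. -/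
theorem beta_nonneg (hd : 1 ≤ d) (α : Fin d → ℝ) : 0 ≤ beta α := by
  have : Nonempty (Fin d) := ⟨⟨0, hd⟩⟩
  refine le_limsup_of_frequently_le (Frequently.of_forall fun k => ?_)
  have h1 : 0 ≤ Real.log (1 / distInt (pair k α)) := by
    rcases (distInt_nonneg (pair k α)).eq_or_lt with h | h
    · rw [← h]; simp
    · refine Real.log_nonneg ?_
      rw [le_div_iff₀ h]
      linarith [distInt_le_half (pair k α)]
  have h2 : 0 ≤ 1 / len k * Real.log (1 / distInt (pair k α)) :=
    mul_nonneg (div_nonneg zero_le_one (len_nonneg k)) h1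
  exact_mod_cast h2

theorem three_mul_toReal_beta_lt (hd : 1 ≤ d) {α : Fin d → ℝ}
    (hR : 3 * beta α < (R : EReal)) :
    beta α = ((beta α).toReal : EReal) ∧ 0 ≤ (beta α).toReal ∧ 3 * (beta α).toReal < R := by
  have h0 := beta_nonneg hd α
  have htop : beta α ≠ ⊤ := by
    intro h
    rw [h, EReal.mul_top_of_pos (by norm_num)] at hR
    exact absurd hR (not_lt.2 le_top)
  have hbot : beta α ≠ ⊥ := fun h => by
    rw [h] at h0
    exact absurd h0 (by simp)
  have hb : beta α = ((beta α).toReal : EReal) := (EReal.coe_toReal htop hbot).symm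
  refine ⟨hb, EReal.toReal_nonneg h0, ?_⟩
  rw [hb] at hR
  have : ((3 * (beta α).toReal : ℝ) : EReal) < R := by
    rw [EReal.coe_mul]
    exact hR
  exact EReal.coe_lt_coe_iff.1 this

/-- The series defining `D_{α,R}` converges, as `‖⟨n, α⟩‖ ≥ e^{-c|n|}` for all but finitely many `n`
whenever `c > β(α)`. -/
theorem summable_DConst (hd : 1 ≤ d) {α : Fin d → ℝ} (hα : RationallyIndependent α)
    (hR : 3 * beta α < (R : EReal)) :
    Summable fun n : Fin d → ℤ => Real.exp (-((R + 3 * (beta α).toReal) * len n / 2)) /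
      ‖Complex.exp (2 * Real.pi * Complex.I * (pair n α : ℂ)) - 1‖ ^ 3 := by
  obtain ⟨hb, hb0, hbR⟩ := three_mul_toReal_beta_lt hd hR
  set β := (beta α).toReal with hβ
  set c := (3 * β + R) / 6 - (R - 3 * β) / 12 with hc
  have hβc : β < c := by rw [hc]; linarith
  have hcR : 0 < (R + 3 * β) / 2 - 3 * c := by rw [hc]; linarith
  have hev : ∀ᶠ k in cofinite, ((1 / len k * Real.log (1 / distInt (pair k α)) : ℝ) : EReal) < c :=
    eventually_lt_of_limsup_lt (by
      change beta α < (c : EReal)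
      rw [hb]
      exact_mod_cast hβc)
  refine Summable.of_norm_bounded_eventually
    (summable_exp_neg_len (d := d) (s := (R + 3 * β) / 2 - 3 * c) hcR) ?_
  filter_upwards [hev, (Set.finite_singleton (0 : Fin d → ℤ)).compl_mem_cofinite] with n hn hn0
  have hn0' : n ≠ 0 := hn0
  have hl := one_le_len hn0'
  have hdist := hα.distInt_pos hn0'
  have hn' : 1 / len n * Real.log (1 / distInt (pair n α)) < c := by exact_mod_cast hn
  have h1 : Real.exp (-(c * len n)) ≤ distInt (pair n α) := by
    rw [one_div_mul_eq_div, div_lt_iff₀ (by linarith), one_div, Real.log_inv] at hn'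
    calc Real.exp (-(c * len n)) ≤ Real.exp (Real.log (distInt (pair n α))) :=
          Real.exp_le_exp.2 (by linarith)
      _ = distInt (pair n α) := Real.exp_log hdist
  have h2 : Real.exp (-(c * len n)) ≤
      ‖Complex.exp (2 * Real.pi * Complex.I * (pair n α : ℂ)) - 1‖ :=
    h1.trans (by linarith [four_mul_distInt_le (pair n α)])
  rw [Real.norm_of_nonneg (by positivity), div_le_iff₀ (pow_pos (hα.norm_divisor_pos hn0') 3)]
  have h3 : Real.exp (-((R + 3 * β) * len n / 2)) =
      Real.exp (-(((R + 3 * β) / 2 - 3 * c) * len n)) * Real.exp (-(c * len n)) ^ 3 := by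
    rw [← Real.exp_nat_mul, ← Real.exp_add]
    congr 1
    push_cast
    ring
  rw [h3]
  gcongr

theorem divisorTerm_sum_le_DConst (hd : 1 ≤ d) {α : Fin d → ℝ} (hα : RationallyIndependent α)
    (hR : 3 * beta α < (R : EReal)) :
    Summable (divisorTerm α R) ∧ ∑' n, divisorTerm α R n ≤ DConst α R ∧ 2 ≤ DConst α R := by
  obtain ⟨-, hb0, hbR⟩ := three_mul_toReal_beta_lt hd hR
  set t : (Fin d → ℤ) → ℝ := fun n => Real.exp (-((R + 3 * (beta α).toReal) * len n / 2)) /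
      ‖Complex.exp (2 * Real.pi * Complex.I * (pair n α : ℂ)) - 1‖ ^ 3 with ht
  have hts : Summable t := summable_DConst hd hα hR
  have ht0 : ∀ n, 0 ≤ t n := fun n => by positivity
  have hle : ∀ n, divisorTerm α R n ≤ 4 * t n := by
    intro n
    by_cases hn : n = 0
    · rw [hn, divisorTerm_zero]
      exact mul_nonneg (by norm_num) (ht0 0)
    have hp := hα.norm_divisor_pos hn
    have h2 := norm_divisor_le α n
    simp only [divisorTerm, ht]
    set w := ‖Complex.exp (2 * Real.pi * Complex.I * (pair n α : ℂ)) - 1‖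
    have hl := len_nonneg n
    have h1 : Real.exp (-(5 * R * len n)) ≤
        Real.exp (-((R + 3 * (beta α).toReal) * len n / 2)) := by
      rw [Real.exp_le_exp]
      have e1 := mul_le_mul_of_nonneg_right hbR.le hl
      have e2 : 0 ≤ R * len n := mul_nonneg (by linarith) hl
      linarith
    rw [← mul_div_assoc, div_le_div_iff₀ hp (pow_pos hp 3)]
    have h3 : w ^ 2 ≤ 4 := by
      have := pow_le_pow_left₀ hp.le h2 2
      linarith
    calc Real.exp (-(5 * R * len n)) * w ^ 3
        = Real.exp (-(5 * R * len n)) * (w ^ 2 * w) := by ring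
      _ ≤ Real.exp (-((R + 3 * (beta α).toReal) * len n / 2)) * (4 * w) := by gcongr
      _ = _ := by ring
  have hd0 : ∀ n, 0 ≤ divisorTerm α R n := fun n => by rw [divisorTerm]; positivity
  have hs := Summable.of_nonneg_of_le hd0 hle (hts.mul_left 4)
  have hD : DConst α R = 2 + 40 * ∑' n, t n := by
    have : ∑' n : {n : Fin d → ℤ | n ≠ 0}, t n = ∑' n, t n := by
      refine tsum_subtype_eq_of_support_subset fun n hn h0 => hn ?_
      rw [h0]
      simp [ht, pair_zero]
    rw [← this]
    rfl
  have hT0 : 0 ≤ ∑' n, t n := tsum_nonneg ht0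
  refine ⟨hs, ?_, by rw [hD]; linarith⟩
  have := hs.tsum_le_tsum hle (hts.mul_left 4)
  rw [tsum_mul_left] at this
  rw [hD]
  linarith

/-- In the Diophantine case the small divisor series is majorized by
`T = D_τ / (γ³ R^{4τ+1})`, and so is, up to a factor `e^{-2R}`, the oscillation series. -/
theorem divisorTerm_sum_le_DTau (hd : 1 ≤ d) {α : Fin d → ℝ} {γ τ : ℝ} (hR : 0 < R) (hγ : 0 < γ)
    (hτ : (d : ℝ) - 1 < τ) (hdio : Diophantine γ τ α) :
    Summable (divisorTerm α R) ∧
      ∑' n, divisorTerm α R n ≤ DTau τ / (γ ^ 3 * R ^ (4 * τ + 1)) ∧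
      ∑' n : Fin d → ℤ, oscTerm R n ≤
        Real.exp (-(2 * R)) * (DTau τ / (γ ^ 3 * R ^ (4 * τ + 1))) ∧ γ < 1 := by
  have hd' : (1 : ℝ) ≤ d := by exact_mod_cast hd
  have hγ1 : γ < 1 := by
    set n : Fin d → ℤ := Pi.single ⟨0, hd⟩ 1 with hn
    have hn0 : n ≠ 0 := by
      intro h
      have := congrFun h ⟨0, hd⟩
      simp [hn] at this
    have hlen : len n = 1 := by
      rw [len, Finset.sum_eq_single ⟨0, hd⟩]
      · simp [hn]
      · intro j _ hj
        simp [hn, hj]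
      · simp
    have h1 := hdio n hn0
    rw [hlen, Real.one_rpow, div_one] at h1
    linarith [distInt_le_half (pair n α)]
  obtain ⟨hs, hle⟩ := tsum_len_rpow_mul_exp_le hd hτ hR
  set t : (Fin d → ℤ) → ℝ :=
    fun n => if n = 0 then 0 else len n ^ τ * Real.exp (-(3 * R * len n)) with ht
  have hτ0 : 0 ≤ τ := by linarith
  have hΓ : 0 < Real.Gamma (4 * τ + 2) := Real.Gamma_pos_of_pos (by linarith)
  have hRm : 0 < R ^ (4 * τ + 1) := Real.rpow_pos_of_pos hR _
  have hterm : ∀ n, divisorTerm α R n ≤ 1 / (4 * γ) * t n := by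
    intro n
    by_cases hn : n = 0
    · rw [hn, divisorTerm_zero, ht]
      simp
    have hl := one_le_len hn
    have hlτ : 0 < len n ^ τ := Real.rpow_pos_of_pos (by linarith) _
    have h1 := hdio n hn
    have h2 : 4 * (γ / len n ^ τ) ≤
        ‖Complex.exp (2 * Real.pi * Complex.I * (pair n α : ℂ)) - 1‖ := by
      linarith [four_mul_distInt_le (pair n α)]
    simp only [divisorTerm, ht, if_neg hn]
    calc Real.exp (-(5 * R * len n)) / ‖Complex.exp (2 * Real.pi * Complex.I * (pair n α : ℂ)) - 1‖
        ≤ Real.exp (-(3 * R * len n)) / (4 * (γ / len n ^ τ)) := by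
          have : 0 ≤ R * len n := mul_nonneg hR.le (by linarith)
          gcongr
          norm_num
      _ = _ := by field_simp
  have hd0 : ∀ n, 0 ≤ divisorTerm α R n := fun n => by rw [divisorTerm]; positivity
  have hsum := Summable.of_nonneg_of_le hd0 hterm (hs.mul_left (1 / (4 * γ)))
  have hpow : (2 : ℝ) ^ (τ + 1) ≤ 2 ^ (4 * τ + 9) :=
    Real.rpow_le_rpow_of_exponent_le (by norm_num) (by linarith)
  have hDT : 2 ^ (τ + 1) * Real.Gamma (4 * τ + 2) / R ^ (4 * τ + 1) ≤ DTau τ / R ^ (4 * τ + 1) := by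
    rw [DTau]
    gcongr
  have hDT0 : 0 ≤ DTau τ / R ^ (4 * τ + 1) := by rw [DTau]; positivity
  have hγ3 : γ ^ 3 ≤ γ := pow_le_of_le_one hγ.le hγ1.le (by norm_num)
  refine ⟨hsum, ?_, ?_, hγ1⟩
  · have h1 := hsum.tsum_le_tsum hterm (hs.mul_left (1 / (4 * γ)))
    rw [tsum_mul_left] at h1
    refine h1.trans ?_
    have h2 : 1 / (4 * γ) ≤ 1 / γ ^ 3 := by
      apply one_div_le_one_div_of_le (by positivity)
      linarith
    have h3 : 0 ≤ 1 / (4 * γ) := by positivity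
    calc 1 / (4 * γ) * ∑' n, t n ≤ 1 / (4 * γ) * (DTau τ / R ^ (4 * τ + 1)) := by
          gcongr
          exact hle.trans hDT
      _ ≤ 1 / γ ^ 3 * (DTau τ / R ^ (4 * τ + 1)) := by gcongr
      _ = _ := by field_simp
  · have hosc : ∀ n : Fin d → ℤ, oscTerm R n ≤ Real.exp (-(2 * R)) * t n := by
      intro n
      by_cases hn : n = 0
      · simp [oscTerm, ht, hn]
      have hl := one_le_len hn
      have hlτ : 1 ≤ len n ^ τ := Real.one_le_rpow hl hτ0
      simp only [oscTerm, ht, if_neg hn]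
      have e : Real.exp (-(5 * R * len n)) =
          Real.exp (-(2 * R * len n)) * (1 * Real.exp (-(3 * R * len n))) := by
        rw [one_mul, ← Real.exp_add]; ring_nf
      rw [e]
      have : Real.exp (-(2 * R * len n)) ≤ Real.exp (-(2 * R)) := by
        rw [Real.exp_le_exp]
        have := mul_le_mul_of_nonneg_left hl hR.le
        linarith
      gcongr
    have ho0 : ∀ n : Fin d → ℤ, 0 ≤ oscTerm R n := fun n => by
      rw [oscTerm]; split_ifs <;> positivity
    have hso := Summable.of_nonneg_of_le ho0 hosc (hs.mul_left _)
    have h1 := hso.tsum_le_tsum hosc (hs.mul_left _)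
    rw [tsum_mul_left] at h1
    refine h1.trans (mul_le_mul_of_nonneg_left ((hle.trans hDT).trans ?_) (Real.exp_pos _).le)
    have hD0 : 0 ≤ DTau τ := by rw [DTau]; positivity
    have : γ ^ 3 * R ^ (4 * τ + 1) ≤ 1 * R ^ (4 * τ + 1) := by
      gcongr
      linarith
    rw [one_mul] at this
    exact div_le_div_of_nonneg_left hD0 (by positivity) this

end SmallDivisors

/-! ### From the conjugacy to the orbit data -/

section Conjugacy

theorem norm_entry_le_opNorm (A : Matrix (Fin 2) (Fin 2) ℂ) (i j : Fin 2) : ‖A i j‖ ≤ opNorm A := by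
  have h1 := (Matrix.toEuclideanCLM (n := Fin 2) (𝕜 := ℂ) A).le_opNorm (EuclideanSpace.single j 1)
  rw [PiLp.norm_single, norm_one, mul_one] at h1
  have h2 := PiLp.norm_apply_le
    (Matrix.toEuclideanCLM (n := Fin 2) (𝕜 := ℂ) A (EuclideanSpace.single j 1)) i
  have h3 : (Matrix.toEuclideanCLM (n := Fin 2) (𝕜 := ℂ) A (EuclideanSpace.single j 1)) i =
      A i j := by
    rw [Matrix.ofLp_toEuclideanCLM]
    simp
  rw [h3] at h2
  exact h2.trans h1

/-- The norm of a column is the norm of the image of a basis vector. -/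
theorem norm_column_sq_le_opNorm (A : Matrix (Fin 2) (Fin 2) ℂ) (j : Fin 2) :
    ‖A 0 j‖ ^ 2 + ‖A 1 j‖ ^ 2 ≤ opNorm A ^ 2 := by
  have h1 := (Matrix.toEuclideanCLM (n := Fin 2) (𝕜 := ℂ) A).le_opNorm (EuclideanSpace.single j 1)
  rw [PiLp.norm_single, norm_one, mul_one] at h1
  have h2 := pow_le_pow_left₀ (norm_nonneg _) h1 2
  have h3 : ∀ i, (Matrix.toEuclideanCLM (n := Fin 2) (𝕜 := ℂ) A (EuclideanSpace.single j 1)) i =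
      A i j := by
    intro i
    rw [Matrix.ofLp_toEuclideanCLM]
    simp
  rw [EuclideanSpace.norm_sq_eq, Fin.sum_univ_two, h3, h3] at h2
  exact h2

variable {d : ℕ} {R : ℝ} (X : AnalyticPSL d R)

namespace AnalyticPSL

/-- The entry `(i, j)` of the lift, as a real function. -/
def entry (i j : Fin 2) (x : Fin d → ℝ) : ℝ := (X.lift x).1 i j

theorem det_entry (x : Fin d → ℝ) :
    X.entry 0 0 x * X.entry 1 1 x - X.entry 0 1 x * X.entry 1 0 x = 1 := by
  have := (X.lift x).2
  rwa [Matrix.det_fin_two] at this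

theorem ofReal_mem_strip (hR : 0 < R) (x : Fin d → ℝ) : (fun l => (x l : ℂ)) ∈ strip d R :=
  fun j => by simpa using hR

theorem continuous_entry (hR : 0 < R) (i j : Fin 2) : Continuous (X.entry i j) := by
  have h : Continuous fun x : Fin d → ℝ => (X.ext (fun l => (x l : ℂ)) i j).re :=
    Complex.continuous_re.comp ((X.holomorphic i j).continuousOn.comp_continuous (by fun_prop)
      (ofReal_mem_strip hR))
  refine h.congr fun x => ?_
  rw [X.ext_ofReal, Complex.ofReal_re]
  rfl

theorem opNorm_le_norm {z : Fin d → ℂ} (hz : z ∈ strip d R) : opNorm (X.ext z) ≤ X.norm := by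
  obtain ⟨C, hC⟩ := X.bounded
  have hb : BddAbove (Set.range fun z : strip d R => opNorm (X.ext z.1)) :=
    ⟨C, by rintro _ ⟨z, rfl⟩; exact hC z.1 z.2⟩
  exact le_ciSup hb ⟨z, hz⟩

theorem norm_ext_entry_le {z : Fin d → ℂ} (hz : z ∈ strip d R) (i j : Fin 2) :
    ‖X.ext z i j‖ ≤ X.norm := (norm_entry_le_opNorm _ i j).trans (X.opNorm_le_norm hz)

theorem abs_entry_le (hR : 0 < R) (i j : Fin 2) (x : Fin d → ℝ) : |X.entry i j x| ≤ X.norm := by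
  have := X.norm_ext_entry_le (ofReal_mem_strip hR x) i j
  rwa [X.ext_ofReal, Complex.norm_real] at this

theorem nonneg_norm (hR : 0 < R) : 0 ≤ X.norm := (abs_nonneg _).trans (X.abs_entry_le hR 0 0 0)

theorem one_le_norm (hR : 0 < R) : 1 ≤ X.norm := by
  have hcol : ∀ j, X.entry 0 j 0 ^ 2 + X.entry 1 j 0 ^ 2 ≤ X.norm ^ 2 := by
    intro j
    have hs := ofReal_mem_strip (d := d) hR 0
    have h1 := norm_column_sq_le_opNorm (X.ext fun l => (((0 : Fin d → ℝ) l : ℝ) : ℂ)) j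
    rw [X.ext_ofReal, X.ext_ofReal, Complex.norm_real, Complex.norm_real, Real.norm_eq_abs,
      Real.norm_eq_abs, sq_abs, sq_abs] at h1
    exact h1.trans (pow_le_pow_left₀ (norm_nonneg _) (X.opNorm_le_norm hs) 2)
  have hdet := X.det_entry 0
  set p := X.entry 0 0 0
  set q := X.entry 0 1 0
  set r := X.entry 1 0 0
  set s := X.entry 1 1 0
  have h0 := hcol 0
  have h1 := hcol 1
  -- Hadamard's inequality for the determinant
  have h2 : 1 ≤ X.norm ^ 2 := by
    linarith [sq_nonneg (p - s), sq_nonneg (q + r)]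
  have h3 := X.nonneg_norm hR
  by_contra! hlt
  have := pow_lt_one₀ h3 hlt (n := 2) (by norm_num)
  linarith

theorem entry_mul_entry_periodic (i j k l : Fin 2) (n : Fin d → ℤ) (x : Fin d → ℝ) :
    X.entry i j (x + intVec n) * X.entry k l (x + intVec n) = X.entry i j x * X.entry k l x := by
  rcases X.periodic n x with h | h
  · simp only [entry, h]
  · simp only [entry, h, Matrix.neg_apply, neg_mul_neg]

theorem holomorphic_mul (i j k l : Fin 2) :
    DifferentiableOn ℂ (fun z => X.ext z i j * X.ext z k l) (strip d R) :=
  (X.holomorphic i j).mul (X.holomorphic k l)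

theorem norm_mul_le (hR : 0 < R) (i j k l : Fin 2) {z : Fin d → ℂ} (hz : z ∈ strip d R) :
    ‖X.ext z i j * X.ext z k l‖ ≤ X.norm ^ 2 := by
  rw [norm_mul, sq]
  exact mul_le_mul (X.norm_ext_entry_le hz i j) (X.norm_ext_entry_le hz k l) (norm_nonneg _)
    (X.nonneg_norm hR)

theorem ext_mul_ofReal (i j k l : Fin 2) (x : Fin d → ℝ) :
    X.ext (fun m => (x m : ℂ)) i j * X.ext (fun m => (x m : ℂ)) k l =
      ((X.entry i j x * X.entry k l x : ℝ) : ℂ) := by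
  rw [X.ext_ofReal, X.ext_ofReal, Complex.ofReal_mul]
  rfl

theorem exists_cohomological_solution (hR : 0 < R) {α : Fin d → ℝ} (hα : RationallyIndependent α)
    (hs : Summable (divisorTerm α R)) (i j k l : Fin 2) :
    ∃ (m : ℝ) (y : (Fin d → ℝ) → ℝ),
      (∀ x, y (x + α) - y x = X.entry i j x * X.entry k l x - m) ∧
      ∀ x, |y x| ≤ X.norm ^ 2 * ∑' n, divisorTerm α R n := by
  obtain ⟨m, y, h1, h2⟩ := QPSchrodinger.exists_cohomological_solution hα hR
    (X.holomorphic_mul i j k l) (fun z hz => X.norm_mul_le hR i j k l hz) (fun n x => by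
      rw [X.ext_mul_ofReal, X.ext_mul_ofReal, X.entry_mul_entry_periodic]) hs
  refine ⟨m, y, fun x => ?_, h2⟩
  rw [h1, X.ext_mul_ofReal, Complex.ofReal_re]

end AnalyticPSL

variable {V : AnalyticPotential d} {α : Fin d → ℝ} {E ζ : ℝ}

/-- The conjugacy relation, entry by entry, with a sign independent of the base point since the
lift is continuous. -/
theorem Conjugates.exists_sign (hR : 0 < R) {X : AnalyticPSL d R}
    (hX : Conjugates X α (cocycle V E) !![1, ζ; 0, 1]) :
    ∃ σ : ℝ, (σ = 1 ∨ σ = -1) ∧ ∀ x,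
      X.entry 0 0 x = σ * X.entry 1 0 (x + α) ∧
      X.entry 0 1 x = σ * (ζ * X.entry 1 0 (x + α) + X.entry 1 1 (x + α)) ∧
      (E - V.toFun x) * X.entry 0 0 x - X.entry 1 0 x = σ * X.entry 0 0 (x + α) ∧
      (E - V.toFun x) * X.entry 0 1 x - X.entry 1 1 x =
        σ * (ζ * X.entry 0 0 (x + α) + X.entry 0 1 (x + α)) := by
  set h : (Fin d → ℝ) → ℝ :=
    fun x => ((X.lift (x + α))⁻¹.1 * cocycle V E x * (X.lift x).1) 0 0 with hh
  have hexp : ∀ x, h x = (X.entry 1 1 (x + α) * (E - V.toFun x) - X.entry 0 1 (x + α)) *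
      X.entry 0 0 x - X.entry 1 1 (x + α) * X.entry 1 0 x := by
    intro x
    simp only [hh, Matrix.SpecialLinearGroup.coe_inv, Matrix.adjugate_fin_two, cocycle,
      Matrix.mul_apply, Fin.sum_univ_two, AnalyticPSL.entry]
    simp
    ring
  have hV : Continuous V.toFun := continuousOn_univ.mp V.analytic.continuousOn
  have hsh : Continuous fun x : Fin d → ℝ => x + α := by fun_prop
  have hcont : Continuous h := by
    have c1 := (X.continuous_entry hR 1 1).comp hsh
    have c2 := (X.continuous_entry hR 0 1).comp hsh
    have c3 : Continuous fun x => E - V.toFun x := continuous_const.sub hV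
    have := ((c1.mul c3).sub c2).mul (X.continuous_entry hR 0 0) |>.sub
      (c1.mul (X.continuous_entry hR 1 0))
    exact this.congr fun x => (hexp x).symm
  have hval : ∀ x, h x = 1 ∧ (X.lift (x + α))⁻¹.1 * cocycle V E x * (X.lift x).1 =
      h x • !![1, ζ; 0, 1] ∨ h x = -1 ∧ (X.lift (x + α))⁻¹.1 * cocycle V E x * (X.lift x).1 =
      h x • !![1, ζ; 0, 1] := by
    intro x
    rcases hX x with hx | hx
    · left
      have : h x = 1 := by simp only [hh]; rw [hx]; simp
      exact ⟨this, by rw [this, one_smul, hx]⟩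
    · right
      have : h x = -1 := by simp only [hh]; rw [hx]; simp
      exact ⟨this, by rw [this, neg_one_smul, hx]⟩
  have hconst : (∀ x, h x = 1) ∨ ∀ x, h x = -1 := by
    have := isPreconnected_univ.eq_one_or_eq_neg_one_of_sq_eq hcont.continuousOn (fun x _ => by
      rcases hval x with h1 | h1 <;> simp [h1.1])
    rcases this with h1 | h1
    · exact Or.inl fun x => h1 (Set.mem_univ x)
    · exact Or.inr fun x => h1 (Set.mem_univ x)
  obtain ⟨σ, hσ, hσx⟩ : ∃ σ : ℝ, (σ = 1 ∨ σ = -1) ∧ ∀ x, h x = σ := by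
    rcases hconst with h1 | h1
    · exact ⟨1, Or.inl rfl, h1⟩
    · exact ⟨-1, Or.inr rfl, h1⟩
  refine ⟨σ, hσ, fun x => ?_⟩
  have hmat : (X.lift (x + α))⁻¹.1 * cocycle V E x * (X.lift x).1 = σ • !![1, ζ; 0, 1] := by
    rw [← hσx x]
    rcases hval x with h1 | h1 <;> exact h1.2
  have hmul : cocycle V E x * (X.lift x).1 = (X.lift (x + α)).1 * (σ • !![1, ζ; 0, 1]) := by
    rw [← hmat, ← Matrix.mul_assoc, ← Matrix.mul_assoc, ← Matrix.SpecialLinearGroup.coe_mul,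
      mul_inv_cancel, Matrix.SpecialLinearGroup.coe_one, Matrix.one_mul]
  have e00 := congrFun (congrFun hmul 0) 0
  have e01 := congrFun (congrFun hmul 0) 1
  have e10 := congrFun (congrFun hmul 1) 0
  have e11 := congrFun (congrFun hmul 1) 1
  simp [Matrix.mul_apply, Fin.sum_univ_two, cocycle] at e00 e01 e10 e11
  simp only [AnalyticPSL.entry]
  refine ⟨?_, ?_, ?_, ?_⟩
  · linarith
  · linarith
  · linarith
  · linarith

variable (θ : Fin d → ℝ)

theorem Conjugates.exists_edgeData (hR : 0 < R) (hα : RationallyIndependent α)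
    {X : AnalyticPSL d R} (hX : Conjugates X α (cocycle V E) !![1, ζ; 0, 1])
    (hs : Summable (divisorTerm α R)) {L : ℝ} (hL : ∑' n, divisorTerm α R n ≤ L) :
    ∃ (D : EdgeData (orbitPotential V α θ) E ζ X.norm (X.norm ^ 2 * L)) (σ : ℝ),
      (σ = 1 ∨ σ = -1) ∧ ∀ n : ℤ, D.φ n = σ ^ n * X.entry 0 0 (θ + (n : ℝ) • α) := by
  obtain ⟨σ, hσ, hrel⟩ := hX.exists_sign hR
  obtain ⟨a, y₁, hy₁, by₁⟩ := X.exists_cohomological_solution hR hα hs 0 0 0 0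
  obtain ⟨b, y₂, hy₂, by₂⟩ := X.exists_cohomological_solution hR hα hs 0 1 0 1
  obtain ⟨c, y₃, hy₃, by₃⟩ := X.exists_cohomological_solution hR hα hs 0 0 0 1
  have hσ2 : σ * σ = 1 := by rcases hσ with h | h <;> rw [h] <;> norm_num
  have hσ0 : σ ≠ 0 := by rintro rfl; norm_num at hσ2
  have hσi : σ⁻¹ = σ := inv_eq_of_mul_eq_one_left hσ2
  have hσn : ∀ n : ℤ, σ ^ n * σ ^ n = 1 := fun n => by rw [← mul_zpow, hσ2, one_zpow]
  have hσa : ∀ n : ℤ, |σ ^ n| = 1 := fun n => by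
    rcases hσ with h | h <;> rw [h, abs_zpow] <;> simp
  set P : ℤ → Fin d → ℝ := fun n => θ + (n : ℝ) • α with hP
  have hPs : ∀ n, P n + α = P (n + 1) := by
    intro n
    simp only [hP]
    push_cast
    rw [add_smul, one_smul, add_assoc]
  have hPm : ∀ n, P (n - 1) + α = P n := fun n => by rw [hPs, sub_add_cancel]
  have hK : X.norm ^ 2 * ∑' n, divisorTerm α R n ≤ X.norm ^ 2 * L := by gcongr
  have hsucc : ∀ n : ℤ, σ ^ (n + 1) = σ ^ n * σ := fun n => zpow_add_one₀ hσ0 n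
  have hpred : ∀ n : ℤ, σ ^ (n - 1) = σ ^ n * σ := fun n => by rw [zpow_sub_one₀ hσ0, hσi]
  -- the relations at the point `P n`, solved for the neighbouring first-row entries
  have r1 : ∀ n, σ * X.entry 0 0 (P (n + 1)) =
      (E - orbitPotential V α θ n) * X.entry 0 0 (P n) - X.entry 1 0 (P n) := fun n => by
    have := (hrel (P n)).2.2.1
    rw [hPs] at this
    exact this.symm
  have r2 : ∀ n, σ * X.entry 0 1 (P (n + 1)) =
      (E - orbitPotential V α θ n) * X.entry 0 1 (P n) - X.entry 1 1 (P n)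
        - σ * ζ * X.entry 0 0 (P (n + 1)) := fun n => by
    have := (hrel (P n)).2.2.2
    rw [hPs] at this
    change (E - orbitPotential V α θ n) * _ - _ = _ at this
    linarith
  have r3 : ∀ n, X.entry 0 0 (P (n - 1)) = σ * X.entry 1 0 (P n) := fun n => by
    have := (hrel (P (n - 1))).1
    rwa [hPm] at this
  have r4 : ∀ n, X.entry 0 1 (P (n - 1)) = σ * (ζ * X.entry 1 0 (P n) + X.entry 1 1 (P n)) :=
    fun n => by
      have := (hrel (P (n - 1))).2.1
      rwa [hPm] at this
  refine ⟨{
    φ := fun n => σ ^ n * X.entry 0 0 (P n)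
    ψ := fun n => σ ^ n * X.entry 0 1 (P n)
    a := a
    b := b
    c := c
    y₁ := fun n => y₁ (P n)
    y₂ := fun n => y₂ (P n)
    y₃ := fun n => y₃ (P n)
    abs_φ := fun n => by
      rw [abs_mul, hσa, one_mul]; exact X.abs_entry_le hR _ _ _
    abs_ψ := fun n => by
      rw [abs_mul, hσa, one_mul]; exact X.abs_entry_le hR _ _ _
    abs_y₁ := fun n => (by₁ _).trans hK
    abs_y₂ := fun n => (by₂ _).trans hK
    abs_y₃ := fun n => (by₃ _).trans hK
    solution_φ := fun n => by
      rw [hsucc, hpred, r3]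
      linear_combination σ ^ n * r1 n + σ ^ n * X.entry 1 0 (P n) * hσ2
    solution_ψ := fun n => by
      rw [hsucc, hpred, r3, r4]
      linear_combination σ ^ n * r2 n + σ ^ n * X.entry 1 1 (P n) * hσ2
    wronskian := fun n => by
      have h1 := r3 (n + 1)
      have h2 := r4 (n + 1)
      rw [add_sub_cancel_right] at h1 h2
      rw [hsucc, h1, h2]
      linear_combination (σ * σ) * (σ ^ n * σ ^ n) * X.det_entry (P (n + 1)) +
        σ * σ * hσn n + hσ2
    step_y₁ := fun n => by
      rw [← hPs, hy₁]
      linear_combination (-(X.entry 0 0 (P n)) ^ 2) * hσn n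
    step_y₂ := fun n => by
      rw [← hPs, hy₂]
      linear_combination (-(X.entry 0 1 (P n)) ^ 2) * hσn n
    step_y₃ := fun n => by
      rw [← hPs, hy₃]
      linear_combination (-(X.entry 0 0 (P n) * X.entry 0 1 (P n))) * hσn n }, σ, hσ, fun n => rfl⟩

/-- At an edge of a bounded gap the entry `X₁₁` has a zero: otherwise `|X₁₁|` would provide a
positive (or sign-alternating) solution. -/
theorem Conjugates.exists_zero (hR : 0 < R) (hα : RationallyIndependent α) (hζ : 0 ≤ ζ)
    {X : AnalyticPSL d R} (hX : Conjugates X α (cocycle V E) !![1, ζ; 0, 1])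
    (hs : Summable (divisorTerm α R)) {a b : ℝ} (hG : IsSpectralGap (spec V α θ) a b)
    (hE : E = a ∨ E = b) : ∃ x, X.entry 0 0 x = 0 := by
  by_contra! hne
  obtain ⟨D, σ, hσ, hφ⟩ := hX.exists_edgeData θ hR hα hs le_rfl
  have hσ0 : σ ≠ 0 := by rcases hσ with h | h <;> rw [h] <;> norm_num
  have hc := X.continuous_entry hR 0 0
  obtain ⟨s, hs⟩ : ∃ s : ℝ, ∀ x, |X.entry 0 0 x| = s * X.entry 0 0 x := by
    have hq : Continuous fun x => X.entry 0 0 x / |X.entry 0 0 x| :=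
      hc.div hc.abs fun x => abs_ne_zero.2 (hne x)
    have := isPreconnected_univ.eq_one_or_eq_neg_one_of_sq_eq hq.continuousOn (fun x _ => by
      have : X.entry 0 0 x ^ 2 ≠ 0 := pow_ne_zero 2 (hne x)
      simp [div_pow, this])
    rcases this with h1 | h1
    · refine ⟨1, fun x => ?_⟩
      have := h1 (Set.mem_univ x)
      simp only [Pi.one_apply] at this
      rw [div_eq_one_iff_eq (abs_ne_zero.2 (hne x))] at this
      rw [one_mul, ← this]
    · refine ⟨-1, fun x => ?_⟩
      have := h1 (Set.mem_univ x)
      simp only [Pi.neg_apply, Pi.one_apply] at this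
      rw [div_eq_iff (abs_ne_zero.2 (hne x))] at this
      linarith
  have hσ2 : σ * σ = 1 := by rcases hσ with h | h <;> rw [h] <;> norm_num
  have hσi : σ⁻¹ = σ := inv_eq_of_mul_eq_one_left hσ2
  have hσn : ∀ n : ℤ, σ ^ n * σ ^ n = 1 := fun n => by rw [← mul_zpow, hσ2, one_zpow]
  have hentry : ∀ n : ℤ, X.entry 0 0 (θ + (n : ℝ) • α) = σ ^ n * D.φ n := by
    intro n
    rw [hφ, ← mul_assoc, hσn, one_mul]
  refine D.not_extremal hζ (fun n => ?_) hG hE hσ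
    (χ := fun n => |X.entry 0 0 (θ + (n : ℝ) • α)|) (fun n => abs_pos.2 (hne _)) fun n => ?_
  · rw [hφ]
    exact mul_ne_zero (zpow_ne_zero _ hσ0) (hne _)
  · simp only [hs]
    simp only [hentry]
    rw [zpow_add_one₀ hσ0, zpow_sub_one₀ hσ0, hσi]
    linear_combination s * σ ^ n * σ * D.solution_φ n

/-- Since `X₁₁` has a zero and oscillates little, `X₁₁` and `X₂₁ = ± X₁₁(· - α)` are small
everywhere, which forces `|X|_R` to be large because `det X = 1`. -/
theorem AnalyticPSL.exp_le_norm_pow (hR : 0 < R) (X : AnalyticPSL d R) {σ : ℝ}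
    (hσ : σ = 1 ∨ σ = -1) (hrel : ∀ x, X.entry 0 0 x = σ * X.entry 1 0 (x + α))
    (hzero : ∃ x, X.entry 0 0 x = 0)
    (hosc : ∑' n : Fin d → ℤ, oscTerm R n ≤ Real.exp (-(2 * R))) :
    Real.exp (2 * R) ≤ 8 * X.norm ^ 4 := by
  obtain ⟨x₀, hx₀⟩ := hzero
  have hN := X.nonneg_norm hR
  have hsmall : ∀ x, X.entry 0 0 x ^ 2 ≤ 2 * X.norm ^ 2 * Real.exp (-(2 * R)) := by
    intro x
    have := norm_sub_le_oscillation hR (X.holomorphic_mul 0 0 0 0)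
      (fun z hz => X.norm_mul_le hR 0 0 0 0 hz) (fun n x => by
        rw [X.ext_mul_ofReal, X.ext_mul_ofReal, X.entry_mul_entry_periodic]) x x₀
    rw [X.ext_mul_ofReal, X.ext_mul_ofReal, hx₀, mul_zero, Complex.ofReal_zero, sub_zero,
      Complex.norm_real, Real.norm_eq_abs, ← sq, abs_of_nonneg (sq_nonneg _)] at this
    have h2 : X.norm ^ 2 * ∑' n : Fin d → ℤ, oscTerm R n ≤ X.norm ^ 2 * Real.exp (-(2 * R)) := by
      gcongr
    linarith
  have h0 := hsmall α
  have h1 : X.entry 1 0 α ^ 2 ≤ 2 * X.norm ^ 2 * Real.exp (-(2 * R)) := by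
    have h2 := hsmall 0
    rw [hrel 0, zero_add] at h2
    rcases hσ with h | h <;> rw [h] at h2 <;> linarith
  have hdet := X.det_entry α
  have hle : ∀ i j, X.entry i j α ^ 2 ≤ X.norm ^ 2 := fun i j =>
    sq_le_sq' (abs_le.1 (X.abs_entry_le hR i j α)).1 (abs_le.1 (X.abs_entry_le hR i j α)).2
  set p := X.entry 0 0 α
  set q := X.entry 0 1 α
  set r := X.entry 1 0 α
  set s := X.entry 1 1 α
  have h3 : 1 ≤ (p ^ 2 + r ^ 2) * (s ^ 2 + q ^ 2) := by
    have : (p ^ 2 + r ^ 2) * (s ^ 2 + q ^ 2) = (p * s - q * r) ^ 2 + (p * q + r * s) ^ 2 := by ring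
    rw [this, hdet]
    linarith [sq_nonneg (p * q + r * s)]
  have h4 : (p ^ 2 + r ^ 2) * (s ^ 2 + q ^ 2) ≤
      (4 * X.norm ^ 2 * Real.exp (-(2 * R))) * (2 * X.norm ^ 2) :=
    mul_le_mul (by linarith) (by linarith [hle 0 1, hle 1 1]) (by positivity) (by positivity)
  have h5 : Real.exp (2 * R) * Real.exp (-(2 * R)) = 1 := by
    rw [← Real.exp_add]; simp
  have h6 := mul_le_mul_of_nonneg_left (h3.trans h4) (Real.exp_pos (2 * R)).le
  have h7 : Real.exp (2 * R) * (4 * X.norm ^ 2 * Real.exp (-(2 * R)) * (2 * X.norm ^ 2)) =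
      8 * X.norm ^ 4 * (Real.exp (2 * R) * Real.exp (-(2 * R))) := by ring
  rw [h7, h5] at h6
  linarith

end Conjugacy

end QPSchrodinger

end

/-! ### The gap estimates -/

theorem theorem5p1 {d : ℕ} (α : Fin d → ℝ) (hα : QPSchrodinger.RationallyIndependent α)
    (R : ℝ) (hR : 3 * QPSchrodinger.beta α < (R : EReal))
    (κ : ℝ) (hκ₀ : 0 < κ) (hκ₁ : κ < 1 / 4)
    (V : QPSchrodinger.AnalyticPotential d) (hV : ∃ x y, V.toFun x ≠ V.toFun y)
    (θ : Fin d → ℝ) (a b : ℝ)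
    (hG : QPSchrodinger.IsSpectralGap (QPSchrodinger.spec V α θ) a b)
    (E : ℝ) (hE : E = a ∨ E = b)
    (ζ : ℝ) (hζ₀ : 0 < ζ) (hζ₁ : ζ < 1 / 2)
    (X : QPSchrodinger.AnalyticPSL d R)
    (hX : QPSchrodinger.Conjugates X α (QPSchrodinger.cocycle V E) !![1, ζ; 0, 1]) :
    (X.norm ^ 14 * ζ ^ κ ≤ 1 / 10 ^ 5 * (1 / QPSchrodinger.DConst α R ^ 4) →
      ζ ^ (1 + κ) ≤ b - a ∧ b - a ≤ ζ ^ (1 - κ)) ∧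
    (∀ γ τ : ℝ, 0 < γ → (d : ℝ) - 1 < τ → QPSchrodinger.Diophantine γ τ α →
      X.norm ^ 14 * ζ ^ κ ≤
        1 / 10 ^ 5 * (1 / QPSchrodinger.DTau τ ^ 4) * γ ^ 12 * R ^ (4 * (4 * τ + 1)) →
      ζ ^ (1 + κ) ≤ b - a ∧ b - a ≤ ζ ^ (1 - κ)) := by
  open QPSchrodinger in
  have hd : 1 ≤ d := by
    by_contra! hd
    obtain rfl : d = 0 := by omega
    obtain ⟨x, y, hxy⟩ := hV
    exact hxy (congrArg V.toFun (Subsingleton.elim x y))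
  obtain ⟨-, hβ0, hβR⟩ := three_mul_toReal_beta_lt hd hR
  have hR0 : 0 < R := by linarith
  have hN1 := X.one_le_norm hR0
  have hN0 : 0 < X.norm := by linarith
  have hε0 : 0 < ζ ^ κ := Real.rpow_pos_of_pos hζ₀ _
  have hfinish : ∀ L : ℝ, 1 ≤ L → Summable (divisorTerm α R) →
      ∑' n, divisorTerm α R n ≤ L → X.norm ^ 10 * L ^ 4 * ζ ^ κ ≤ 1 / 10 ^ 5 →
      ζ ^ (1 + κ) ≤ b - a ∧ b - a ≤ ζ ^ (1 - κ) := by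
    intro L hL1 hs hL hsmall
    obtain ⟨D, -⟩ := hX.exists_edgeData θ hR0 hα hs hL
    exact D.gap_bounds hκ₀ hκ₁ hG hE hζ₀ hζ₁ hN1 hL1 hsmall
  have h1014 : X.norm ^ 10 ≤ X.norm ^ 14 := pow_le_pow_right₀ hN1 (by norm_num)
  refine ⟨fun h => ?_, fun γ τ hγ hτ hdio h => ?_⟩
  · obtain ⟨hs, hle, h2⟩ := divisorTerm_sum_le_DConst hd hα hR
    refine hfinish (DConst α R) (by linarith) hs hle ?_
    have hD4 : 0 < DConst α R ^ 4 := by positivity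
    rw [mul_one_div, le_div_iff₀ hD4] at h
    have : X.norm ^ 10 * (ζ ^ κ * DConst α R ^ 4) ≤ X.norm ^ 14 * (ζ ^ κ * DConst α R ^ 4) := by
      gcongr
    linarith
  · obtain ⟨hs, hle, hosc, hγ1⟩ := divisorTerm_sum_le_DTau hd hR0 hγ hτ hdio
    have hd' : (1 : ℝ) ≤ d := by exact_mod_cast hd
    have hτ0 : 0 < τ := by linarith
    have hΓ : 0 < Real.Gamma (4 * τ + 2) := Real.Gamma_pos_of_pos (by linarith)
    have hRm : 0 < R ^ (4 * τ + 1) := Real.rpow_pos_of_pos hR0 _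
    have hDτ : 0 < DTau τ := by rw [DTau]; positivity
    set T := DTau τ / (γ ^ 3 * R ^ (4 * τ + 1)) with hT
    have hT0 : 0 < T := by positivity
    have h' : X.norm ^ 14 * ζ ^ κ ≤ 1 / 10 ^ 5 * (1 / T) ^ 4 := by
      have e1 : R ^ (4 * (4 * τ + 1)) = (R ^ (4 * τ + 1)) ^ 4 := by
        rw [← Real.rpow_natCast, ← Real.rpow_mul hR0.le]
        congr 1
        push_cast
        ring
      have e2 : 1 / 10 ^ 5 * (1 / T) ^ 4 =
          1 / 10 ^ 5 * (1 / DTau τ ^ 4) * γ ^ 12 * (R ^ (4 * τ + 1)) ^ 4 := by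
        rw [hT]
        field_simp
      rw [e2, ← e1]
      exact h
    rcases le_total 1 T with hT1 | hT1
    · refine hfinish T hT1 hs hle ?_
      rw [one_div_pow, mul_one_div, le_div_iff₀ (by positivity)] at h'
      have : X.norm ^ 10 * (ζ ^ κ * T ^ 4) ≤ X.norm ^ 14 * (ζ ^ κ * T ^ 4) := by gcongr
      linarith
    · -- for large `R` the hypothesis alone does not make `ζ` small; the growth of `|X|_R` does
      refine hfinish 1 le_rfl hs (hle.trans hT1) ?_
      obtain ⟨σ, hσ, hrel⟩ := hX.exists_sign hR0
      have hexp := X.exp_le_norm_pow hR0 hσ (fun x => (hrel x).1)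
        (hX.exists_zero θ hR0 hα hζ₀.le hs hG hE)
        (hosc.trans (mul_le_of_le_one_right (Real.exp_pos _).le hT1))
      have hTinv : 1 / T ≤ Real.exp (R / 2) / 256 := by
        have h1 := rpow_mul_exp_neg_le_Gamma (p := 4 * τ + 1) (y := R / 2) (by linarith)
          (by linarith)
        rw [show 4 * τ + 1 + 1 = 4 * τ + 2 by ring, Real.div_rpow hR0.le (by norm_num)] at h1
        have h2 : R ^ (4 * τ + 1) ≤
            2 ^ (4 * τ + 1) * Real.Gamma (4 * τ + 2) * Real.exp (R / 2) := by
          rw [div_mul_eq_mul_div, div_le_iff₀ (by positivity), Real.exp_neg,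
            ← div_eq_mul_inv, div_le_iff₀ (Real.exp_pos _)] at h1
          linarith
        have h3 : DTau τ = 256 * (2 ^ (4 * τ + 1) * Real.Gamma (4 * τ + 2)) := by
          rw [DTau, show 4 * τ + 9 = (4 * τ + 1) + (8 : ℕ) by push_cast; ring,
            Real.rpow_add (by norm_num), Real.rpow_natCast]
          ring
        have hγ3 : γ ^ 3 ≤ 1 := pow_le_one₀ hγ.le hγ1.le
        rw [hT, one_div_div, div_le_div_iff₀ hDτ (by norm_num), h3]
        have h4 : γ ^ 3 * R ^ (4 * τ + 1) ≤ 1 * R ^ (4 * τ + 1) := by gcongr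
        linarith
      have hT4 : (1 / T) ^ 4 ≤ X.norm ^ 4 := by
        have h1 : (1 / T) ^ 4 ≤ (Real.exp (R / 2) / 256) ^ 4 := by gcongr
        have h2 : (Real.exp (R / 2) / 256) ^ 4 = Real.exp (2 * R) / 256 ^ 4 := by
          rw [div_pow, ← Real.exp_nat_mul]
          congr 2
          push_cast
          ring
        rw [h2] at h1
        have : 0 < X.norm ^ 4 := by positivity
        linarith
      have h5 : X.norm ^ 10 * ζ ^ κ * X.norm ^ 4 ≤ 1 / 10 ^ 5 * X.norm ^ 4 := by
        have := mul_le_mul_of_nonneg_left hT4 (by norm_num : (0 : ℝ) ≤ 1 / 10 ^ 5)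
        calc X.norm ^ 10 * ζ ^ κ * X.norm ^ 4 = X.norm ^ 14 * ζ ^ κ := by ring
          _ ≤ _ := h'.trans this
      rw [one_pow, mul_one]
      exact le_of_mul_le_mul_right h5 (by positivity)
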